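/- Words are elements of $\{0,1\}^*$. An automata network with $n$ nodes over a finite non-empty alphabet $Q$ is a map $F:Q^n\to Q^n$. Fix, for every alphabet $Q$, an injective map $m_Q:Q\to\{0,1\}^{k_Q}$ with $k_Q\ge 1$, extended cell-wise to $Q^n$. A circuit encoding of $F$ is a Boolean circuit $C$ with $k_Qn$ inputs and $k_Qn$ outputs such that $m_Q\circ F=C\circ m_Q$ on $Q^n$. A family with a standard representation is a set $\mathcal F$ of networks over one alphabet together with a language of words $w$, each representing a network $F_w\in\mathcal F$, such that every $F\in\mathcal F$ is some $F_w$ and some deterministic logarithmic-space (DLOGSPACE) algorithm maps each such $w$ to (the canonical word for) a circuit encoding of $F_w$. A block embedding of $Q_F^{n}$ into $Q_G^{n'}$ consists of a partition $(D_i)_{i\le n}$ of the $n'$ nodes and patterns $p_{i,q}\in Q_G^{D_i}$ ($q\in Q_F$) with $p_{i,q}\neq p_{i,q'}$ for $q\ne q'$; it defines $\phi:Q_F^n\to Q_G^{n'}$ by $\phi(x)|_{D_i}=p_{i,x_i}$. A family $\mathcal F$ simulates a family $\mathcal H$ in time $T:\mathbb N\to\mathbb N$ and space $S:\mathbb N\to\mathbb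 N$ if some DLOGSPACE machine maps every word $w$ representing a network $H_w\in\mathcal H$ with $n\ge1$ nodes to a word $w'$ representing a network $F_{w'}\in\mathcal F$ with exactly $S(n)$ nodes, together with $T(n)$ and a description of a block embedding $\phi$ such that $\phi\circ H_w=F_{w'}^{\,T(n)}\circ\phi$. A family is universal if for every alphabet $Q$ and every polynomial $P$ it simulates, in polynomial time $T$ and polynomial space $S$, the family of all networks $F:Q^n\to Q^n$ having a circuit encoding of size at most $P(n)$, represented by these circuits. It is strongly universal if for every alphabet $Q$ and every $\Delta\ge1$ it simulates, in constant time $T$ and linear space $S(n)=cn$, the family $\mathcal B_{Q,\Delta}$ of all networks over $Q$ having a (directed) communication graph whose nodes all have degree (in-degree plus out-degree) at most $\Delta$, represented by such a graph and the transition tables of the local maps. Let $\mathcal G_m$ be the set of the gates $\mathrm{OR},\mathrm{AND}:\{0,1\}^i\to\{0,1\}^o$ with $i,o\in\{1,2\}$, all of whose $o$ outputs equal the maximum (for OR) or the minimum (for AND) of the $i$ inputs. A $\mathcal G_m$-network is a network over $\{0,1\}$ obtained from a finite collection of gates of $\mathcal G_m$ by wiring outputs to inputs bijectively (the wires being the nodes),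 no output of a gate being wired to an input of the same gate; at each step every node receives the value of the corresponding gate output computed from the current states of the nodes feeding that gate. Let $\Gamma(\mathcal G_m)$ be the family of all $\mathcal G_m$-networks, each represented by a communication graph of degree at most $4$ and the transition tables of its local maps. Theorem. This representation of $\Gamma(\mathcal G_m)$ is standard, and 1. $\Gamma(\mathcal G_m)$ is strongly universal; 2. $\Gamma(\mathcal G_m)$ is universal; 3. every strongly universal family of automata networks with a standard representation is universal. -/

import Mathlib

namespace AutNet

/-! ### Words over `{0,1}` and self-delimiting encodings -/

/-- Self-delimiting encoding of a binary word: each bit is preceded by `1`, the end is marked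
by `0`. -/
def encWord (w : List Bool) : List Bool :=
  w.flatMap (fun b => [true, b]) ++ [false]

/-- Self-delimiting binary encoding of a natural number. -/
def encNat (n : ℕ) : List Bool := encWord n.bits

/-! ### Logarithmic-space Turing machines with output -/

inductive Move
  | left
  | stay
  | right

/-- A deterministic Turing machine with a read-only two-way input tape, finitely many work tapes
and a write-only one-way output tape. In one step it reads the current input symbol (`none` is the
end marker on both sides of the input) and the work symbols under the heads; it either halts
(`none`) or changes state, moves the input head, writes and moves on each work tape, and possibly
appends a bit to the output. -/
structure Machine where
  State : Type
  Sym : Type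
  finState : Finite State
  finSym : Finite Sym
  tapes : ℕ
  start : State
  blank : Sym
  trans : State → Option Bool → (Fin tapes → Sym) →
    Option (State × Move × (Fin tapes → Sym × Move) × Option Bool)

namespace Machine

/-- A configuration. Work tapes are one-way infinite, with cells numbered from `0`. -/
structure Cfg (M : Machine) where
  state : M.State
  inHead : ℕ
  head : Fin M.tapes → ℕ
  tape : Fin M.tapes → ℕ → M.Sym
  out : List Bool

/-- The symbol in a cell of the input tape: the input is written in the cells `1, …, |w|`, and
the cells `0` and `|w| + 1` hold the end marker. -/
def readInput (w : List Bool) : ℕ → Option Bool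
  | 0 => none
  | p + 1 => w[p]?

/-- The input head stays between the two end markers. -/
def moveInput (w : List Bool) (p : ℕ) : Move → ℕ
  | .left => p - 1
  | .stay => p
  | .right => min (p + 1) (w.length + 1)

def moveWork (p : ℕ) : Move → ℕ
  | .left => p - 1
  | .stay => p
  | .right => p + 1

def initial (M : Machine) : M.Cfg where
  state := M.start
  inHead := 0
  head := fun _ => 0
  tape := fun _ _ => M.blank
  out := []

/-- One step on input `w`; `none` if the machine has halted. -/
def next (M : Machine) (w : List Bool) (c : M.Cfg) : Option M.Cfg :=
  (M.trans c.state (readInput w c.inHead) (fun j => c.tape j (c.head j))).map fun r =>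
    { state := r.1
      inHead := moveInput w c.inHead r.2.1
      head := fun j => moveWork (c.head j) (r.2.2.1 j).2
      tape := fun j => Function.update (c.tape j) (c.head j) (r.2.2.1 j).1
      out := c.out ++ r.2.2.2.toList }

/-- The configuration after `t` steps on input `w` (a halted machine stays as it is). -/
def run (M : Machine) (w : List Bool) (t : ℕ) : M.Cfg :=
  (fun c => (M.next w c).getD c)^[t] M.initial

end Machine

/-- `f` is computed by a Turing machine that halts on every input `w` and visits only
`O(log |w|)` cells of its work tapes. -/
def LogspaceComputable (f : List Bool → List Bool) : Prop :=
  ∃ (M : Machine) (c : ℕ), ∀ w : List Bool,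
    (∀ t j, (M.run w t).head j ≤ c * (Nat.log 2 w.length + 1)) ∧
    ∃ t, M.next w (M.run w t) = none ∧ (M.run w t).out = f w

/-! ### Boolean circuits -/

/-- A gate; operands are the numbers of earlier vertices of the circuit. -/
inductive Gate
  | const (b : Bool)
  | not (i : ℕ)
  | and (i j : ℕ)
  | or (i j : ℕ)

namespace Gate

/-- All operands are smaller than `m`. -/
def Below (m : ℕ) : Gate → Prop
  | const _ => True
  | not i => i < m
  | and i j => i < m ∧ j < m
  | or i j => i < m ∧ j < m

def eval (vals : List Bool) : Gate → Bool
  | const b => b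
  | not i => !(vals.getD i false)
  | and i j => vals.getD i false && vals.getD j false
  | or i j => vals.getD i false || vals.getD j false

def encode : Gate → List Bool
  | const b => [false, false, b]
  | not i => [false, true] ++ encNat i
  | and i j => [true, false] ++ encNat i ++ encNat j
  | or i j => [true, true] ++ encNat i ++ encNat j

end Gate

/-- A Boolean circuit with several outputs, whose vertices are numbered in a topological order:
first the inputs, then the gates. -/
structure Circuit where
  inputs : ℕ
  gates : List Gate
  outputs : List ℕ
  gates_below : ∀ (t : ℕ) (h : t < gates.length), (gates[t]).Below (inputs + t)
  outputs_below : ∀ i ∈ outputs, i < inputs + gates.length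

namespace Circuit

/-- The number of vertices. -/
def size (C : Circuit) : ℕ := C.inputs + C.gates.length

/-- The values of all vertices on an input word (of length `C.inputs`). -/
def values (C : Circuit) (x : List Bool) : List Bool :=
  C.gates.foldl (fun vals g => vals ++ [g.eval vals]) x

def eval (C : Circuit) (x : List Bool) : List Bool :=
  C.outputs.map fun i => (C.values x).getD i false

/-- The canonical representation of a circuit as a word. -/
def encode (C : Circuit) : List Bool :=
  encNat C.inputs ++ encNat C.gates.length ++ C.gates.flatMap Gate.encode ++
    encNat C.outputs.length ++ C.outputs.flatMap encNat

end Circuit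

/-! ### Automata networks, communication graphs, families and their representations -/

/-- An (abstract) automata network with `n` nodes over the alphabet `{0, …, q-1}`. -/
abbrev NetMap (q n : ℕ) : Type := (Fin n → Fin q) → (Fin n → Fin q)

/-- Automata networks over the alphabet `{0, …, q-1}`, with any finite number of nodes. -/
abbrev Network (q : ℕ) : Type := Σ n : ℕ, NetMap q n

/-- The directed graph with edge relation `E` is a communication graph of `F`. -/
def IsCommunicationGraph {q n : ℕ} (E : Fin n → Fin n → Prop) (F : NetMap q n) : Prop :=
  ∀ v, ∃ f : ({u // E u v} → Fin q) → Fin q, ∀ x, F x v = f (fun u => x u.1)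

/-- Every node of the directed graph has degree (in-degree plus out-degree) at most `Δ`. -/
def DegreeAtMost {n : ℕ} (Δ : ℕ) (E : Fin n → Fin n → Prop) : Prop :=
  ∀ v, {u | E u v}.ncard + {u | E v u}.ncard ≤ Δ

/-- For every alphabet, an injective coding of its letters by binary words of a fixed positive
length. -/
structure AlphabetCoding where
  len : ℕ → ℕ
  code : (q : ℕ) → Fin q → Fin (len q) → Bool
  len_pos : ∀ q, 0 < len q
  code_injective : ∀ q, Function.Injective (code q)

/-- The cell-wise extension of the coding to configurations. -/
def AlphabetCoding.word (m : AlphabetCoding) {q n : ℕ} (x : Fin n → Fin q) : List Bool :=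
  (List.ofFn x).flatMap fun s => List.ofFn (m.code q s)

/-- `C` is a circuit encoding of the automata network `F`. -/
def Circuit.Codes (m : AlphabetCoding) {q : ℕ} (C : Circuit) (F : Network q) : Prop :=
  C.inputs = m.len q * F.1 ∧ C.outputs.length = m.len q * F.1 ∧
    ∀ x : Fin F.1 → Fin q, C.eval (m.word x) = m.word (F.2 x)

/-- A set of automata networks over `{0, …, q-1}` together with a way of representing them by
words: `Rep w F` says that `w` is a word of the representation language and that the network
it represents is `F`. -/
structure Family (q : ℕ) where
  nets : Set (Network q)
  Rep : List Bool → Network q → Prop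

/-- The representation is a standard one: words represent members of the family, some
logarithmic-space algorithm turns each of them into a circuit encoding of the represented
network, and each member of the family is represented by some word. -/
def Family.IsStandard (m : AlphabetCoding) {q : ℕ} (A : Family q) : Prop :=
  (∃ f, LogspaceComputable f ∧ ∀ w F, A.Rep w F →
    F ∈ A.nets ∧ ∃ C : Circuit, f w = C.encode ∧ C.Codes m F) ∧
  ∀ F ∈ A.nets, ∃ w, A.Rep w F

/-- Networks that have a circuit encoding of size at most `P n`, where `n` is the number of
nodes, represented by these circuits. -/
def circuitFamily (m : AlphabetCoding) (q : ℕ) (P : Polynomial ℕ) : Family q where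
  nets := {F | ∃ C : Circuit, C.Codes m F ∧ C.size ≤ P.eval F.1}
  Rep w F := ∃ C : Circuit, w = C.encode ∧ C.Codes m F ∧ C.size ≤ P.eval F.1

/-- A directed graph on `n` nodes, given by the lists of in-neighbours, together with a local map
for each node. -/
structure LocalMaps (q n : ℕ) where
  nbr : Fin n → List (Fin n)
  nodup : ∀ v, (nbr v).Nodup
  loc : (v : Fin n) → (Fin (nbr v).length → Fin q) → Fin q

namespace LocalMaps

variable {q n : ℕ}

def Edge (R : LocalMaps q n) (u v : Fin n) : Prop := u ∈ R.nbr v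

/-- The automata network given by the local maps. -/
def net (R : LocalMaps q n) : NetMap q n :=
  fun x v => R.loc v fun i => x ((R.nbr v).get i)

/-- The number of nodes, then for each node the list of its in-neighbours and the plain
transition table of its local map. -/
def encode (R : LocalMaps q n) : List Bool :=
  encNat n ++ (List.finRange n).flatMap fun v =>
    encNat (R.nbr v).length ++ (R.nbr v).flatMap (fun u => encNat u) ++
      (List.finRange (q ^ (R.nbr v).length)).flatMap fun i =>
        encNat (R.loc v (finFunctionFinEquiv.symm i))

end LocalMaps

/-- Networks with a communication graph of degree at most `Δ`, represented by such a graph and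
the transition tables of the local maps. -/
def boundedDegreeFamily (q Δ : ℕ) : Family q where
  nets := {F | ∃ E, IsCommunicationGraph E F.2 ∧ DegreeAtMost Δ E}
  Rep w F := ∃ R : LocalMaps q F.1, w = R.encode ∧ R.net = F.2 ∧ DegreeAtMost Δ R.Edge

/-! ### Simulation and universality -/

/-- A block embedding of `{0,…,q-1}^n` into `{0,…,a-1}^k`: node `u` belongs to the block of the
node `block u`, and carries the letter `pat u s` in the pattern of this block for state `s`.
The blocks form a partition, and the patterns of a block for different states are different. -/
structure BlockEmbedding (q n a k : ℕ) where
  block : Fin k → Fin n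
  block_surjective : Function.Surjective block
  pat : Fin k → Fin q → Fin a
  inj : ∀ (i : Fin n) (s s' : Fin q), (∀ u, block u = i → pat u s = pat u s') → s = s'

namespace BlockEmbedding

variable {q n a k : ℕ}

/-- The map on configurations defined by a block embedding. -/
def map (E : BlockEmbedding q n a k) (x : Fin n → Fin q) : Fin k → Fin a :=
  fun u => E.pat u (x (E.block u))

/-- The representation of a block embedding as a word. -/
def encode (E : BlockEmbedding q n a k) : List Bool :=
  encNat n ++ encNat k ++ (List.finRange k).flatMap fun u =>
    encNat (E.block u) ++ (List.finRange q).flatMap fun s => encNat (E.pat u s)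

end BlockEmbedding

/-- `A` simulates `H` in time `T` and space `S`: a logarithmic-space machine turns every word
representing a network `F` of `H` with `n > 0` nodes into a word representing a network `G` of `A`
with `S n` nodes, the number `T n`, and a block embedding `E` with `E ∘ F = G ^ (T n) ∘ E`. -/
def Simulates {a q : ℕ} (A : Family a) (H : Family q) (T S : ℕ → ℕ) : Prop :=
  ∃ M, LogspaceComputable M ∧ ∀ w F, H.Rep w F → 0 < F.1 →
    ∃ (w' : List Bool) (G : Network a) (E : BlockEmbedding q F.1 a G.1),
      M w = encWord w' ++ encNat (T F.1) ++ E.encode ∧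
      A.Rep w' G ∧ G.1 = S F.1 ∧
      ∀ x, E.map (F.2 x) = (G.2)^[T F.1] (E.map x)

/-- Simulation of every family of circuit-represented networks of polynomial size, in polynomial
time and space. -/
def Universal (m : AlphabetCoding) {a : ℕ} (A : Family a) : Prop :=
  ∀ q, 1 ≤ q → ∀ P : Polynomial ℕ, ∃ T S : Polynomial ℕ,
    Simulates A (circuitFamily m q P) (fun n => T.eval n) (fun n => S.eval n)

/-- Simulation of every family of networks of bounded degree, in constant time and linear
space. -/
def StronglyUniversal {a : ℕ} (A : Family a) : Prop :=
  ∀ q, 1 ≤ q → ∀ Δ, 1 ≤ Δ → ∃ t c : ℕ,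
    Simulates A (boundedDegreeFamily q Δ) (fun _ => t) (fun n => c * n)

/-! ### Networks built from a set of gates -/

/-- A map `Q^ins → Q^outs` over the alphabet `Q = {0, …, q-1}`. -/
structure LocalGate (q : ℕ) where
  ins : ℕ
  outs : ℕ
  map : (Fin ins → Fin q) → (Fin outs → Fin q)

/-- `F` is obtained from a finite collection of gates from `𝒢` by wiring, bijectively, outputs to
inputs, where no output of a gate is wired to an input of the same gate. -/
def IsGateNetwork {q : ℕ} (𝒢 : Set (LocalGate q)) (F : Network q) : Prop :=
  ∃ (N : ℕ) (g : Fin N → LocalGate q)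
    (α : (Σ j, Fin (g j).ins) ≃ Fin F.1) (β : Fin F.1 ≃ (Σ j, Fin (g j).outs)),
    (∀ j, g j ∈ 𝒢) ∧ (∀ p, (β (α p)).1 ≠ p.1) ∧
    ∀ x v, F.2 x v = (g (β v).1).map (fun k => x (α ⟨(β v).1, k⟩)) (β v).2

/-- All networks built from gates of `𝒢`, represented as networks of degree at most `Δ`. -/
def gateFamily {q : ℕ} (𝒢 : Set (LocalGate q)) (Δ : ℕ) : Family q where
  nets := {F | IsGateNetwork 𝒢 F}
  Rep w F := IsGateNetwork 𝒢 F ∧ (boundedDegreeFamily q Δ).Rep w F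

/-- All `o` outputs are the maximum of the `i` inputs. -/
noncomputable def orGate (i o : ℕ) : LocalGate 2 := ⟨i, o, fun x _ => Finset.univ.sup x⟩

/-- All `o` outputs are the minimum of the `i` inputs. -/
noncomputable def andGate (i o : ℕ) : LocalGate 2 := ⟨i, o, fun x _ => Finset.univ.inf x⟩

/-- The monotone gates: AND and OR with one or two inputs and one or two outputs. -/
def monotoneGates : Set (LocalGate 2) :=
  {g | ∃ i o : ℕ, (i = 1 ∨ i = 2) ∧ (o = 1 ∨ o = 2) ∧ (g = orGate i o ∨ g = andGate i o)}

/-- Networks of monotone gates. Each node has at most two in-neighbours and at most two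
out-neighbours, hence degree at most `4`. -/
def monotoneFamily : Family 2 := gateFamily monotoneGates 4

end AutNet

namespace AutNet

/-! ### Structured programs for Turing machines -/

/-- The memory of a Turing machine with infinitely many work tapes. -/
structure Store where
  pos : ℕ
  head : ℕ → ℕ
  tape : ℕ → ℕ → Option Bool
  out : List Bool

inductive Act
  | input (m : Move)
  | write (j : ℕ) (s : Option Bool)
  | shift (j : ℕ) (m : Move)
  | emit (b : Bool)

inductive Test
  | input (f : Option Bool → Bool)
  | work (j : ℕ) (f : Option Bool → Bool)

inductive Prog
  | skip
  | act (a : Act)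
  | seq (p q : Prog)
  | ite (t : Test) (p q : Prog)
  | loop (t : Test) (p : Prog)

def Act.apply (w : List Bool) : Act → Store → Store
  | input m, σ => { σ with pos := Machine.moveInput w σ.pos m }
  | write j s, σ =>
      { σ with tape := Function.update σ.tape j (Function.update (σ.tape j) (σ.head j) s) }
  | shift j m, σ => { σ with head := Function.update σ.head j (Machine.moveWork (σ.head j) m) }
  | emit b, σ => { σ with out := σ.out ++ [b] }

def Test.eval (inp : Option Bool) (sym : ℕ → Option Bool) : Test → Bool
  | input f => f inp
  | work j f => f (sym j)

def Test.holds (w : List Bool) (t : Test) (σ : Store) : Bool :=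
  t.eval (Machine.readInput w σ.pos) (fun j => σ.tape j (σ.head j))

/-- Execution of a program; all work heads stay in the cells `0, …, B`. -/
inductive Runs (w : List Bool) (B : ℕ) : Prog → Store → Store → Prop
  | skip (σ) : Runs w B .skip σ σ
  | act (a : Act) (σ) : (∀ j, (a.apply w σ).head j ≤ B) → Runs w B (.act a) σ (a.apply w σ)
  | seq {p q σ σ' σ''} : Runs w B p σ σ' → Runs w B q σ' σ'' → Runs w B (.seq p q) σ σ''
  | iteT {t p q σ σ'} : t.holds w σ = true → Runs w B p σ σ' → Runs w B (.ite t p q) σ σ'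
  | iteF {t p q σ σ'} : t.holds w σ = false → Runs w B q σ σ' → Runs w B (.ite t p q) σ σ'
  | loopT {t p σ σ' σ''} : t.holds w σ = true → Runs w B p σ σ' →
      Runs w B (.loop t p) σ' σ'' → Runs w B (.loop t p) σ σ''
  | loopF {t p σ} : t.holds w σ = false → Runs w B (.loop t p) σ σ

theorem Runs.mono {w : List Bool} {B B' : ℕ} (h : B ≤ B') {p : Prog} {σ σ' : Store}
    (hr : Runs w B p σ σ') : Runs w B' p σ σ' := by
  induction hr with
  | skip σ => exact .skip σ
  | act a σ ha => exact .act a σ fun j => (ha j).trans h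
  | seq _ _ h1 h2 => exact .seq h1 h2
  | iteT ht _ h1 => exact .iteT ht h1
  | iteF ht _ h1 => exact .iteF ht h1
  | loopT ht _ _ h1 h2 => exact .loopT ht h1 h2
  | loopF ht => exact .loopF ht

namespace Prog

/-- The control part of a step: what remains to be executed. -/
def next (inp : Option Bool) (sym : ℕ → Option Bool) : List Prog → List Prog
  | [] => []
  | skip :: K => K
  | act _ :: K => K
  | seq p q :: K => p :: q :: K
  | ite t p q :: K => if t.eval inp sym then p :: K else q :: K
  | loop t p :: K => if t.eval inp sym then p :: loop t p :: K else K

/-- The memory operation of a step. -/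
def action : List Prog → Option Act
  | act a :: _ => some a
  | _ => none

/-- The continuations that can occur while `p` is executed before `K`. -/
def conts : Prog → List Prog → Set (List Prog)
  | skip, K => {skip :: K, K}
  | act a, K => {act a :: K, K}
  | seq p q, K => {seq p q :: K} ∪ (conts p (q :: K) ∪ conts q K)
  | ite t p q, K => {ite t p q :: K} ∪ (conts p K ∪ conts q K)
  | loop t p, K => {loop t p :: K, K} ∪ conts p (loop t p :: K)

theorem conts_finite (p : Prog) (K : List Prog) : (conts p K).Finite := by
  induction p generalizing K with
  | skip => simp [conts]
  | act a => simp [conts]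
  | seq p q hp hq => exact (Set.finite_singleton _).union ((hp _).union (hq _))
  | ite t p q hp hq => exact (Set.finite_singleton _).union ((hp _).union (hq _))
  | loop t p hp => exact (Set.toFinite _).union (hp _)

theorem cons_mem_conts (p : Prog) (K : List Prog) : p :: K ∈ conts p K := by
  cases p <;> simp [conts]

theorem mem_conts (p : Prog) (K : List Prog) : K ∈ conts p K := by
  induction p generalizing K <;> simp_all [conts]

/-- The tests of the program look at the tapes `0, …, k-1` only. -/
def Width (k : ℕ) : Prog → Prop
  | skip => True
  | act _ => True
  | seq p q => p.Width k ∧ q.Width k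
  | ite t p q => (∀ j f, t = .work j f → j < k) ∧ p.Width k ∧ q.Width k
  | loop t p => (∀ j f, t = .work j f → j < k) ∧ p.Width k

theorem Width.mono {k l : ℕ} (h : k ≤ l) {p : Prog} (hp : p.Width k) : p.Width l := by
  induction p with
  | skip => trivial
  | act a => trivial
  | seq p q ihp ihq => exact ⟨ihp hp.1, ihq hp.2⟩
  | ite t p q ihp ihq => exact ⟨fun j f e => (hp.1 j f e).trans_le h, ihp hp.2.1, ihq hp.2.2⟩
  | loop t p ihp => exact ⟨fun j f e => (hp.1 j f e).trans_le h, ihp hp.2⟩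

theorem exists_width (p : Prog) : ∃ k, p.Width k := by
  have ht : ∀ t : Test, ∃ k, ∀ j f, t = .work j f → j < k := by
    rintro (f | ⟨j, f⟩)
    · exact ⟨0, fun j f h => by simp at h⟩
    · exact ⟨j + 1, fun j' f' h => by injection h with h1; omega⟩
  induction p with
  | skip => exact ⟨0, trivial⟩
  | act a => exact ⟨0, trivial⟩
  | seq p q ihp ihq =>
    obtain ⟨k, hk⟩ := ihp
    obtain ⟨l, hl⟩ := ihq
    exact ⟨max k l, hk.mono (le_max_left _ _), hl.mono (le_max_right _ _)⟩
  | ite t p q ihp ihq =>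
    obtain ⟨k, hk⟩ := ihp
    obtain ⟨l, hl⟩ := ihq
    obtain ⟨m, hm⟩ := ht t
    exact ⟨max m (max k l), fun j f e => (hm j f e).trans_le (le_max_left _ _),
      hk.mono ((le_max_left _ _).trans (le_max_right _ _)),
      hl.mono ((le_max_right _ _).trans (le_max_right _ _))⟩
  | loop t p ihp =>
    obtain ⟨k, hk⟩ := ihp
    obtain ⟨m, hm⟩ := ht t
    exact ⟨max m k, fun j f e => (hm j f e).trans_le (le_max_left _ _),
      hk.mono (le_max_right _ _)⟩

def inMove : Option Act → Move
  | some (.input m) => m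
  | _ => .stay

def workOp (a : Option Act) (j : ℕ) (s : Option Bool) : Option Bool × Move :=
  match a with
  | some (.write i s') => if j = i then (s', .stay) else (s, .stay)
  | some (.shift i m) => if j = i then (s, m) else (s, .stay)
  | _ => (s, .stay)

def outBit : Option Act → Option Bool
  | some (.emit b) => some b
  | _ => none

open Classical in
/-- The Turing machine with `k` work tapes that executes a program. -/
noncomputable def machine (p : Prog) (k : ℕ) : Machine where
  State := {K // K ∈ conts p []}
  Sym := Option Bool
  finState := (conts_finite p []).to_subtype
  finSym := inferInstance
  tapes := k
  start := ⟨[p], cons_mem_conts p []⟩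
  blank := none
  trans K inp syms :=
    if K.1 = [] then none
    else if h : next inp (fun j => if h : j < k then syms ⟨j, h⟩ else none) K.1 ∈ conts p [] then
      some (⟨_, h⟩, inMove (action K.1), fun j => workOp (action K.1) j (syms j),
        outBit (action K.1))
    else none

variable {p : Prog} {k : ℕ}

/-- The configuration of the machine given by a continuation and a memory. -/
def cfg (K : {K // K ∈ conts p []}) (σ : Store) : (machine p k).Cfg where
  state := K
  inHead := σ.pos
  head j := σ.head j
  tape j := σ.tape j
  out := σ.out

def applyOpt (w : List Bool) (a : Option Act) (σ : Store) : Store :=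
  a.elim σ fun a => a.apply w σ

theorem machine_next {w : List Bool} {K K' : {K // K ∈ conts p []}} {σ : Store} (h0 : K.1 ≠ [])
    (h : next (Machine.readInput w σ.pos)
      (fun j => if j < k then σ.tape j (σ.head j) else none) K.1 = K'.1) :
    (machine p k).next w (cfg K σ) = some (cfg K' (applyOpt w (action K.1) σ)) := by
  obtain ⟨K', hK'⟩ := K'
  simp only at h
  subst h
  have hK : (next (Machine.readInput w σ.pos)
      (fun j => if h : j < k then σ.tape j (σ.head j) else none) K.1) ∈ conts p [] := by
    simpa using hK'
  simp only [Machine.next, machine, cfg, h0, if_false, dif_pos hK, Option.map_some]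
  congr 1
  cases ha : action K.1 with
  | none =>
    simp only [applyOpt, workOp, outBit, inMove, Machine.moveInput, Machine.moveWork]
    simp
  | some a =>
    cases a with
    | input m => simp [applyOpt, Act.apply, workOp, outBit, inMove, Machine.moveWork]
    | write j s =>
      simp only [applyOpt, Act.apply, workOp, outBit, inMove, Machine.moveWork, Machine.moveInput]
      simp only [Option.elim, Option.toList, List.append_nil, dite_eq_ite, Machine.Cfg.mk.injEq,
        true_and, and_true]
      refine ⟨funext fun i => by split_ifs <;> rfl, funext fun i => ?_⟩
      by_cases hi : (i : ℕ) = j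
      · subst hi; simp
      · simp [hi]
    | shift j m =>
      simp only [applyOpt, Act.apply, workOp, outBit, inMove, Machine.moveWork, Machine.moveInput]
      simp only [Option.elim, Option.toList, List.append_nil, dite_eq_ite, Machine.Cfg.mk.injEq,
        true_and, and_true]
      refine ⟨funext fun i => ?_, funext fun i => by split_ifs <;> simp⟩
      by_cases hi : (i : ℕ) = j
      · subst hi; simp
      · simp [hi]
    | emit b =>
      simp [applyOpt, Act.apply, workOp, outBit, inMove, Machine.moveWork, Machine.moveInput]

end Prog

/-- Computations of a machine whose work heads stay in the cells `0, …, B`. -/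
inductive Machine.Steps (M : Machine) (w : List Bool) (B : ℕ) : M.Cfg → M.Cfg → Prop
  | refl (c) : Steps M w B c c
  | step {c c' c''} : M.next w c = some c' → (∀ j, c'.head j ≤ B) → Steps M w B c' c'' →
      Steps M w B c c''

theorem Machine.Steps.trans {M : Machine} {w : List Bool} {B : ℕ} {c c' c'' : M.Cfg}
    (h : M.Steps w B c c') (h' : M.Steps w B c' c'') : M.Steps w B c c'' := by
  induction h with
  | refl => exact h'
  | step h1 h2 _ ih => exact .step h1 h2 (ih h')

theorem Machine.Steps.halts {M : Machine} {w : List Bool} {B : ℕ} {c c' : M.Cfg}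
    (h : M.Steps w B c c') (h0 : ∀ j, c.head j ≤ B) (hc : M.next w c' = none) :
    (∀ t j, ((fun c => (M.next w c).getD c)^[t] c).head j ≤ B) ∧
      ∃ t, (fun c => (M.next w c).getD c)^[t] c = c' := by
  induction h with
  | refl c =>
    refine ⟨fun t => ?_, 0, rfl⟩
    rw [Function.iterate_fixed (by simp [hc])]
    exact h0
  | step h1 h2 _ ih =>
    obtain ⟨ih1, t, ht⟩ := ih h2 hc
    refine ⟨fun s => ?_, t + 1, ?_⟩
    · cases s with
      | zero => exact h0
      | succ s => simpa [Function.iterate_succ_apply, h1] using ih1 s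
    · simpa [Function.iterate_succ_apply, h1] using ht

open Prog in
theorem Runs.steps {w : List Bool} {B k : ℕ} {P p : Prog} {σ σ' : Store} (h : Runs w B p σ σ')
    (hw : p.Width k) (hσ : ∀ j, σ.head j ≤ B) (K : List Prog) (hK : conts p K ⊆ conts P []) :
    (∀ j, σ'.head j ≤ B) ∧ (machine P k).Steps w B
      (cfg ⟨p :: K, hK (cons_mem_conts p K)⟩ σ) (cfg ⟨K, hK (mem_conts p K)⟩ σ') := by
  induction h generalizing K with
  | skip σ =>
    refine ⟨hσ, .step (machine_next (K' := ⟨K, hK (mem_conts _ K)⟩) (by simp) ?_) ?_ (.refl _)⟩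
    · simp [next]
    · exact fun j => hσ j
  | act a σ ha =>
    refine ⟨ha, .step (machine_next (K' := ⟨K, hK (mem_conts _ K)⟩) (by simp) ?_) ?_ (.refl _)⟩
    · simp [next]
    · exact fun j => ha j
  | @seq p q σ σ' σ'' _ _ ihp ihq =>
    have hp : conts p (q :: K) ⊆ conts P [] := fun x hx => hK (by simp [conts, hx])
    have hq : conts q K ⊆ conts P [] := fun x hx => hK (by simp [conts, hx])
    obtain ⟨h1, s1⟩ := ihp hw.1 hσ _ hp
    obtain ⟨h2, s2⟩ := ihq hw.2 h1 _ hq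
    refine ⟨h2, .step (machine_next (K' := ⟨p :: q :: K, hp (cons_mem_conts _ _)⟩) (by simp) ?_)
      ?_ (s1.trans s2)⟩
    · simp [next]
    · exact fun j => hσ j
  | @iteT t p q σ σ' ht _ ih =>
    have hp : conts p K ⊆ conts P [] := fun x hx => hK (by simp [conts, hx])
    obtain ⟨h1, s1⟩ := ih hw.2.1 hσ _ hp
    refine ⟨h1, .step (machine_next (K' := ⟨p :: K, hp (cons_mem_conts _ _)⟩) (by simp) ?_)
      ?_ s1⟩
    · have : t.eval (Machine.readInput w σ.pos)
          (fun j => if j < k then σ.tape j (σ.head j) else none) = true := by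
        rw [← ht]
        cases t with
        | input f => rfl
        | work j f => simp [Test.eval, Test.holds, hw.1 j f rfl]
      simp [next, this]
    · exact fun j => hσ j
  | @iteF t p q σ σ' ht _ ih =>
    have hp : conts q K ⊆ conts P [] := fun x hx => hK (by simp [conts, hx])
    obtain ⟨h1, s1⟩ := ih hw.2.2 hσ _ hp
    refine ⟨h1, .step (machine_next (K' := ⟨q :: K, hp (cons_mem_conts _ _)⟩) (by simp) ?_)
      ?_ s1⟩
    · have : t.eval (Machine.readInput w σ.pos)
          (fun j => if j < k then σ.tape j (σ.head j) else none) = false := by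
        rw [← ht]
        cases t with
        | input f => rfl
        | work j f => simp [Test.eval, Test.holds, hw.1 j f rfl]
      simp [next, this]
    · exact fun j => hσ j
  | @loopT t p σ σ' σ'' ht _ _ ih1 ih2 =>
    have hp : conts p (loop t p :: K) ⊆ conts P [] := fun x hx => hK (by simp [conts, hx])
    obtain ⟨h1, s1⟩ := ih1 hw.2 hσ _ hp
    obtain ⟨h2, s2⟩ := ih2 hw h1 _ hK
    refine ⟨h2, .step (machine_next (K' := ⟨p :: loop t p :: K, hp (cons_mem_conts _ _)⟩)
      (by simp) ?_) ?_ (s1.trans s2)⟩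
    · have : t.eval (Machine.readInput w σ.pos)
          (fun j => if j < k then σ.tape j (σ.head j) else none) = true := by
        rw [← ht]
        cases t with
        | input f => rfl
        | work j f => simp [Test.eval, Test.holds, hw.1 j f rfl]
      simp [next, this]
    · exact fun j => hσ j
  | @loopF t p σ ht =>
    refine ⟨hσ, .step (machine_next (K' := ⟨K, hK (mem_conts _ K)⟩) (by simp) ?_) ?_ (.refl _)⟩
    · have : t.eval (Machine.readInput w σ.pos)
          (fun j => if j < k then σ.tape j (σ.head j) else none) = false := by
        rw [← ht]
        cases t with
        | input f => rfl
        | work j f => simp [Test.eval, Test.holds, hw.1 j f rfl]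
      simp [next, this]
    · exact fun j => hσ j

/-- The memory at the start of a computation. -/
def Store.empty : Store := ⟨0, fun _ => 0, fun _ _ => none, []⟩

theorem LogspaceComputable.of_runs {f : List Bool → List Bool} (p : Prog) (c : ℕ)
    (h : ∀ w, ∃ σ, Runs w (c * (Nat.log 2 w.length + 1)) p .empty σ ∧ σ.out = f w) :
    LogspaceComputable f := by
  obtain ⟨k, hk⟩ := p.exists_width
  refine ⟨p.machine k, c, fun w => ?_⟩
  obtain ⟨σ, hσ, ho⟩ := h w
  obtain ⟨-, hs⟩ := hσ.steps (P := p) hk (fun j => Nat.zero_le _) [] subset_rfl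
  have hn : (p.machine k).next w (Prog.cfg ⟨[], Prog.mem_conts p []⟩ σ) = none := by
    simp [Machine.next, Prog.machine, Prog.cfg]
  obtain ⟨h1, t, ht⟩ := hs.halts (fun j => Nat.zero_le _) hn
  exact ⟨h1, t, by rw [Machine.run]; exact (congrArg _ ht).trans hn, by
    rw [Machine.run]; exact (congrArg _ ht).trans ho⟩

end AutNet

namespace AutNet

/-! ### Binary counters on work tapes -/

/-- A tape with a blank in the cell `0`, followed by the bits of a list. -/
def tapeOf (l : List Bool) : ℕ → Option Bool
  | 0 => none
  | i + 1 => l[i]?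

/-- Replace the contents and the head position of the work tape `j`. -/
def Store.put (σ : Store) (j h : ℕ) (l : List Bool) : Store :=
  { σ with head := Function.update σ.head j h, tape := Function.update σ.tape j (tapeOf l) }

abbrev Prog.mv (j : ℕ) (m : Move) : Prog := .act (.shift j m)

abbrev Prog.wr (j : ℕ) (s : Option Bool) : Prog := .act (.write j s)

theorem update_tapeOf (pre suf : List Bool) (b b' : Bool) :
    Function.update (tapeOf (pre ++ b :: suf)) (pre.length + 1) (some b') =
      tapeOf (pre ++ b' :: suf) := by
  funext i
  rcases i with _ | i
  · simp [tapeOf]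
  · by_cases h : i = pre.length
    · subst h; simp [tapeOf]
    · rw [Function.update_of_ne (by simpa using h)]
      simp only [tapeOf, List.getElem?_append]
      split_ifs with h1
      · rfl
      · obtain ⟨k, hk⟩ : ∃ k, i - pre.length = k + 1 := ⟨i - pre.length - 1, by omega⟩
        simp [hk]

theorem update_tapeOf_end (pre : List Bool) (b : Bool) :
    Function.update (tapeOf pre) (pre.length + 1) (some b) = tapeOf (pre ++ [b]) := by
  funext i
  rcases i with _ | i
  · simp [tapeOf]
  · by_cases h : i = pre.length
    · subst h; simp [tapeOf]
    · rw [Function.update_of_ne (by simpa using h)]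
      simp only [tapeOf, List.getElem?_append]
      split_ifs with h1
      · rfl
      · rw [List.getElem?_eq_none (by omega), List.getElem?_eq_none (by simp; omega)]

theorem update_tapeOf_none (pre : List Bool) (b : Bool) :
    Function.update (tapeOf (pre ++ [b])) (pre.length + 1) none = tapeOf pre := by
  funext i
  rcases i with _ | i
  · simp [tapeOf]
  · by_cases h : i = pre.length
    · subst h; simp [tapeOf]
    · rw [Function.update_of_ne (by simpa using h)]
      simp only [tapeOf, List.getElem?_append]
      split_ifs with h1
      · rfl
      · rw [List.getElem?_eq_none (by simp; omega), List.getElem?_eq_none (by omega)]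

theorem Runs.put_shift {w : List Bool} {B : ℕ} {σ : Store} (hσ : ∀ j, σ.head j ≤ B) (j : ℕ)
    {h : ℕ} {l : List Bool} (m : Move) (hB : Machine.moveWork h m ≤ B) :
    Runs w B (.mv j m) (σ.put j h l) (σ.put j (Machine.moveWork h m) l) := by
  have := Runs.act (w := w) (B := B) (.shift j m) (σ.put j h l) (fun i => by
    simp only [Act.apply, Store.put]
    by_cases hi : i = j
    · subst hi; simpa using hB
    · simpa [hi] using hσ i)
  simpa [Act.apply, Store.put] using this

theorem Runs.put_write {w : List Bool} {B : ℕ} {σ : Store} (hσ : ∀ j, σ.head j ≤ B) (j : ℕ)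
    {h : ℕ} {l l' : List Bool} (s : Option Bool) (hB : h ≤ B)
    (hl : Function.update (tapeOf l) h s = tapeOf l') :
    Runs w B (.wr j s) (σ.put j h l) (σ.put j h l') := by
  have := Runs.act (w := w) (B := B) (.write j s) (σ.put j h l) (fun i => by
    simp only [Act.apply, Store.put]
    by_cases hi : i = j
    · subst hi; simpa using hB
    · simpa [hi] using hσ i)
  simpa [Act.apply, Store.put, hl] using this

theorem Test.holds_put (w : List Bool) (σ : Store) (j : ℕ) (f : Option Bool → Bool) (h : ℕ)
    (l : List Bool) : (Test.work j f).holds w (σ.put j h l) = f (tapeOf l h) := by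
  simp [Test.holds, Test.eval, Store.put]

theorem tapeOf_append (pre suf : List Bool) :
    tapeOf (pre ++ suf) (pre.length + 1) = suf.head? := by
  cases suf <;> simp [tapeOf]

theorem bits_length_mono {m n : ℕ} (h : m ≤ n) : m.bits.length ≤ n.bits.length := by
  rw [Nat.size_eq_bits_len, Nat.size_eq_bits_len]
  exact Nat.size_le_size h

/-- Move the head of a counter back to the cell `0`. -/
def Prog.home (j : ℕ) : Prog :=
  .seq (.mv j .left) (.loop (.work j Option.isSome) (.mv j .left))

/-- Propagate a carry. -/
def Prog.carry (j : ℕ) : Prog :=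
  .seq (.loop (.work j (· == some true)) (.seq (.wr j (some false)) (.mv j .right)))
    (.wr j (some true))

/-- Propagate a borrow. -/
def Prog.borrow (j : ℕ) : Prog :=
  .seq (.loop (.work j (· == some false)) (.seq (.wr j (some true)) (.mv j .right)))
    (.seq (.wr j (some false)) (.seq (.mv j .right)
      (.ite (.work j Option.isSome) .skip (.seq (.mv j .left) (.wr j none)))))

/-- Increment a counter. -/
def Prog.inc (j : ℕ) : Prog := .seq (.mv j .right) (.seq (.carry j) (.home j))

/-- Decrement a positive counter. -/
def Prog.dec (j : ℕ) : Prog := .seq (.mv j .right) (.seq (.borrow j) (.home j))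

section

variable {w : List Bool} {B : ℕ} {σ : Store}

theorem Runs.home (hσ : ∀ j, σ.head j ≤ B) (j : ℕ) {h : ℕ} {l : List Bool} (hl : h ≤ l.length + 1)
    (hB : h ≤ B) : Runs w B (.home j) (σ.put j h l) (σ.put j 0 l) := by
  refine .seq (.put_shift hσ j .left (by simp [Machine.moveWork]; omega)) ?_
  have key : ∀ h ≤ l.length, h ≤ B → Runs w B (.loop (.work j Option.isSome) (.mv j .left))
      (σ.put j h l) (σ.put j 0 l) := by
    intro h
    induction h with
    | zero => exact fun _ _ => .loopF (by simp [Test.holds_put, tapeOf])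
    | succ h ih =>
      intro hl hB
      refine .loopT ?_ (.put_shift hσ j .left (by simp [Machine.moveWork]; omega))
        (ih (by omega) (by omega))
      rw [Test.holds_put]
      simp [tapeOf]; omega
  exact key _ (by simp [Machine.moveWork]; omega) (by simp [Machine.moveWork]; omega)

theorem Runs.carry (hσ : ∀ j, σ.head j ≤ B) (j n : ℕ) (pre : List Bool)
    (hB : pre.length + (n + 1).bits.length ≤ B) :
    ∃ h ≤ pre.length + (n + 1).bits.length,
      Runs w B (.carry j) (σ.put j (pre.length + 1) (pre ++ n.bits))
        (σ.put j h (pre ++ (n + 1).bits)) := by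
  induction n using Nat.strong_induction_on generalizing pre with
  | _ n ih =>
  obtain ⟨m, rfl | rfl⟩ := n.even_or_odd'
  · rw [Nat.bit1_bits] at hB ⊢
    refine ⟨pre.length + 1, by simp, ?_⟩
    rcases Nat.eq_zero_or_pos m with rfl | hm
    · refine .seq (.loopF ?_) (.put_write hσ j _ (by simp at hB; omega) ?_)
      · rw [Test.holds_put]; simp [tapeOf]
      · simpa using update_tapeOf_end pre true
    · rw [Nat.bit0_bits _ (by omega)]
      refine .seq (.loopF ?_) (.put_write hσ j _ (by simp at hB; omega) (update_tapeOf _ _ _ _))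
      rw [Test.holds_put, tapeOf_append]; rfl
  · have e : (2 * m + 1 + 1).bits = false :: (m + 1).bits := by
      rw [← Nat.bit0_bits _ (by omega)]; ring_nf
    rw [e] at hB ⊢
    rw [Nat.bit1_bits]
    have hle : 1 ≤ (m + 1).bits.length :=
      bits_length_mono (m := 1) (n := m + 1) (by omega)
    simp only [List.length_cons] at hB
    obtain ⟨h, hh, hr⟩ := ih m (by omega) (pre ++ [false]) (by simp; omega)
    refine ⟨h, by simp at hh ⊢; omega, ?_⟩
    simp only [List.append_assoc, List.cons_append, List.nil_append, List.length_append,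
      List.length_cons, List.length_nil] at hr
    cases hr with
    | seq h1 h2 =>
      refine .seq (.loopT ?_ (.seq (.put_write hσ j _ (by omega) (update_tapeOf _ _ _ false))
        (.put_shift hσ j .right (by simp [Machine.moveWork]; omega))) h1) h2
      rw [Test.holds_put, tapeOf_append]; rfl

theorem Runs.borrow (hσ : ∀ j, σ.head j ≤ B) (j n : ℕ) (pre : List Bool)
    (hB : pre.length + (n + 1).bits.length + 1 ≤ B) :
    ∃ h ≤ pre.length + n.bits.length + 1, h ≤ B ∧
      Runs w B (.borrow j) (σ.put j (pre.length + 1) (pre ++ (n + 1).bits))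
        (σ.put j h (pre ++ n.bits)) := by
  induction n using Nat.strong_induction_on generalizing pre with
  | _ n ih =>
  obtain ⟨m, rfl | rfl⟩ := n.even_or_odd'
  · rw [Nat.bit1_bits] at hB ⊢
    simp only [List.length_cons] at hB
    rcases Nat.eq_zero_or_pos m with rfl | hm
    · refine ⟨pre.length + 1, by simp, by omega, ?_⟩
      refine .seq (.loopF ?_) (.seq (.put_write hσ j _ (by omega) (update_tapeOf _ _ _ _))
        (.seq (.put_shift hσ j .right (by simp [Machine.moveWork]; omega)) (.iteF ?_
          (.seq (.put_shift hσ j .left (by simp [Machine.moveWork]; omega))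
            (.put_write hσ j _ (by simp [Machine.moveWork]; omega) ?_)))))
      · rw [Test.holds_put, tapeOf_append]; rfl
      · rw [Test.holds_put]; simp [tapeOf, Machine.moveWork]
      · simpa [Machine.moveWork] using update_tapeOf_none pre false
    · have hle : 1 ≤ m.bits.length := bits_length_mono (m := 1) (n := m) (by omega)
      rw [Nat.bit0_bits _ (by omega)]
      refine ⟨pre.length + 2, by simp, by omega, ?_⟩
      refine .seq (.loopF ?_) (.seq (.put_write hσ j _ (by omega) (update_tapeOf _ _ _ _))
        (.seq (.put_shift hσ j .right (by simp [Machine.moveWork]; omega)) (.iteT ?_ (.skip _))))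
      · rw [Test.holds_put, tapeOf_append]; rfl
      · rw [Test.holds_put]; simp [tapeOf, Machine.moveWork]; omega
  · have e : (2 * m + 1 + 1).bits = false :: (m + 1).bits := by
      rw [← Nat.bit0_bits _ (by omega)]; ring_nf
    rw [e] at hB ⊢
    rw [Nat.bit1_bits]
    simp only [List.length_cons] at hB
    obtain ⟨h, hh, hh', hr⟩ := ih m (by omega) (pre ++ [true]) (by simp; omega)
    refine ⟨h, by simp at hh ⊢; omega, hh', ?_⟩
    simp only [List.append_assoc, List.cons_append, List.nil_append, List.length_append,
      List.length_cons, List.length_nil] at hr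
    cases hr with
    | seq h1 h2 =>
      refine .seq (.loopT ?_ (.seq (.put_write hσ j _ (by omega) (update_tapeOf _ _ _ true))
        (.put_shift hσ j .right (by simp [Machine.moveWork]; omega))) h1) h2
      rw [Test.holds_put, tapeOf_append]; rfl

theorem Runs.inc (hσ : ∀ j, σ.head j ≤ B) (j n : ℕ) (hB : (n + 1).bits.length ≤ B) :
    Runs w B (.inc j) (σ.put j 0 n.bits) (σ.put j 0 (n + 1).bits) := by
  obtain ⟨h, h1, h2⟩ := Runs.carry (w := w) hσ j n [] (by simpa using hB)
  have hle : 1 ≤ (n + 1).bits.length := bits_length_mono (m := 1) (n := n + 1) (by omega)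
  simp only [List.length_nil, List.nil_append, zero_add] at h1 h2
  exact .seq (.put_shift hσ j .right (by simp [Machine.moveWork]; omega))
    (.seq h2 (.home hσ j (by omega) (by omega)))

theorem Runs.dec (hσ : ∀ j, σ.head j ≤ B) (j n : ℕ) (hB : (n + 1).bits.length + 1 ≤ B) :
    Runs w B (.dec j) (σ.put j 0 (n + 1).bits) (σ.put j 0 n.bits) := by
  obtain ⟨h, h1, h2, h3⟩ := Runs.borrow (w := w) hσ j n [] (by simpa using hB)
  simp only [List.length_nil, List.nil_append, zero_add] at h1 h3
  exact .seq (.put_shift hσ j .right (by simp [Machine.moveWork]; omega))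
    (.seq h3 (.home hσ j (by omega) (by omega)))

end

/-! ### Programs with counters -/

/-- The memory with given counter values. -/
def Store.ofCounters (v : ℕ → ℕ) (p : ℕ) (o : List Bool) : Store :=
  ⟨p, fun _ => 0, fun j => tapeOf (v j).bits, o⟩

/-- On input `w`, the program `P` turns the counter values `v` and the input head position `p` into
`v'` and `p'` and appends `o` to the output; the counters stay below `M`. -/
def Counts (w : List Bool) (M : ℕ) (P : Prog) (v : ℕ → ℕ) (p : ℕ) (v' : ℕ → ℕ) (p' : ℕ)
    (o : List Bool) : Prop :=
  ∀ o', Runs w (M.bits.length + 1) P (.ofCounters v p o') (.ofCounters v' p' (o' ++ o))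

theorem Store.ofCounters_put (v : ℕ → ℕ) (p : ℕ) (o : List Bool) (j x : ℕ) :
    (Store.ofCounters v p o).put j 0 x.bits = .ofCounters (Function.update v j x) p o := by
  simp only [put, ofCounters, Store.mk.injEq, true_and, and_true]
  refine ⟨by ext i; by_cases h : i = j <;> simp [h], ?_⟩
  funext i
  by_cases h : i = j
  · subst h; simp
  · simp [h]

theorem Store.ofCounters_put_self (v : ℕ → ℕ) (p : ℕ) (o : List Bool) (j : ℕ) :
    (Store.ofCounters v p o).put j 0 (v j).bits = .ofCounters v p o := by
  rw [ofCounters_put, Function.update_eq_self]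

namespace Counts

variable {w : List Bool} {M : ℕ} {P Q : Prog} {v v' v'' : ℕ → ℕ} {p p' p'' : ℕ}
  {o o' : List Bool}

theorem skip : Counts w M .skip v p v p [] := fun o => by simpa using Runs.skip _

theorem seq (h : Counts w M P v p v' p' o) (h' : Counts w M Q v' p' v'' p'' o') :
    Counts w M (.seq P Q) v p v'' p'' (o ++ o') := fun a => by
  simpa using Runs.seq (h a) (h' _)

/-- Sequential composition of programs without output. -/
theorem andThen (h : Counts w M P v p v' p' []) (h' : Counts w M Q v' p' v'' p'' []) :
    Counts w M (.seq P Q) v p v'' p'' [] := h.seq h'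

theorem inc (j : ℕ) (h : v j + 1 ≤ M) :
    Counts w M (.inc j) v p (Function.update v j (v j + 1)) p [] := fun a => by
  have := Runs.inc (w := w) (B := M.bits.length + 1) (σ := .ofCounters v p a)
    (fun _ => Nat.zero_le _) j (v j) ((bits_length_mono h).trans (Nat.le_succ _))
  rw [Store.ofCounters_put, Store.ofCounters_put, Function.update_eq_self] at this
  simpa using this

theorem dec (j : ℕ) (h : v j ≤ M) (h0 : v j ≠ 0) :
    Counts w M (.dec j) v p (Function.update v j (v j - 1)) p [] := fun a => by
  obtain ⟨n, hn⟩ := Nat.exists_eq_succ_of_ne_zero h0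
  have := Runs.dec (w := w) (B := M.bits.length + 1) (σ := .ofCounters v p a)
    (fun _ => Nat.zero_le _) j n (Nat.succ_le_succ (bits_length_mono (hn.symm.trans_le h)))
  rw [Store.ofCounters_put, Store.ofCounters_put, show n + 1 = v j from hn.symm,
    Function.update_eq_self] at this
  simpa [hn] using this

theorem input (m : Move) : Counts w M (.act (.input m)) v p v (Machine.moveInput w p m) [] :=
  fun a => by
    have := Runs.act (w := w) (B := M.bits.length + 1) (.input m) (.ofCounters v p a)
      (fun _ => Nat.zero_le _)
    simpa [Act.apply, Store.ofCounters] using this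

theorem emit (b : Bool) : Counts w M (.act (.emit b)) v p v p [b] :=
  fun a => by
    have := Runs.act (w := w) (B := M.bits.length + 1) (.emit b) (.ofCounters v p a)
      (fun _ => Nat.zero_le _)
    simpa [Act.apply, Store.ofCounters] using this

theorem iteInput {f : Option Bool → Bool}
    (h : Counts w M (if f (Machine.readInput w p) then P else Q) v p v' p' o) :
    Counts w M (.ite (.input f) P Q) v p v' p' o := fun a => by
  by_cases hf : f (Machine.readInput w p) = true
  · exact .iteT hf (by simpa [hf] using h a)
  · exact .iteF (by simpa [Test.holds, Test.eval, Store.ofCounters] using hf) (by simpa [hf] using h a)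

theorem loopInputT {f : Option Bool → Bool} (hf : f (Machine.readInput w p) = true)
    (h : Counts w M P v p v' p' o) (h' : Counts w M (.loop (.input f) P) v' p' v'' p'' o') :
    Counts w M (.loop (.input f) P) v p v'' p'' (o ++ o') := fun a => by
  simpa using Runs.loopT (t := .input f) (σ := .ofCounters v p a) hf (h a) (h' _)

theorem loopInputF {f : Option Bool → Bool} (hf : f (Machine.readInput w p) = false) :
    Counts w M (.loop (.input f) P) v p v p [] := fun a => by
  simpa using Runs.loopF (t := .input f) (σ := .ofCounters v p a) hf

end Counts

/-- Branch on a counter being nonzero. -/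
def Prog.ifNZ (j : ℕ) (P Q : Prog) : Prog :=
  .seq (.mv j .right) (.ite (.work j Option.isSome) (.seq (.mv j .left) P) (.seq (.mv j .left) Q))

/-- Loop as long as a counter is nonzero. -/
def Prog.whileNZ (j : ℕ) (P : Prog) : Prog :=
  .seq (.mv j .right) (.seq
    (.loop (.work j Option.isSome) (.seq (.mv j .left) (.seq P (.mv j .right)))) (.mv j .left))

theorem isSome_tapeOf_bits (n : ℕ) : (tapeOf n.bits 1).isSome = decide (n ≠ 0) := by
  rcases Nat.eq_zero_or_pos n with rfl | h
  · simp [tapeOf]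
  · have hle : 1 ≤ n.bits.length := bits_length_mono (m := 1) (n := n) (by omega)
    rw [tapeOf, List.getElem?_eq_getElem (by omega)]
    simp; omega

namespace Counts

variable {w : List Bool} {M : ℕ} {P Q : Prog} {v v' v'' : ℕ → ℕ} {p p' p'' : ℕ}
  {o o' : List Bool}

/-- The memory with the head of the counter `j` in the cell `1`. -/
def lifted (v : ℕ → ℕ) (p j : ℕ) (o : List Bool) : Store :=
  (Store.ofCounters v p o).put j 1 (v j).bits

theorem runs_right (j : ℕ) : Runs w (M.bits.length + 1) (.mv j .right)
    (.ofCounters v p o) (lifted v p j o) := by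
  have := Runs.put_shift (w := w) (B := M.bits.length + 1) (σ := .ofCounters v p o)
    (fun _ => Nat.zero_le _) j (h := 0) (l := (v j).bits) .right (by simp [Machine.moveWork])
  rwa [Store.ofCounters_put_self] at this

theorem runs_left (j : ℕ) : Runs w (M.bits.length + 1) (.mv j .left)
    (lifted v p j o) (.ofCounters v p o) := by
  have := Runs.put_shift (w := w) (B := M.bits.length + 1) (σ := .ofCounters v p o)
    (fun _ => Nat.zero_le _) j (h := 1) (l := (v j).bits) .left (by simp [Machine.moveWork])
  rw [← Store.ofCounters_put_self (v := v) (p := p) (o := o) (j := j)]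
  exact this

theorem holds_lifted (j : ℕ) : (Test.work j Option.isSome).holds w (lifted v p j o) =
    decide (v j ≠ 0) := by
  rw [lifted, Test.holds_put, isSome_tapeOf_bits]

theorem ifNZ {j : ℕ} (h : Counts w M (if v j ≠ 0 then P else Q) v p v' p' o) :
    Counts w M (.ifNZ j P Q) v p v' p' o := fun a => by
  refine .seq (runs_right j) ?_
  by_cases hf : v j = 0
  · exact .iteF (by simp [holds_lifted, hf]) (.seq (runs_left j) (by simpa [hf] using h a))
  · exact .iteT (by simp [holds_lifted, hf]) (.seq (runs_left j) (by simpa [hf] using h a))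

/-- A loop that is executed `n` times. -/
theorem whileNZ {j : ℕ} (n : ℕ) (V : ℕ → ℕ → ℕ) (pos : ℕ → ℕ) (out : ℕ → List Bool)
    (hn : ∀ i < n, V i j ≠ 0) (h0 : V n j = 0)
    (h : ∀ i < n, Counts w M P (V i) (pos i) (V (i + 1)) (pos (i + 1)) (out i)) :
    Counts w M (.whileNZ j P) (V 0) (pos 0) (V n) (pos n) ((List.range n).flatMap out) := by
  have key : ∀ i ≤ n, ∀ a, Runs w (M.bits.length + 1)
      (.loop (.work j Option.isSome) (.seq (.mv j .left) (.seq P (.mv j .right))))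
      (lifted (V (n - i)) (pos (n - i)) j a)
      (lifted (V n) (pos n) j (a ++ ((List.range n).drop (n - i)).flatMap out)) := by
    intro i
    induction i with
    | zero =>
      intro _ a
      rw [show (List.range n).drop (n - 0) = [] by simp]
      simpa using Runs.loopF (by simp [holds_lifted, h0])
    | succ i ih =>
      intro hi a
      have e : n - (i + 1) + 1 = n - i := by omega
      have h1 := h (n - (i + 1)) (by omega) a
      rw [e] at h1
      refine .loopT (by simpa [holds_lifted] using hn (n - (i + 1)) (by omega))
        (.seq (runs_left j) (.seq h1 (runs_right j))) ?_
      have := ih (by omega) (a ++ out (n - (i + 1)))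
      rw [List.drop_eq_getElem_cons (i := n - (i + 1)) (by simp; omega), e]
      simpa using this
  intro a
  have := key n le_rfl a
  simp only [Nat.sub_self, List.drop_zero] at this
  exact .seq (runs_right j) (.seq this (runs_left j))

end Counts

end AutNet

namespace AutNet

/-! ### Counter subroutines -/

namespace Prog

/-- Add the counter `i` to the counter `j` and clear it. -/
def addTo (i j : ℕ) : Prog := whileNZ i (.seq (dec i) (inc j))

/-- Add the counter `i` to the counter `j`, using the counter `t` as scratch. -/
def copyTo (i j t : ℕ) : Prog :=
  .seq (whileNZ i (.seq (dec i) (.seq (inc j) (inc t)))) (addTo t i)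

def clear (i : ℕ) : Prog := whileNZ i (dec i)

end Prog

namespace Counts

variable {w : List Bool} {M : ℕ} {P Q : Prog} {v v' v'' : ℕ → ℕ} {p p' p'' : ℕ}
  {o o' : List Bool}

theorem congr (h : Counts w M P v p v' p' o) (e : v' = v'') (e' : p' = p'') :
    Counts w M P v p v'' p'' o := e ▸ e' ▸ h

theorem whileNZ_silent {j : ℕ} (n : ℕ) (V : ℕ → ℕ → ℕ) (pos : ℕ → ℕ)
    (hv : v = V 0) (hp : p = pos 0) (hv' : v' = V n) (hp' : p' = pos n)
    (hn : ∀ i < n, V i j ≠ 0) (h0 : V n j = 0)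
    (h : ∀ i < n, Counts w M P (V i) (pos i) (V (i + 1)) (pos (i + 1)) []) :
    Counts w M (.whileNZ j P) v p v' p' [] := by
  subst hv hp hv' hp'
  have := whileNZ n V pos (fun _ => []) hn h0 h
  rwa [show (List.range n).flatMap (fun _ => ([] : List Bool)) = [] by simp] at this

theorem addTo {i j : ℕ} (hij : i ≠ j) (h : v i + v j ≤ M) : Counts w M (.addTo i j) v p
    (Function.update (Function.update v i 0) j (v j + v i)) p [] := by
  refine whileNZ_silent (v i)
    (fun t => Function.update (Function.update v i (v i - t)) j (v j + t)) (fun _ => p)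
    ?_ rfl ?_ rfl ?_ ?_ ?_
  · grind [Function.update_apply]
  · grind [Function.update_apply]
  · grind [Function.update_apply]
  · grind [Function.update_apply]
  · intro t ht
    refine ((Counts.dec i ?_ ?_).andThen (Counts.inc j ?_)).congr ?_ rfl
    all_goals grind [Function.update_apply]

theorem copyTo {i j t : ℕ} (hij : i ≠ j) (hit : i ≠ t) (hjt : j ≠ t) (ht : v t = 0)
    (h : v i + v j ≤ M) : Counts w M (.copyTo i j t) v p
    (Function.update v j (v j + v i)) p [] := by
  refine Counts.andThen (whileNZ_silent (v i)
    (fun s => Function.update (Function.update (Function.update v i (v i - s)) j (v j + s)) t s)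
    (fun _ => p) ?_ rfl rfl rfl ?_ ?_ ?_) ((Counts.addTo hit.symm ?_).congr ?_ rfl)
  · grind [Function.update_apply]
  · grind [Function.update_apply]
  · grind [Function.update_apply]
  · intro s hs
    refine ((Counts.dec i ?_ ?_).andThen ((Counts.inc j ?_).andThen (Counts.inc t ?_))).congr ?_ rfl
    all_goals grind [Function.update_apply]
  · grind [Function.update_apply]
  · grind [Function.update_apply]

theorem clear {i : ℕ} (h : v i ≤ M) :
    Counts w M (.clear i) v p (Function.update v i 0) p [] := by
  refine whileNZ_silent (v i) (fun t => Function.update v i (v i - t)) (fun _ => p)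
    ?_ rfl ?_ rfl ?_ ?_ ?_
  · grind [Function.update_apply]
  · grind [Function.update_apply]
  · grind [Function.update_apply]
  · grind [Function.update_apply]
  · intro t ht
    refine (Counts.dec i ?_ ?_).congr ?_ rfl
    all_goals grind [Function.update_apply]

end Counts

/-! ### Pairing -/

/-- One step of a walk through all pairs of natural numbers. -/
def cstep : ℕ × ℕ → ℕ × ℕ
  | (0, y) => (y + 1, 0)
  | (x + 1, y) => (x, y + 1)

def cunpair (n : ℕ) : ℕ × ℕ := cstep^[n] (0, 0)

def tri : ℕ → ℕ
  | 0 => 0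
  | s + 1 => tri s + (s + 1)

/-- Cantor's pairing function. -/
def cpair (x y : ℕ) : ℕ := y + tri (x + y)

theorem cstep_iterate (k x y : ℕ) : cstep^[k] (x + k, y) = (x, y + k) := by
  induction k generalizing x y with
  | zero => rfl
  | succ k ih =>
    rw [Function.iterate_succ_apply, ← add_assoc, cstep, ih]
    congr 1; omega

theorem cunpair_tri (s : ℕ) : cunpair (tri s) = (s, 0) := by
  induction s with
  | zero => rfl
  | succ s ih =>
    rw [cunpair, tri, add_comm, Function.iterate_add_apply]
    rw [cunpair] at ih
    rw [ih, Function.iterate_succ_apply']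
    have := cstep_iterate s 0 0
    simp only [zero_add] at this
    rw [this, cstep]

theorem cunpair_cpair (x y : ℕ) : cunpair (cpair x y) = (x, y) := by
  have := cunpair_tri (x + y)
  rw [cunpair] at this ⊢
  rw [cpair, Function.iterate_add_apply, this, cstep_iterate, zero_add]

theorem cunpair_sum_le (n : ℕ) : (cunpair n).1 + (cunpair n).2 ≤ n := by
  induction n with
  | zero => simp [cunpair]
  | succ n ih =>
    rw [cunpair, Function.iterate_succ_apply']
    rw [cunpair] at ih
    rcases h : cstep^[n] (0, 0) with ⟨_ | x, y⟩ <;> rw [h] at ih <;> simp [cstep] at * <;> omega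

theorem tri_le (s : ℕ) : tri s ≤ s * s := by
  induction s with
  | zero => rfl
  | succ s ih => rw [tri]; nlinarith

theorem cpair_le (x y : ℕ) : cpair x y ≤ (x + y + 1) ^ 2 := by
  have := tri_le (x + y)
  rw [cpair]; nlinarith

/-! ### Number functions computable in logarithmic space -/

/-- The code of a symbol of the input. -/
def symCode : Option Bool → ℕ
  | none => 0
  | some false => 1
  | some true => 2

/-- Functions `f w n`, where `w` is the input word, that are computable with registers containing
numbers bounded by a polynomial in `|w| + n`. -/
inductive Lnat : (List Bool → ℕ → ℕ) → Prop
  | zero : Lnat fun _ _ => 0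
  | succ : Lnat fun _ n => n + 1
  | pred : Lnat fun _ n => n - 1
  | left : Lnat fun _ n => (cunpair n).1
  | right : Lnat fun _ n => (cunpair n).2
  | bit : Lnat fun w n => symCode w[n]?
  | len : Lnat fun w _ => w.length
  | comp {f g} : Lnat f → Lnat g → Lnat fun w n => f w (g w n)
  | pair {f g} : Lnat f → Lnat g → Lnat fun w n => cpair (f w n) (g w n)
  | iter {f} : Lnat f → (∃ k, ∀ w n, ∀ i ≤ (cunpair n).1,
      (f w)^[i] (cunpair n).2 ≤ (w.length + n + 2) ^ k) →
      Lnat fun w n => (f w)^[(cunpair n).1] (cunpair n).2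

theorem poly_step {l n k m : ℕ} (h : m ≤ (l + n + 2) ^ k) : l + m + 2 ≤ (l + n + 2) ^ (k + 2) := by
  have h1 : l + n + 2 ≤ (l + n + 2) ^ (k + 1) := Nat.le_self_pow (by omega) _
  have h2 : (l + n + 2) ^ k ≤ (l + n + 2) ^ (k + 1) := Nat.pow_le_pow_right (by omega) (by omega)
  have h3 : (l + n + 2) ^ (k + 2) = (l + n + 2) ^ (k + 1) * (l + n + 2) := pow_succ _ _
  nlinarith

theorem pow_mono_exp (l n : ℕ) {k k' : ℕ} (h : k ≤ k') :
    (l + n + 2) ^ k ≤ (l + n + 2) ^ k' := Nat.pow_le_pow_right (by omega) h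

theorem Lnat.bound {f : List Bool → ℕ → ℕ} (hf : Lnat f) :
    ∃ k, ∀ w n, f w n ≤ (w.length + n + 2) ^ k := by
  induction hf with
  | zero => exact ⟨0, fun w n => Nat.zero_le _⟩
  | succ => exact ⟨1, fun w n => by simp; omega⟩
  | pred => exact ⟨1, fun w n => by simp; omega⟩
  | left => exact ⟨1, fun w n => by have := cunpair_sum_le n; simp; omega⟩
  | right => exact ⟨1, fun w n => by have := cunpair_sum_le n; simp; omega⟩
  | bit => exact ⟨1, fun w n => by beta_reduce; rcases w[n]? with _ | _ | _ <;> simp [symCode]⟩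
  | len => exact ⟨1, fun w n => by simp; omega⟩
  | @comp f g _ _ ihf ihg =>
    obtain ⟨k, hk⟩ := ihf
    obtain ⟨l, hl⟩ := ihg
    refine ⟨(l + 2) * k, fun w n => (hk w _).trans ?_⟩
    rw [pow_mul]
    exact Nat.pow_le_pow_left (poly_step (hl w n)) k
  | @pair f g _ _ ihf ihg =>
    obtain ⟨k, hk⟩ := ihf
    obtain ⟨l, hl⟩ := ihg
    refine ⟨(k + l + 2) * 2, fun w n => (cpair_le _ _).trans ?_⟩
    rw [pow_mul]
    refine Nat.pow_le_pow_left ?_ 2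
    have h1 := (hk w n).trans (pow_mono_exp w.length n (Nat.le_add_right k l))
    have h2 := (hl w n).trans (pow_mono_exp w.length n (Nat.le_add_left l k))
    have h3 : 1 ≤ (w.length + n + 2) ^ (k + l) := Nat.one_le_pow _ _ (by omega)
    rw [pow_add _ (k + l) 2]
    have h4 : 2 * 2 ≤ (w.length + n + 2) ^ 2 := by rw [sq]; gcongr <;> omega
    nlinarith
  | iter _ hb _ =>
    obtain ⟨k, hk⟩ := hb
    exact ⟨k, fun w n => hk w n _ le_rfl⟩

/-- `f` is computed by a counter program: for an argument in the counter `i`, it puts the value into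
the empty counter `j`, using empty counters `≥ b` as scratch. -/
def Compiled (f : List Bool → ℕ → ℕ) : Prop :=
  ∃ k, ∀ i j b, i < b → j < b → i ≠ j → ∃ P : Prog, ∀ w M v, (∀ r ≥ b, v r = 0) → v j = 0 →
    (w.length + v i + 2) ^ k ≤ M → Counts w M P v 0 (Function.update v j (f w (v i))) 0 []

theorem le_of_pow_le {l n k M : ℕ} (hk : 1 ≤ k) (h : (l + n + 2) ^ k ≤ M) : l + n + 2 ≤ M :=
  (Nat.le_self_pow (by omega) _).trans h

namespace Compiled

theorem zero : Compiled fun _ _ => 0 :=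
  ⟨0, fun i j b _ _ _ => ⟨.skip, fun w M v _ hj _ => Counts.skip.congr (by
    grind [Function.update_apply]) rfl⟩⟩

theorem succ : Compiled fun _ n => n + 1 := by
  refine ⟨1, fun i j b hi hj hij => ⟨.seq (.copyTo i j b) (.inc j), fun w M v hb h0 hM => ?_⟩⟩
  have := le_of_pow_le le_rfl hM
  have := hb b le_rfl
  refine ((Counts.copyTo hij hi.ne hj.ne ?_ ?_).andThen (Counts.inc j ?_)).congr ?_ rfl
  all_goals grind [Function.update_apply]

theorem pred : Compiled fun _ n => n - 1 := by
  refine ⟨1, fun i j b hi hj hij => ⟨.seq (.copyTo i j b) (.ifNZ j (.dec j) .skip),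
    fun w M v hb h0 hM => ?_⟩⟩
  have := le_of_pow_le le_rfl hM
  have := hb b le_rfl
  refine (Counts.copyTo hij hi.ne hj.ne ?_ ?_).andThen (Counts.ifNZ ?_)
  · grind
  · grind
  · by_cases h : v i = 0
    · rw [if_neg (by grind [Function.update_apply])]
      refine Counts.skip.congr ?_ rfl
      grind [Function.update_apply]
    · rw [if_pos (by grind [Function.update_apply])]
      refine (Counts.dec j ?_ ?_).congr ?_ rfl
      all_goals grind [Function.update_apply]

/-- The walk through pairs on the counters `b + 1` and `b + 2`, controlled by the counter `b`. -/
def walk (b : ℕ) : Prog :=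
  .whileNZ b (.seq (.dec b) (.ifNZ (b + 1) (.seq (.dec (b + 1)) (.inc (b + 2)))
    (.seq (.addTo (b + 2) (b + 1)) (.inc (b + 1)))))

theorem counts_walk {w : List Bool} {M b : ℕ} {v : ℕ → ℕ} (h1 : v (b + 1) = 0)
    (h2 : v (b + 2) = 0) (hM : v b + 1 ≤ M) : Counts w M (walk b) v 0
      (Function.update (Function.update (Function.update v b 0) (b + 1) (cunpair (v b)).1)
        (b + 2) (cunpair (v b)).2) 0 [] := by
  refine Counts.whileNZ_silent (v b) (fun t => Function.update (Function.update
    (Function.update v b (v b - t)) (b + 1) (cunpair t).1) (b + 2) (cunpair t).2) (fun _ => 0)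
    ?_ rfl ?_ rfl ?_ ?_ ?_
  · simp only [cunpair, Function.iterate_zero, id]
    grind [Function.update_apply]
  · grind [Function.update_apply]
  · grind [Function.update_apply]
  · grind [Function.update_apply]
  · intro t ht
    have hs := cunpair_sum_le t
    have e : cunpair (t + 1) = cstep (cunpair t) := by
      rw [cunpair, Function.iterate_succ_apply', cunpair]
    simp only [e]
    clear e
    generalize cunpair t = c at hs ⊢
    obtain ⟨x, y⟩ := c
    simp only at hs ⊢
    refine (Counts.dec b ?_ ?_).andThen (Counts.ifNZ ?_)
    · grind [Function.update_apply]
    · grind [Function.update_apply]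
    cases x with
    | zero =>
      rw [if_neg (by grind [Function.update_apply])]
      refine ((Counts.addTo (by omega) ?_).andThen (Counts.inc _ ?_)).congr ?_ rfl
      all_goals try simp only [cstep]
      all_goals grind [Function.update_apply]
    | succ x =>
      rw [if_pos (by grind [Function.update_apply])]
      refine ((Counts.dec _ ?_ ?_).andThen (Counts.inc _ ?_)).congr ?_ rfl
      all_goals try simp only [cstep]
      all_goals grind [Function.update_apply]

theorem left : Compiled fun _ n => (cunpair n).1 := by
  refine ⟨1, fun i j b hi hj hij => ⟨.seq (.copyTo i b (b + 1)) (.seq (walk b)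
    (.seq (.addTo (b + 1) j) (.clear (b + 2)))), fun w M v hb h0 hM => ?_⟩⟩
  have := le_of_pow_le le_rfl hM
  have hb0 := hb b le_rfl
  have hb1 := hb (b + 1) (by omega)
  have hb2 := hb (b + 2) (by omega)
  have := cunpair_sum_le (v i)
  refine ((Counts.copyTo (by omega) (by omega) (by omega) ?_ ?_).andThen ((counts_walk ?_ ?_ ?_
    ).andThen ((Counts.addTo (by omega) ?_).andThen (Counts.clear ?_)))).congr ?_ rfl
  all_goals grind [Function.update_apply]

theorem right : Compiled fun _ n => (cunpair n).2 := by
  refine ⟨1, fun i j b hi hj hij => ⟨.seq (.copyTo i b (b + 1)) (.seq (walk b)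
    (.seq (.addTo (b + 2) j) (.clear (b + 1)))), fun w M v hb h0 hM => ?_⟩⟩
  have := le_of_pow_le le_rfl hM
  have hb0 := hb b le_rfl
  have hb1 := hb (b + 1) (by omega)
  have hb2 := hb (b + 2) (by omega)
  have := cunpair_sum_le (v i)
  refine ((Counts.copyTo (by omega) (by omega) (by omega) ?_ ?_).andThen ((counts_walk ?_ ?_ ?_
    ).andThen ((Counts.addTo (by omega) ?_).andThen (Counts.clear ?_)))).congr ?_ rfl
  all_goals grind [Function.update_apply]

theorem bit : Compiled fun w n => symCode w[n]? := by
  refine ⟨1, fun i j b hi hj hij => ⟨.seq (.copyTo i b (b + 1)) (.seq (.act (.input .right))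
    (.seq (.whileNZ b (.seq (.dec b) (.seq (.act (.input .right)) (.inc (b + 1)))))
    (.seq (.ite (.input Option.isSome) (.ite (.input (· == some true)) (.seq (.inc j) (.inc j))
      (.inc j)) .skip)
    (.seq (.act (.input .left)) (.whileNZ (b + 1) (.seq (.dec (b + 1)) (.act (.input .left)))))))),
    fun w M v hb h0 hM => ?_⟩⟩
  have := le_of_pow_le le_rfl hM
  have hb0 := hb b le_rfl
  have hb1 := hb (b + 1) (by omega)
  refine (Counts.copyTo (by omega) (by omega) (by omega) ?_ ?_).andThen ((Counts.input _).andThen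
    ((Counts.whileNZ_silent (v i) (fun t => Function.update (Function.update v b (v i - t))
      (b + 1) t) (fun t => min (t + 1) (w.length + 1)) ?_ ?_ rfl rfl ?_ ?_ ?_).andThen
    (Counts.andThen (v' := Function.update (Function.update v (b + 1) (v i)) j (symCode w[v i]?))
      (p' := min (v i + 1) (w.length + 1)) ?_ ((Counts.input _).andThen
      (Counts.whileNZ_silent (v i) (fun t => Function.update (Function.update v (b + 1) (v i - t))
        j (symCode w[v i]?)) (fun t => min (v i + 1) (w.length + 1) - 1 - t) ?_ ?_ ?_ ?_ ?_ ?_ ?_)))))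
  · grind
  · grind
  · grind [Function.update_apply]
  · simp [Machine.moveInput]
  · grind [Function.update_apply]
  · grind [Function.update_apply]
  · intro t ht
    refine ((Counts.dec _ ?_ ?_).andThen ((Counts.input _).andThen (Counts.inc _ ?_))).congr ?_ ?_
    · grind [Function.update_apply]
    · grind [Function.update_apply]
    · grind [Function.update_apply]
    · grind [Function.update_apply]
    · simp only [Machine.moveInput]; omega
  · have hr : Machine.readInput w (min (v i + 1) (w.length + 1)) = w[v i]? := by
      rcases Nat.lt_or_ge (v i) w.length with h | h
      · rw [min_eq_left (by omega), Machine.readInput]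
      · rw [min_eq_right (by omega), Machine.readInput, List.getElem?_eq_none h,
          List.getElem?_eq_none le_rfl]
    refine Counts.iteInput ?_
    rw [hr]
    rcases hs : w[v i]? with _ | _ | _
    · refine Counts.skip.congr ?_ rfl
      simp only [symCode]
      grind [Function.update_apply]
    · refine Counts.iteInput ?_
      rw [hr, if_neg (by simp [hs])]
      refine (Counts.inc _ ?_).congr ?_ rfl
      · grind [Function.update_apply]
      · simp only [symCode]; grind [Function.update_apply]
    · refine Counts.iteInput ?_
      rw [hr, if_pos (by simp [hs])]
      refine ((Counts.inc _ ?_).andThen (Counts.inc _ ?_)).congr ?_ rfl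
      · grind [Function.update_apply]
      · grind [Function.update_apply]
      · simp only [symCode]; grind [Function.update_apply]
  · grind [Function.update_apply]
  · simp [Machine.moveInput]
  · grind [Function.update_apply]
  · omega
  · grind [Function.update_apply]
  · grind [Function.update_apply]
  · intro t ht
    refine ((Counts.dec _ ?_ ?_).andThen (Counts.input _)).congr ?_ ?_
    · grind [Function.update_apply]
    · grind [Function.update_apply]
    · grind [Function.update_apply]
    · simp only [Machine.moveInput]; omega

theorem len : Compiled fun w _ => w.length := by
  refine ⟨1, fun i j b hi hj hij => ⟨.seq (.act (.input .right))
    (.seq (.loop (.input Option.isSome) (.seq (.inc j) (.seq (.inc b) (.act (.input .right)))))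
    (.seq (.act (.input .left)) (.whileNZ b (.seq (.dec b) (.act (.input .left)))))),
    fun w M v hb h0 hM => ?_⟩⟩
  have := le_of_pow_le le_rfl hM
  have hb0 := hb b le_rfl
  have key : ∀ t ≤ w.length, Counts w M (.loop (.input Option.isSome)
      (.seq (.inc j) (.seq (.inc b) (.act (.input .right)))))
      (Function.update (Function.update v j (w.length - t)) b (w.length - t))
      (w.length - t + 1) (Function.update (Function.update v j w.length) b w.length)
      (w.length + 1) [] := by
    intro t
    induction t with
    | zero => exact fun _ => Counts.loopInputF (by simp [Machine.readInput])
    | succ t ih =>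
      intro ht
      refine Counts.loopInputT (o := []) (o' := []) ?_ (((Counts.inc _ ?_).andThen
        ((Counts.inc _ ?_).andThen (Counts.input _))).congr ?_ ?_) (ih (by omega))
      · simp [Machine.readInput]; omega
      · grind [Function.update_apply]
      · grind [Function.update_apply]
      · grind [Function.update_apply]
      · simp only [Machine.moveInput]; omega
  have k0 := key _ le_rfl
  refine (Counts.input _).andThen (Counts.andThen (v' := Function.update (Function.update v j
    w.length) b w.length) (p' := w.length + 1) ?_ ((Counts.input _).andThen (Counts.whileNZ_silent
      w.length (fun t => Function.update (Function.update v j w.length) b (w.length - t))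
      (fun t => w.length - t) ?_ ?_ ?_ ?_ ?_ ?_ ?_)))
  · convert k0 using 1
    · grind [Function.update_apply]
    · simp [Machine.moveInput]
  · grind [Function.update_apply]
  · simp [Machine.moveInput]
  · grind [Function.update_apply]
  · omega
  · grind [Function.update_apply]
  · grind [Function.update_apply]
  · intro t ht
    refine ((Counts.dec _ ?_ ?_).andThen (Counts.input _)).congr ?_ ?_
    · grind [Function.update_apply]
    · grind [Function.update_apply]
    · grind [Function.update_apply]
    · simp only [Machine.moveInput]; omega

theorem comp {f g : List Bool → ℕ → ℕ} (hf : Compiled f) (hg : Compiled g)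
    (hb : ∃ k, ∀ w n, g w n ≤ (w.length + n + 2) ^ k) : Compiled fun w n => f w (g w n) := by
  obtain ⟨k, hk⟩ := hf
  obtain ⟨l, hl⟩ := hg
  obtain ⟨m, hm⟩ := hb
  refine ⟨l + (m + 2) * k + (m + 2), fun i j b hi hj hij => ?_⟩
  obtain ⟨P, hP⟩ := hk b j (b + 1) (by omega) (by omega) (by omega)
  obtain ⟨Q, hQ⟩ := hl i b (b + 1) (by omega) (by omega) (by omega)
  refine ⟨.seq Q (.seq P (.clear b)), fun w M v hv h0 hM => ?_⟩
  have h1 := (pow_mono_exp w.length (v i) (show l ≤ l + (m + 2) * k + (m + 2) by omega)).trans hM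
  have h2 := (pow_mono_exp w.length (v i)
    (show (m + 2) * k ≤ l + (m + 2) * k + (m + 2) by omega)).trans hM
  have h3 := (pow_mono_exp w.length (v i)
    (show m + 2 ≤ l + (m + 2) * k + (m + 2) by omega)).trans hM
  have h4 := poly_step (hm w (v i))
  have hvb := hv b le_rfl
  refine ((hQ w M v (fun r hr => hv r (by omega)) hvb h1).andThen ((hP w M _ ?_ ?_ ?_).andThen
    (Counts.clear ?_))).congr ?_ rfl
  · grind [Function.update_apply]
  · grind [Function.update_apply]
  · rw [Function.update_self]
    refine le_trans ?_ h2
    rw [pow_mul]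
    exact Nat.pow_le_pow_left h4 k
  · rw [Function.update_of_ne (by omega), Function.update_self]
    omega
  · rw [Function.update_self]
    grind [Function.update_apply]

theorem pair {f g : List Bool → ℕ → ℕ} (hf : Compiled f) (hg : Compiled g)
    (hb : ∃ k, ∀ w n, cpair (f w n) (g w n) ≤ (w.length + n + 2) ^ k) :
    Compiled fun w n => cpair (f w n) (g w n) := by
  obtain ⟨k, hk⟩ := hf
  obtain ⟨l, hl⟩ := hg
  obtain ⟨m, hm⟩ := hb
  refine ⟨k + l + (m + 2), fun i j b hi hj hij => ?_⟩
  obtain ⟨P, hP⟩ := hk i b (b + 2) (by omega) (by omega) (by omega)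
  obtain ⟨Q, hQ⟩ := hl i (b + 1) (b + 2) (by omega) (by omega) (by omega)
  refine ⟨.seq P (.seq Q (.seq (.copyTo (b + 1) j (b + 2)) (.seq (.addTo (b + 1) b)
    (.whileNZ b (.seq (.copyTo b j (b + 1)) (.dec b)))))), fun w M v hv h0 hM => ?_⟩
  have h1 := (pow_mono_exp w.length (v i) (show k ≤ k + l + (m + 2) by omega)).trans hM
  have h2 := (pow_mono_exp w.length (v i) (show l ≤ k + l + (m + 2) by omega)).trans hM
  have h3 := (pow_mono_exp w.length (v i) (show m + 2 ≤ k + l + (m + 2) by omega)).trans hM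
  have h4 := poly_step (hm w (v i))
  have hvb := hv b le_rfl
  have hvb1 := hv (b + 1) (by omega)
  have hvb2 := hv (b + 2) (by omega)
  have tri_mono : ∀ s t, tri s ≤ tri (s + t) := fun s t => by
    induction t with
    | zero => rfl
    | succ t ih => rw [← add_assoc, tri]; omega
  have le_tri : ∀ s, s ≤ tri s := fun s => by cases s <;> simp [tri]
  have hM' : cpair (f w (v i)) (g w (v i)) ≤ M := by omega
  refine (hP w M v (fun r hr => hv r (by omega)) hvb h1).andThen ((hQ w M _ ?_ ?_ ?_).andThen
    ?_)
  · grind [Function.update_apply]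
  · grind [Function.update_apply]
  · rwa [Function.update_of_ne (by omega)]
  rw [Function.update_of_ne (show i ≠ b by omega)]
  beta_reduce
  generalize f w (v i) = x at *
  generalize g w (v i) = y at *
  have hxy := le_tri (x + y)
  simp only [cpair] at hM'
  refine (Counts.copyTo (by omega) (by omega) (by omega) ?_ ?_).andThen
    ((Counts.addTo (by omega) ?_).andThen (Counts.whileNZ_silent (x + y)
      (fun t => Function.update (Function.update v b (x + y - t)) j
        (y + (tri (x + y) - tri (x + y - t)))) (fun _ => 0) ?_ rfl ?_ rfl ?_ ?_ ?_))
  · grind [Function.update_apply]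
  · grind [Function.update_apply]
  · grind [Function.update_apply]
  · grind [Function.update_apply]
  · have : tri 0 = 0 := rfl
    simp only [cpair]
    grind [Function.update_apply]
  · grind [Function.update_apply]
  · grind [Function.update_apply]
  · intro t ht
    obtain ⟨s, hs⟩ : ∃ s, x + y = (s + 1) + t := ⟨x + y - t - 1, by omega⟩
    have e1 : x + y - t = s + 1 := by omega
    have e2 : x + y - (t + 1) = s := by omega
    have e3 := tri_mono (s + 1) t
    rw [← hs] at e3
    have e4 : tri (s + 1) = tri s + (s + 1) := rfl
    simp only [e1, e2]
    refine ((Counts.copyTo (by omega) (by omega) (by omega) ?_ ?_).andThen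
      (Counts.dec b ?_ ?_)).congr ?_ rfl
    · grind [Function.update_apply]
    · grind [Function.update_apply]
    · grind [Function.update_apply]
    · grind [Function.update_apply]
    · grind [Function.update_apply]

theorem iter {f : List Bool → ℕ → ℕ} (hf : Compiled f)
    (hb : ∃ k, ∀ w n, ∀ i ≤ (cunpair n).1,
      (f w)^[i] (cunpair n).2 ≤ (w.length + n + 2) ^ k) :
    Compiled fun w n => (f w)^[(cunpair n).1] (cunpair n).2 := by
  obtain ⟨k, hk⟩ := hf
  obtain ⟨kl, hl⟩ := left
  obtain ⟨kr, hr⟩ := right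
  obtain ⟨m, hm⟩ := hb
  refine ⟨kl + kr + (m + 2) * k + (m + 2), fun i j b hi hj hij => ?_⟩
  obtain ⟨P, hP⟩ := hk (b + 1) (b + 2) (b + 3) (by omega) (by omega) (by omega)
  obtain ⟨QL, hQL⟩ := hl i b (b + 2) (by omega) (by omega) (by omega)
  obtain ⟨QR, hQR⟩ := hr i (b + 1) (b + 2) (by omega) (by omega) (by omega)
  refine ⟨.seq QL (.seq QR (.seq (.whileNZ b (.seq (.dec b) (.seq P (.seq (.clear (b + 1))
    (.addTo (b + 2) (b + 1)))))) (.addTo (b + 1) j))), fun w M v hv h0 hM => ?_⟩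
  have h1 := (pow_mono_exp w.length (v i)
    (show kl ≤ kl + kr + (m + 2) * k + (m + 2) by omega)).trans hM
  have h2 := (pow_mono_exp w.length (v i)
    (show kr ≤ kl + kr + (m + 2) * k + (m + 2) by omega)).trans hM
  have h3 := (pow_mono_exp w.length (v i)
    (show m + 2 ≤ kl + kr + (m + 2) * k + (m + 2) by omega)).trans hM
  have h5 := (pow_mono_exp w.length (v i)
    (show (m + 2) * k ≤ kl + kr + (m + 2) * k + (m + 2) by omega)).trans hM
  have hvb := hv b le_rfl
  have hvb1 := hv (b + 1) (by omega)
  have hvb2 := hv (b + 2) (by omega)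
  refine (hQL w M v (fun r hr => hv r (by omega)) hvb h1).andThen ((hQR w M _ ?_ ?_ ?_).andThen
    ?_)
  · grind [Function.update_apply]
  · grind [Function.update_apply]
  · rwa [Function.update_of_ne (by omega)]
  rw [Function.update_of_ne (show i ≠ b by omega)]
  have hc := cunpair_sum_le (v i)
  have hM' := le_of_pow_le (by omega) h3
  have hm' := hm w (v i)
  beta_reduce
  generalize cunpair (v i) = c at *
  obtain ⟨x, y⟩ := c
  simp only at *
  refine (Counts.whileNZ_silent x (fun t => Function.update (Function.update v b (x - t)) (b + 1)
    ((f w)^[t] y)) (fun _ => 0) ?_ rfl rfl rfl ?_ ?_ ?_).andThen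
    ((Counts.addTo (by omega) ?_).congr ?_ rfl)
  · simp only [Function.iterate_zero, id, Nat.sub_zero]
  · grind [Function.update_apply]
  · grind [Function.update_apply]
  · intro t ht
    have h6 := poly_step (hm' t (by omega))
    have h7 := poly_step (hm' (t + 1) (by omega))
    rw [Function.iterate_succ_apply'] at h7 ⊢
    refine (Counts.dec b ?_ ?_).andThen ((hP w M _ ?_ ?_ ?_).andThen ((Counts.clear ?_).andThen
      ((Counts.addTo (by omega) ?_).congr ?_ rfl)))
    · grind [Function.update_apply]
    · grind [Function.update_apply]
    · grind [Function.update_apply]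
    · grind [Function.update_apply]
    · rw [Function.update_of_ne (by omega), Function.update_self]
      refine le_trans ?_ h5
      rw [pow_mul]
      exact Nat.pow_le_pow_left h6 k
    · rw [Function.update_of_ne (by omega), Function.update_of_ne (by omega),
        Function.update_self]
      omega
    · simp only [Function.update_apply]
      simp
      omega
    · simp only [Function.update_apply]
      grind [Function.update_apply]
  · have h6 := poly_step (hm' x le_rfl)
    grind [Function.update_apply]
  · grind [Function.update_apply]

end Compiled

theorem Lnat.compiled {f : List Bool → ℕ → ℕ} (hf : Lnat f) : Compiled f := by
  induction hf with
  | zero => exact Compiled.zero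
  | succ => exact Compiled.succ
  | pred => exact Compiled.pred
  | left => exact Compiled.left
  | right => exact Compiled.right
  | bit => exact Compiled.bit
  | len => exact Compiled.len
  | comp _ hg ihf ihg => exact ihf.comp ihg hg.bound
  | pair hf hg ihf ihg => exact ihf.pair ihg (hf.pair hg).bound
  | iter _ hb ih => exact ih.iter hb

/-- A word function is computable in logarithmic space if its length and its letters are. -/
theorem logspaceComputable_of_Lnat {F : List Bool → List Bool}
    (hl : Lnat fun w _ => (F w).length) (hb : Lnat fun w n => symCode (F w)[n]?) :
    LogspaceComputable F := by
  obtain ⟨kl, hkl⟩ := hl.bound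
  obtain ⟨k₁, h₁⟩ := hl.compiled
  obtain ⟨k₂, h₂⟩ := hb.compiled
  obtain ⟨P, hP⟩ := h₁ 0 1 2 (by omega) (by omega) (by omega)
  obtain ⟨Q, hQ⟩ := h₂ 2 3 4 (by omega) (by omega) (by omega)
  beta_reduce at hP hQ
  set K := k₁ + (kl + 2) * k₂ + (kl + 2) with hK
  refine .of_runs (.seq P (.whileNZ 1 (.seq (.dec 1) (.seq Q (.seq
    (.ifNZ 3 (.seq (.dec 3) (.ifNZ 3 (.seq (.dec 3) (.act (.emit true))) (.act (.emit false))))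
      .skip) (.inc 2)))))) (2 * K + 2) fun w => ?_
  set M := 2 ^ (K * (Nat.log 2 w.length + 2)) with hMdef
  have hM0 : (w.length + 0 + 2) ^ K ≤ M := by
    rw [hMdef, mul_comm, pow_mul]
    refine Nat.pow_le_pow_left ?_ K
    have := Nat.lt_pow_succ_log_self (b := 2) (by omega) w.length
    rw [pow_succ]
    omega
  have hM1 := (pow_mono_exp w.length 0 (show k₁ ≤ K by omega)).trans hM0
  have hM2 := (pow_mono_exp w.length 0 (show (kl + 2) * k₂ ≤ K by omega)).trans hM0
  have hM3 := (pow_mono_exp w.length 0 (show kl + 2 ≤ K by omega)).trans hM0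
  have hlen := poly_step (l := w.length) (n := 0) (hkl w 0)
  set V : ℕ → ℕ → ℕ := fun t => Function.update (Function.update (fun _ => 0) 1
    ((F w).length - t)) 2 t with hV
  have hlast : Counts w M (.whileNZ 1 (.seq (.dec 1) (.seq Q (.seq
      (.ifNZ 3 (.seq (.dec 3) (.ifNZ 3 (.seq (.dec 3) (.act (.emit true))) (.act (.emit false))))
      .skip) (.inc 2))))) (V 0) 0 (V (F w).length) 0
      ((List.range (F w).length).flatMap fun t => (F w)[t]?.toList) := by
    refine Counts.whileNZ (F w).length V (fun _ => 0) _ ?_ ?_ ?_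
    · grind [Function.update_apply]
    · grind [Function.update_apply]
    · intro t ht
      have hF : (F w)[t]? = some (F w)[t] := List.getElem?_eq_getElem ht
      have hQ' := hQ w M (Function.update (Function.update (fun _ => 0) 1
        ((F w).length - (t + 1))) 2 t) ?_ ?_ ?_
      · rw [Function.update_self, hF] at hQ'
        rw [hF]
        have e : (Function.update (V t) 1 ((V t) 1 - 1)) = (Function.update (Function.update
          (fun _ => 0) 1 ((F w).length - (t + 1))) 2 t) := by
          grind [Function.update_apply]
        have hd := Counts.dec (w := w) (M := M) (p := 0) (v := V t) 1 ?_ ?_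
        · rw [e] at hd
          refine hd.seq (o' := [(F w)[t]]) (hQ'.seq (o' := [(F w)[t]]) ?_)
          refine Counts.seq (o := [(F w)[t]]) (o' := []) (v' := Function.update (Function.update
            (fun _ => 0) 1 ((F w).length - (t + 1))) 2 t) (p' := 0) ?_ ((Counts.inc 2 ?_).congr
              ?_ rfl)
          · refine Counts.ifNZ ?_
            rw [if_pos]
            · refine Counts.seq (o := []) (o' := [(F w)[t]]) (Counts.dec 3 ?_ ?_) ?_
              · cases (F w)[t] <;> simp [symCode] <;> omega
              · cases (F w)[t] <;> simp [symCode]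
              · refine Counts.ifNZ ?_
                cases (F w)[t]
                · rw [if_neg (by simp [symCode])]
                  refine (Counts.emit _).congr ?_ rfl
                  simp only [symCode]; grind [Function.update_apply]
                · rw [if_pos (by simp [symCode])]
                  refine Counts.seq (o := []) (o' := [true]) (Counts.dec 3 ?_ ?_)
                    ((Counts.emit _).congr ?_ rfl)
                  · simp [symCode]; omega
                  · simp [symCode]
                  · simp only [symCode]; grind [Function.update_apply]
            · cases (F w)[t] <;> simp [symCode]
          · grind [Function.update_apply]
          · grind [Function.update_apply]
        · grind [Function.update_apply]
        · grind [Function.update_apply]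
      · grind [Function.update_apply]
      · grind [Function.update_apply]
      · rw [Function.update_self]
        refine le_trans ?_ hM2
        rw [pow_mul]
        exact Nat.pow_le_pow_left (by omega) k₂
  have hfirst := hP w M (fun _ => 0) (fun _ _ => rfl) rfl hM1
  have e0 : Function.update (fun _ : ℕ => 0) 1 (F w).length = V 0 := by
    grind [Function.update_apply]
  rw [e0] at hfirst
  have hout : ((List.range (F w).length).flatMap fun t => (F w)[t]?.toList) = F w := by
    have : ∀ l : List Bool, ((List.range l.length).flatMap fun t => l[t]?.toList) = l := by
      intro l
      induction l with
      | nil => rfl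
      | cons a l ih =>
        rw [List.length_cons, List.range_succ_eq_map, List.flatMap_cons, List.flatMap_map]
        simpa using ih
    exact this _
  rw [hout] at hlast
  have htot := (hfirst.seq hlast) []
  have hM4 : M.bits.length + 1 ≤ (2 * K + 2) * (Nat.log 2 w.length + 1) := by
    rw [Nat.size_eq_bits_len, hMdef, Nat.size_pow]
    nlinarith
  have hempty : Store.ofCounters (fun _ => 0) 0 [] = Store.empty := by
    simp only [Store.ofCounters, Store.empty, Store.mk.injEq, true_and, and_true]
    funext j i
    cases i <;> simp [tapeOf]
  rw [hempty] at htot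
  exact ⟨_, htot.mono hM4, by simp [Store.ofCounters]⟩

end AutNet

namespace AutNet

/-! ### Typed functions computable in logarithmic space -/

theorem cpair_cunpair (n : ℕ) : cpair (cunpair n).1 (cunpair n).2 = n := by
  induction n with
  | zero => rfl
  | succ n ih =>
    rw [cunpair, Function.iterate_succ_apply']
    rw [cunpair] at ih
    rcases h : cstep^[n] (0, 0) with ⟨_ | x, y⟩ <;> rw [h] at ih <;>
      simp only [cpair, cstep, zero_add, add_zero] at ih ⊢
    · rw [tri]; omega
    · rw [show x + (y + 1) = x + 1 + y by omega]; omega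

theorem tri_mono {s t : ℕ} (h : s ≤ t) : tri s ≤ tri t := by
  induction t, h using Nat.le_induction with
  | base => rfl
  | succ t _ ih => rw [tri]; omega

theorem cpair_mono {x y x' y' : ℕ} (hx : x ≤ x') (hy : y ≤ y') : cpair x y ≤ cpair x' y' :=
  add_le_add hy (tri_mono (by omega))

theorem Lnat.id : Lnat fun _ n => n := by
  have := Lnat.pair .left .right
  simpa only [cpair_cunpair] using this

theorem Lnat.const (c : ℕ) : Lnat fun _ _ => c := by
  induction c with
  | zero => exact .zero
  | succ c ih => exact Lnat.comp (f := fun _ n => n + 1) .succ ih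

/-- A coding of the elements of a type by numbers. -/
class Enc (α : Type) where
  enc : α → ℕ

open Enc

instance : Enc ℕ := ⟨id⟩

instance {α β : Type} [Enc α] [Enc β] : Enc (α × β) := ⟨fun p => cpair (enc p.1) (enc p.2)⟩

theorem enc_nat (n : ℕ) : enc n = n := rfl

theorem enc_prod {α β : Type} [Enc α] [Enc β] (p : α × β) :
    enc p = cpair (enc p.1) (enc p.2) := rfl

/-- `f w a` is computable in logarithmic space from the input word `w` and registers holding the
code of `a`. -/
class L {α β : Type} [Enc α] [Enc β] (f : List Bool → α → β) : Prop where
  intro ::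
  out : ∃ g, Lnat g ∧ ∀ w a, g w (enc a) = enc (f w a)

theorem L.iff_nat {f : List Bool → ℕ → ℕ} : L f ↔ Lnat f :=
  ⟨fun ⟨g, hg, h⟩ => by
    have : g = f := by funext w a; exact h w a
    exact this ▸ hg, fun h => ⟨f, h, fun _ _ => rfl⟩⟩

section basic

variable {α β γ : Type} [Enc α] [Enc β] [Enc γ]

theorem L.comp {f : List Bool → β → γ} (hf : L f) {g : List Bool → α → β} (hg : L g) :
    L fun w a => f w (g w a) := by
  obtain ⟨f', hf', hf⟩ := hf
  obtain ⟨g', hg', hg⟩ := hg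
  exact ⟨_, hf'.comp hg', fun w a => by rw [hg, hf]⟩

instance L.self : L fun _ (a : α) => a := ⟨_, .id, fun _ _ => rfl⟩

instance L.const (b : β) : L fun _ (_ : α) => b := ⟨_, .const (enc b), fun _ _ => rfl⟩

instance L.prodMk (f : List Bool → α → β) (g : List Bool → α → γ) [hf : L f] [hg : L g] :
    L fun w a => (f w a, g w a) := by
  obtain ⟨f', hf', hf⟩ := hf
  obtain ⟨g', hg', hg⟩ := hg
  exact ⟨_, hf'.pair hg', fun w a => by rw [hf, hg, enc_prod]⟩

instance L.fst (f : List Bool → α → β × γ) [hf : L f] : L fun w a => (f w a).1 := by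
  obtain ⟨f', hf', hf⟩ := hf
  exact ⟨_, Lnat.comp .left hf', fun w a => by rw [hf, enc_prod, cunpair_cpair]⟩

instance L.snd (f : List Bool → α → β × γ) [hf : L f] : L fun w a => (f w a).2 := by
  obtain ⟨f', hf', hf⟩ := hf
  exact ⟨_, Lnat.comp .right hf', fun w a => by rw [hf, enc_prod, cunpair_cpair]⟩

instance L.encOf (f : List Bool → α → β) [hf : L f] : L fun w a => enc (f w a) := by
  obtain ⟨f', hf', hf⟩ := hf
  exact ⟨_, hf', fun w a => by rw [hf]; rfl⟩

instance L.cpairOf (f g : List Bool → α → ℕ) [hf : L f] [hg : L g] :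
    L fun w a => cpair (f w a) (g w a) := by
  obtain ⟨f', hf', hf⟩ := hf
  obtain ⟨g', hg', hg⟩ := hg
  exact ⟨_, hf'.pair hg', fun w a => by rw [hf, hg]; rfl⟩

instance L.length : L fun w (_ : α) => w.length := ⟨_, .len, fun _ _ => rfl⟩

instance L.input (f : List Bool → α → ℕ) [hf : L f] : L fun w a => symCode w[f w a]? := by
  obtain ⟨f', hf', hf⟩ := hf
  exact ⟨_, Lnat.comp .bit hf', fun w a => by rw [hf]; rfl⟩

instance L.succ (f : List Bool → α → ℕ) [hf : L f] : L fun w a => f w a + 1 := by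
  obtain ⟨f', hf', hf⟩ := hf
  exact ⟨_, Lnat.comp .succ hf', fun w a => by rw [hf]; rfl⟩

/-- Iteration with an unconditional polynomial bound. -/
theorem L.iterate_poly {f : List Bool → ℕ × ℕ → ℕ} (hf : L f)
    (hb : ∃ k, ∀ w a s i, (fun x => f w (a, x))^[i] s ≤ (w.length + (a + s + i) + 2) ^ k)
    (c n s : List Bool → α → ℕ) [hc : L c] [hn : L n] [hs : L s] :
    L fun w a => (fun x => f w (c w a, x))^[n w a] (s w a) := by
  obtain ⟨f', hf', hf⟩ := hf
  have e : ∀ w (i a x : ℕ), (fun m => cpair (cunpair m).1 (f' w m))^[i]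
      (cpair a x) = cpair a ((fun x => f w (a, x))^[i] x) := by
    intro w i a x
    induction i with
    | zero => rfl
    | succ i ih =>
      rw [Function.iterate_succ_apply', ih, Function.iterate_succ_apply', cunpair_cpair]
      exact congrArg _ (hf w (a, _))
  have hit : Lnat fun w m => ((fun w m => cpair (cunpair m).1 (f' w m) :
      List Bool → ℕ → ℕ) w)^[(cunpair m).1] (cunpair m).2 := by
    refine Lnat.iter (.pair .left hf') ?_
    obtain ⟨k, hk⟩ := hb
    refine ⟨(k + 2) * 2, fun w n i hi => ?_⟩
    have h0 := cunpair_sum_le n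
    rw [← cpair_cunpair (cunpair n).2, e]
    have h1 := cunpair_sum_le (cunpair n).2
    have h2 := hk w (cunpair (cunpair n).2).1 (cunpair (cunpair n).2).2 i
    have h3 : (w.length + ((cunpair (cunpair n).2).1 + (cunpair (cunpair n).2).2 + i) + 2) ^ k ≤
      (w.length + n + 2) ^ k := Nat.pow_le_pow_left (by omega) k
    refine (cpair_le _ _).trans ?_
    rw [pow_mul]
    refine Nat.pow_le_pow_left ?_ 2
    have h4 := h2.trans h3
    generalize (fun x => f w ((cunpair (cunpair n).2).1, x))^[i] (cunpair (cunpair n).2).2 = y at *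
    have h5 : 1 ≤ (w.length + n + 2) ^ k := Nat.one_le_pow _ _ (by omega)
    have h6 : (cunpair (cunpair n).2).1 + 2 ≤ w.length + n + 2 := by omega
    rw [pow_add, sq]
    generalize w.length + n + 2 = X at *
    have hX : X ≤ X ^ k * X := Nat.le_mul_of_pos_left _ h5
    have hP : X ^ k ≤ X ^ k * X := Nat.le_mul_of_pos_right _ (by omega)
    have h7 : X ^ k * X * 2 ≤ X ^ k * X * X := Nat.mul_le_mul_left _ (by omega)
    rw [← mul_assoc]
    omega
  obtain ⟨g, hg, hg'⟩ := L.prodMk n (fun w a => (c w a, s w a))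
  refine ⟨_, Lnat.comp .right (hit.comp hg), fun w a => ?_⟩
  rw [hg']
  simp only [enc_prod, cunpair_cpair, enc_nat]
  rw [e, cunpair_cpair]

theorem iterate_succ_eq (i y : ℕ) : (fun m : ℕ => m + 1)^[i] y = y + i := by
  induction i with
  | zero => rfl
  | succ i ih => rw [Function.iterate_succ_apply', ih]; omega

instance L.add (f g : List Bool → α → ℕ) [hf : L f] [hg : L g] :
    L fun w a => f w a + g w a := by
  have := L.iterate_poly (f := fun _ p => p.2 + 1) inferInstance
    ⟨1, fun w a s i => by rw [iterate_succ_eq]; simp; omega⟩ (fun _ _ => 0) g f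
  simpa only [iterate_succ_eq] using this

instance L.mul (f g : List Bool → α → ℕ) [hf : L f] [hg : L g] :
    L fun w a => f w a * g w a := by
  have e : ∀ a i s : ℕ, (fun m : ℕ => m + a)^[i] s = s + i * a := fun a i s => by
    induction i with
    | zero => simp
    | succ i ih => rw [Function.iterate_succ_apply', ih]; ring
  have := L.iterate_poly (f := fun _ p => p.2 + p.1) inferInstance
    ⟨2, fun w a s i => by rw [e]; nlinarith [Nat.zero_le (w.length * w.length)]⟩ f g
      (fun _ _ => 0)
  simpa only [e, zero_add, mul_comm (g _ _)] using this

instance L.pred (f : List Bool → α → ℕ) [hf : L f] : L fun w a => f w a - 1 :=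
  L.comp (f := fun _ n => n - 1) (L.iff_nat.2 .pred) hf

instance L.sub (f g : List Bool → α → ℕ) [hf : L f] [hg : L g] :
    L fun w a => f w a - g w a := by
  have e : ∀ i s : ℕ, (fun m : ℕ => m - 1)^[i] s = s - i := fun i s => by
    induction i with
    | zero => rfl
    | succ i ih => rw [Function.iterate_succ_apply', ih]; omega
  have := L.iterate_poly (f := fun _ p => p.2 - 1) inferInstance
    ⟨1, fun w a s i => by rw [e]; simp; omega⟩ (fun _ _ => 0) g f
  simpa only [e] using this

instance L.minOf (f g : List Bool → α → ℕ) [hf : L f] [hg : L g] :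
    L fun w a => min (f w a) (g w a) := by
  have : L fun w a => f w a - (f w a - g w a) := inferInstance
  convert this using 3
  omega

instance L.maxOf (f g : List Bool → α → ℕ) [hf : L f] [hg : L g] :
    L fun w a => max (f w a) (g w a) := by
  have : L fun w a => f w a + (g w a - f w a) := inferInstance
  convert this using 3
  omega

instance L.pow (f : List Bool → α → ℕ) [hf : L f] (k : ℕ) : L fun w a => f w a ^ k := by
  induction k with
  | zero => simpa only [pow_zero] using L.const 1
  | succ k ih => simpa only [pow_succ] using L.mul _ _

theorem L.bound {f : List Bool → α → β} (hf : L f) :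
    ∃ k, ∀ w a, enc (f w a) ≤ (w.length + enc a + 2) ^ k := by
  obtain ⟨g, hg, h⟩ := hf
  obtain ⟨k, hk⟩ := hg.bound
  exact ⟨k, fun w a => h w a ▸ hk w _⟩

/-- Iteration with intermediate values of polynomial size. -/
theorem L.iterate {f : List Bool → α × β → β} (hf : L f) (n : List Bool → α → ℕ)
    (s : List Bool → α → β) (B : List Bool → α → ℕ) [hn : L n] [hs : L s] [hB : L B]
    (hb : ∀ w a, ∀ i ≤ n w a, enc ((fun x => f w (a, x))^[i] (s w a)) ≤ B w a) :
    L fun w a => (fun x => f w (a, x))^[n w a] (s w a) := by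
  obtain ⟨g, hg, h⟩ := hf
  have hl : L fun _ (n : ℕ) => (cunpair n).1 := L.iff_nat.2 .left
  have hr : L fun _ (n : ℕ) => (cunpair n).2 := L.iff_nat.2 .right
  have hg' : L g := L.iff_nat.2 hg
  have h1 : L fun _ (p : ℕ × ℕ) => (cunpair p.1).1 := hl.comp inferInstance
  have h2 : L fun _ (p : ℕ × ℕ) => (cunpair p.1).2 := hr.comp inferInstance
  have h3 : L fun w (p : ℕ × ℕ) => g w (cpair (cunpair p.1).1 p.2) :=
    hg'.comp inferInstance
  have h4 := L.iterate_poly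
    (f := fun w p => min (g w (cpair (cunpair p.1).1 p.2)) (cunpair p.1).2)
    inferInstance ⟨1, fun w a s i => by
      cases i with
      | zero => simp; omega
      | succ i =>
        rw [Function.iterate_succ_apply']
        have := cunpair_sum_le a
        refine (min_le_right _ _).trans ?_
        simp; omega⟩ (fun w a => cpair (enc a) (B w a)) n (fun w a => enc (s w a))
  obtain ⟨F, hF, hF'⟩ := h4
  refine ⟨F, hF, fun w a => ?_⟩
  rw [hF']
  have key : ∀ i ≤ n w a, (fun x => min (g w (cpair (cunpair (cpair (enc a)
      (B w a))).1 x)) (cunpair (cpair (enc a) (B w a))).2)^[i] (enc (s w a)) =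
      enc ((fun x => f w (a, x))^[i] (s w a)) := by
    intro i hi
    induction i with
    | zero => rfl
    | succ i ih =>
      rw [Function.iterate_succ_apply', ih (by omega)]
      have := hb w a (i + 1) hi
      rw [Function.iterate_succ_apply'] at this ⊢
      rw [cunpair_cpair]
      have h5 := h w (a, (fun x => f w (a, x))^[i] (s w a))
      rw [enc_prod] at h5
      simp only at h5 ⊢
      rw [h5]
      exact min_eq_left this
  exact key _ le_rfl

/-- A property decidable in logarithmic space. -/
class LP (p : List Bool → α → Prop) : Prop where
  out : ∃ g : List Bool → α → ℕ, L g ∧ ∀ w a, (p w a ↔ g w a = 0)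

instance LP.eq (f g : List Bool → α → ℕ) [L f] [L g] : LP fun w a => f w a = g w a :=
  ⟨fun w a => (f w a - g w a) + (g w a - f w a), inferInstance, fun w a => by beta_reduce; omega⟩

instance LP.lt (f g : List Bool → α → ℕ) [L f] [L g] : LP fun w a => f w a < g w a :=
  ⟨fun w a => f w a + 1 - g w a, inferInstance, fun w a => by beta_reduce; omega⟩

instance LP.const (p : Prop) : LP fun _ (_ : α) => p := by
  classical
  exact ⟨fun _ _ => if p then 0 else 1, inferInstance, fun w a => by split_ifs with h <;> simp [h]⟩

instance LP.not (p : List Bool → α → Prop) [hp : LP p] : LP fun w a => ¬ p w a := by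
  obtain ⟨g, hg, h⟩ := hp
  exact ⟨fun w a => 1 - g w a, inferInstance, fun w a => by beta_reduce; rw [h]; omega⟩

instance LP.and (p q : List Bool → α → Prop) [hp : LP p] [hq : LP q] :
    LP fun w a => p w a ∧ q w a := by
  obtain ⟨g, hg, h⟩ := hp
  obtain ⟨g', hg', h'⟩ := hq
  exact ⟨fun w a => g w a + g' w a, inferInstance, fun w a => by beta_reduce; rw [h, h']; omega⟩

instance LP.or (p q : List Bool → α → Prop) [hp : LP p] [hq : LP q] :
    LP fun w a => p w a ∨ q w a := by
  obtain ⟨g, hg, h⟩ := hp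
  obtain ⟨g', hg', h'⟩ := hq
  exact ⟨fun w a => g w a * g' w a, inferInstance, fun w a => by rw [h, h', mul_eq_zero]⟩

instance LP.imp (p q : List Bool → α → Prop) [hp : LP p] [hq : LP q] :
    LP fun w a => p w a → q w a := by
  have : LP fun w a => ¬ p w a ∨ q w a := inferInstance
  simpa only [imp_iff_not_or] using this

theorem LP.comp {p : List Bool → β → Prop} (hp : LP p) {g : List Bool → α → β} (hg : L g) :
    LP fun w a => p w (g w a) := by
  obtain ⟨f, hf, h⟩ := hp
  exact ⟨fun w a => f w (g w a), hf.comp hg, fun w a => h w _⟩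

/-- Case distinction. -/
instance L.ite (p : List Bool → α → Prop) [hp : LP p] {d : ∀ w a, Decidable (p w a)}
    (f g : List Bool → α → β) [hf : L f] [hg : L g] :
    L fun w a => if p w a then f w a else g w a := by
  obtain ⟨t, ht, h⟩ := hp
  have h1 := L.iterate (f := fun _ (q : α × (β × β)) => (q.2.2, q.2.2)) inferInstance t
    (fun w a => (f w a, g w a))
    (fun w a => cpair (enc (f w a) + enc (g w a))
      (enc (f w a) + enc (g w a))) (fun w a i hi => by
      have e : ((fun x : β × β => (x.2, x.2))^[i] (f w a, g w a)).2 = g w a := by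
        clear hi
        induction i with
        | zero => rfl
        | succ i ih => rw [Function.iterate_succ_apply']; exact ih
      cases i with
      | zero => exact cpair_mono (Nat.le_add_right _ _) (Nat.le_add_left _ _)
      | succ i =>
        rw [Function.iterate_succ_apply'] at e ⊢
        simp only at e ⊢
        rw [e]
        exact cpair_mono (Nat.le_add_left _ _) (Nat.le_add_left _ _))
  have h2 : L fun w a => ((fun x : β × β => (x.2, x.2))^[t w a] (f w a, g w a)).1 := inferInstance
  convert h2 using 3 with w a
  split_ifs with hp
  · rw [(h w a).1 hp]; rfl
  · have e : ∀ i, ((fun x : β × β => (x.2, x.2))^[i] (f w a, g w a)).2 = g w a := fun i => by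
      induction i with
      | zero => rfl
      | succ i ih => rw [Function.iterate_succ_apply']; exact ih
    obtain ⟨i, hi⟩ := Nat.exists_eq_succ_of_ne_zero (mt (h w a).2 hp)
    rw [hi, Function.iterate_succ_apply']
    exact (e i).symm

instance L.sum (n : List Bool → α → ℕ) (f : List Bool → α → ℕ → ℕ) [hn : L n]
    [hf : L fun w (p : α × ℕ) => f w p.1 p.2] :
    L fun w a => ∑ i ∈ Finset.range (n w a), f w a i := by
  obtain ⟨k, hk⟩ := hf.bound
  have hstep : L fun w (p : α × (ℕ × ℕ)) => f w p.1 p.2.1 :=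
    hf.comp (g := fun w (p : α × (ℕ × ℕ)) => (p.1, p.2.1)) inferInstance
  have e : ∀ w a i, (fun x : ℕ × ℕ => (x.1 + 1, x.2 + f w a x.1))^[i] (0, 0) =
      (i, ∑ j ∈ Finset.range i, f w a j) := by
    intro w a i
    induction i with
    | zero => rfl
    | succ i ih => rw [Function.iterate_succ_apply', ih, Finset.sum_range_succ]
  have h1 := L.iterate (f := fun w (p : α × (ℕ × ℕ)) => (p.2.1 + 1, p.2.2 + f w p.1 p.2.1))
    inferInstance n (fun _ _ => (0, 0)) (fun w a => cpair (n w a)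
      (n w a * (w.length + cpair (enc a) (n w a) + 2) ^ k)) (fun w a i hi => by
      simp only [e]
      refine cpair_mono hi ?_
      change ∑ j ∈ Finset.range i, f w a j ≤ _
      refine (Finset.sum_le_card_nsmul _ _
        ((w.length + cpair (enc a) (n w a) + 2) ^ k) fun j hj => ?_).trans ?_
      · refine (hk w (a, j)).trans (Nat.pow_le_pow_left ?_ k)
        have := cpair_mono (le_refl (enc a)) ((Finset.mem_range.1 hj).le.trans hi)
        simpa [enc_prod, enc_nat] using this
      · rw [Finset.card_range, smul_eq_mul]
        exact Nat.mul_le_mul_right _ hi)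
  simp only [e] at h1
  exact L.snd (β := ℕ) _ (hf := h1)

instance LP.forall_lt (n : List Bool → α → ℕ) (p : List Bool → α → ℕ → Prop) [hn : L n]
    [hp : LP fun w (q : α × ℕ) => p w q.1 q.2] :
    LP fun w a => ∀ i, i < n w a → p w a i := by
  obtain ⟨g, hg, h⟩ := hp
  refine ⟨fun w a => ∑ i ∈ Finset.range (n w a), g w (a, i), ?_, fun w a => ?_⟩
  · exact L.sum n (fun w a i => g w (a, i)) (hf := hg)
  · rw [Finset.sum_eq_zero_iff]
    simp only [Finset.mem_range, ← h w (a, _)]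

instance LP.exists_lt (n : List Bool → α → ℕ) (p : List Bool → α → ℕ → Prop) [hn : L n]
    [hp : LP fun w (q : α × ℕ) => p w q.1 q.2] :
    LP fun w a => ∃ i, i < n w a ∧ p w a i := by
  have : LP fun w a => ¬ ∀ i, i < n w a → ¬ p w a i := inferInstance
  simpa only [not_forall, not_not, exists_prop] using this

end basic

/-- The least `i < n` with `p i`, or `n` if there is none. -/
noncomputable def bmin (n : ℕ) (p : ℕ → Prop) : ℕ := by
  classical exact ∑ i ∈ Finset.range n, if ∃ j, j < i + 1 ∧ p j then 0 else 1

theorem bmin_eq {n m : ℕ} {p : ℕ → Prop} (hm : m ≤ n) (h : ∀ j < m, ¬ p j) (h' : m = n ∨ p m) :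
    bmin n p = m := by
  classical
  rw [bmin]
  have e : ∀ i ∈ Finset.range n, (if ∃ j, j < i + 1 ∧ p j then 0 else 1) =
      if i ∈ Finset.range m then 1 else 0 := by
    intro i hi
    rw [Finset.mem_range] at hi
    by_cases him : i < m
    · rw [if_neg, if_pos (Finset.mem_range.2 him)]
      rintro ⟨j, hj, hpj⟩
      exact h j (by omega) hpj
    · rw [if_pos, if_neg (by simpa using him)]
      exact ⟨m, by omega, h'.resolve_left (by omega)⟩
  rw [Finset.sum_congr rfl e, Finset.sum_ite_mem, Finset.inter_eq_right.2]
  · simp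
  · simpa using hm

theorem bmin_spec {n : ℕ} {p : ℕ → Prop} (h : ∃ i < n, p i) :
    bmin n p < n ∧ p (bmin n p) ∧ ∀ j < bmin n p, ¬ p j := by
  classical
  have hex : ∃ i, p i := h.imp fun _ h => h.2
  obtain ⟨i, hi, hp⟩ := h
  have hle : Nat.find hex ≤ i := Nat.find_min' hex hp
  rw [bmin_eq (m := Nat.find hex) (by omega) (fun j hj => Nat.find_min hex hj)
    (.inr (Nat.find_spec hex))]
  exact ⟨by omega, Nat.find_spec hex, fun j hj => Nat.find_min hex hj⟩

theorem bmin_eq_self {n : ℕ} {p : ℕ → Prop} (h : ∀ i < n, ¬ p i) : bmin n p = n :=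
  bmin_eq le_rfl h (.inl rfl)

section derived

variable {α β γ : Type} [Enc α] [Enc β] [Enc γ]

instance L.bminOf (n : List Bool → α → ℕ) (p : List Bool → α → ℕ → Prop) [hn : L n]
    [hp : LP fun w (q : α × ℕ) => p w q.1 q.2] :
    L fun w a => bmin (n w a) (p w a) := by
  have : LP fun w (q : (α × ℕ) × ℕ) => p w q.1.1 q.2 :=
    hp.comp (g := fun w (q : (α × ℕ) × ℕ) => (q.1.1, q.2)) inferInstance
  unfold bmin
  infer_instance

instance L.div (f g : List Bool → α → ℕ) [hf : L f] [hg : L g] :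
    L fun w a => f w a / g w a := by
  have h1 : L fun w (p : α × ℕ) => f w p.1 := hf.comp inferInstance
  have h2 : L fun w (p : α × ℕ) => g w p.1 := hg.comp inferInstance
  have : L fun w a => if g w a = 0 then 0 else
    bmin (f w a) (fun i => f w a < (i + 1) * g w a) := inferInstance
  convert this using 3 with w a
  split_ifs with h
  · simp [h]
  · symm
    have h0 : 0 < g w a := Nat.pos_of_ne_zero h
    refine bmin_eq (Nat.div_le_self _ _) (fun j hj => ?_) (.inr ?_)
    · rw [not_lt, ← Nat.le_div_iff_mul_le h0]
      exact hj
    · rw [← Nat.div_lt_iff_lt_mul h0]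
      exact Nat.lt_succ_self _

instance L.mod (f g : List Bool → α → ℕ) [hf : L f] [hg : L g] :
    L fun w a => f w a % g w a := by
  have : L fun w a => f w a - g w a * (f w a / g w a) := inferInstance
  convert this using 3 with w a
  exact Nat.mod_eq_sub_mul_div

/-- Iteration with clipped values. -/
instance L.iterate_min (f : List Bool → α → ℕ → ℕ) (n s B : List Bool → α → ℕ) [hn : L n]
    [hs : L s] [hB : L B] [hf : L fun w (p : α × ℕ) => f w p.1 p.2] :
    L fun w a => (fun x => min (f w a x) (B w a))^[n w a] (s w a) := by
  have hB' : L fun w (p : α × ℕ) => B w p.1 := hB.comp inferInstance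
  refine L.iterate (f := fun w (p : α × ℕ) => min (f w p.1 p.2) (B w p.1)) inferInstance n s
    (fun w a => max (s w a) (B w a)) fun w a i hi => ?_
  cases i with
  | zero => exact le_max_left _ _
  | succ i =>
    rw [Function.iterate_succ_apply']
    exact (min_le_right _ _).trans (le_max_right _ _)

theorem min_pow_eq (b e B : ℕ) : (fun x => min (x * b) B)^[e] (min 1 B) = min (b ^ e) B := by
  induction e with
  | zero => simp
  | succ e ih =>
    rw [Function.iterate_succ_apply', ih, pow_succ]
    rcases le_total (b ^ e) B with h | h
    · rw [min_eq_left h]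
    · rw [min_eq_right h]
      rcases Nat.eq_zero_or_pos b with rfl | hb
      · simp
      · rw [min_eq_right (Nat.le_mul_of_pos_right B hb),
          min_eq_right (h.trans (Nat.le_mul_of_pos_right _ hb))]

instance L.min_pow (b e B : List Bool → α → ℕ) [hb : L b] [he : L e] [hB : L B] :
    L fun w a => min (b w a ^ e w a) (B w a) := by
  have hb' : L fun w (p : α × ℕ) => b w p.1 := hb.comp inferInstance
  have := L.iterate_min (fun w a x => x * b w a) e (fun w a => min 1 (B w a)) B
  simpa only [min_pow_eq] using this

end derived

end AutNet

namespace AutNet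

open Enc

/-! ### Word functions computable in logarithmic space -/

/-- A word that depends on the input and on registers, and whose length and letters are computable
in logarithmic space. -/
class LO {α : Type} [Enc α] (f : List Bool → α → List Bool) : Prop where
  intro ::
  length : L fun w a => (f w a).length
  sym : L fun w (p : α × ℕ) => symCode (f w p.1)[p.2]?

section

variable {α β γ : Type} [Enc α] [Enc β] [Enc γ]

theorem LO.comp {f : List Bool → β → List Bool} (hf : LO f) {g : List Bool → α → β} (hg : L g) :
    LO fun w a => f w (g w a) := by
  have : L fun w (p : α × ℕ) => g w p.1 := hg.comp inferInstance
  exact ⟨hf.length.comp hg, hf.sym.comp (g := fun w (p : α × ℕ) => (g w p.1, p.2)) inferInstance⟩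

instance L.lengthOf (f : List Bool → α → List Bool) [hf : LO f] :
    L fun w a => (f w a).length := hf.length

instance L.symOf (f : List Bool → α → List Bool) (i : List Bool → α → ℕ) [hf : LO f] [hi : L i] :
    L fun w a => symCode (f w a)[i w a]? :=
  hf.sym.comp (g := fun w a => (a, i w a)) inferInstance

instance LO.nil : LO fun _ (_ : α) => ([] : List Bool) :=
  ⟨inferInstance, by simp only [List.getElem?_nil]; infer_instance⟩

instance LO.input : LO fun w (_ : α) => w := ⟨inferInstance, inferInstance⟩

open Classical in
/-- A word given by its length and its letters. -/
theorem LO.map_range (n : List Bool → α → ℕ) (p : List Bool → α → ℕ → Prop) [hn : L n]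
    [hp : LP fun w (q : α × ℕ) => p w q.1 q.2] :
    LO fun w a => (List.range (n w a)).map fun i => decide (p w a i) := by
  refine ⟨by simpa using hn, ?_⟩
  have h1 : L fun w (q : α × ℕ) => n w q.1 := hn.comp inferInstance
  have : L fun w (q : α × ℕ) => if q.2 < n w q.1 then if p w q.1 q.2 then 2 else 1 else 0 :=
    inferInstance
  convert this using 3 with w q
  by_cases h : q.2 < n w q.1
  · by_cases h' : p w q.1 q.2 <;> simp [h, h', symCode]
  · simp [h, symCode]

instance LO.singleton (p : List Bool → α → Prop) [hp : LP p] {d : ∀ w a, Decidable (p w a)} :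
    LO fun w a => [decide (p w a)] := by
  have h1 : LP fun w (q : α × ℕ) => p w q.1 := hp.comp inferInstance
  have := LO.map_range (α := α) (fun _ _ => 1) (fun w a _ => p w a)
  convert this using 3
  simp

instance LO.singleton_true : LO fun _ (_ : α) => [true] := by
  have := LO.singleton (α := α) (fun _ _ => True) (d := fun _ _ => instDecidableTrue)
  simpa using this

instance LO.singleton_false : LO fun _ (_ : α) => [false] := by
  have := LO.singleton (α := α) (fun _ _ => False) (d := fun _ _ => instDecidableFalse)
  simpa using this

instance LO.append (f g : List Bool → α → List Bool) [hf : LO f] [hg : LO g] :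
    LO fun w a => f w a ++ g w a := by
  refine ⟨?_, ?_⟩
  · simp only [List.length_append]; infer_instance
  · have h1 : LO fun w (q : α × ℕ) => f w q.1 := hf.comp inferInstance
    have h2 : LO fun w (q : α × ℕ) => g w q.1 := hg.comp inferInstance
    have : L fun w (q : α × ℕ) => if q.2 < (f w q.1).length then symCode (f w q.1)[q.2]?
      else symCode (g w q.1)[q.2 - (f w q.1).length]? := inferInstance
    convert this using 3 with w q
    rw [List.getElem?_append]
    split_ifs <;> rfl

instance LO.take (f : List Bool → α → List Bool) (n : List Bool → α → ℕ) [hf : LO f] [hn : L n] :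
    LO fun w a => (f w a).take (n w a) := by
  refine ⟨?_, ?_⟩
  · simp only [List.length_take]; infer_instance
  · have h1 : LO fun w (q : α × ℕ) => f w q.1 := hf.comp inferInstance
    have h2 : L fun w (q : α × ℕ) => n w q.1 := hn.comp inferInstance
    have : L fun w (q : α × ℕ) => if q.2 < n w q.1 then symCode (f w q.1)[q.2]? else 0 :=
      inferInstance
    convert this using 3 with w q
    rw [List.getElem?_take]
    split_ifs <;> simp [symCode]

instance LO.ite (p : List Bool → α → Prop) [hp : LP p] {d : ∀ w a, Decidable (p w a)}
    (f g : List Bool → α → List Bool) [hf : LO f] [hg : LO g] :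
    LO fun w a => if p w a then f w a else g w a := by
  refine ⟨?_, ?_⟩
  · have : L fun w a => if p w a then (f w a).length else (g w a).length := inferInstance
    convert this using 3
    split_ifs <;> rfl
  · have h1 : LO fun w (q : α × ℕ) => f w q.1 := hf.comp inferInstance
    have h2 : LO fun w (q : α × ℕ) => g w q.1 := hg.comp inferInstance
    have h3 : LP fun w (q : α × ℕ) => p w q.1 := hp.comp inferInstance
    have : L fun w (q : α × ℕ) => if p w q.1 then symCode (f w q.1)[q.2]?
      else symCode (g w q.1)[q.2]? := inferInstance
    convert this using 3
    split_ifs <;> rfl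

theorem length_flatMap_range (n : ℕ) (f : ℕ → List Bool) :
    ((List.range n).flatMap f).length = ∑ i ∈ Finset.range n, (f i).length := by
  induction n with
  | zero => rfl
  | succ n ih => simp [List.range_succ, Finset.sum_range_succ, ih]

theorem getElem?_flatMap_range (n k : ℕ) (f : ℕ → List Bool) :
    ((List.range n).flatMap f)[k]? =
      if bmin n (fun i => k < ∑ j ∈ Finset.range (i + 1), (f j).length) < n then
        (f (bmin n fun i => k < ∑ j ∈ Finset.range (i + 1), (f j).length))[k -
          ∑ j ∈ Finset.range (bmin n fun i => k < ∑ j ∈ Finset.range (i + 1), (f j).length),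
            (f j).length]?
      else none := by
  set p : ℕ → Prop := fun i => k < ∑ j ∈ Finset.range (i + 1), (f j).length with hp
  have hmono : ∀ {i j}, i ≤ j → ∑ j ∈ Finset.range i, (f j).length ≤
      ∑ j ∈ Finset.range j, (f j).length := fun h =>
    Finset.sum_le_sum_of_subset (by simpa using h)
  by_cases h : ∃ i < n, p i
  · obtain ⟨h1, h2, h3⟩ := bmin_spec h
    generalize bmin n p = m at *
    rw [if_pos h1]
    have h4 : ∑ j ∈ Finset.range m, (f j).length ≤ k := by
      cases m with
      | zero => simp
      | succ m => simpa [p] using h3 m (by omega)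
    obtain ⟨l, rfl⟩ : ∃ l, n = m + (l + 1) := ⟨n - m - 1, by omega⟩
    rw [List.range_add, List.flatMap_append, List.getElem?_append_right
      (by rwa [length_flatMap_range]), length_flatMap_range, List.range_succ_eq_map]
    simp only [List.map_cons, List.flatMap_cons, add_zero]
    rw [List.getElem?_append_left]
    have : k < ∑ j ∈ Finset.range (m + 1), (f j).length := h2
    rw [Finset.sum_range_succ] at this
    omega
  · push Not at h
    rw [bmin_eq_self h, if_neg (lt_irrefl _), List.getElem?_eq_none]
    rw [length_flatMap_range]
    cases n with
    | zero => simp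
    | succ n => simpa [p] using h n (by omega)

instance LO.flatMap_range (n : List Bool → α → ℕ) (f : List Bool → α → ℕ → List Bool) [hn : L n]
    [hf : LO fun w (p : α × ℕ) => f w p.1 p.2] :
    LO fun w a => (List.range (n w a)).flatMap (f w a) := by
  refine ⟨?_, ?_⟩
  · simp only [length_flatMap_range]
    have : L fun w (p : α × ℕ) => (f w p.1 p.2).length := inferInstance
    infer_instance
  · have h1 : L fun w (q : α × ℕ) => n w q.1 := hn.comp inferInstance
    have h2 : L fun w (p : ((α × ℕ) × ℕ) × ℕ) => (f w p.1.1.1 p.2).length :=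
      hf.length.comp (g := fun w (p : ((α × ℕ) × ℕ) × ℕ) => (p.1.1.1, p.2)) inferInstance
    have h3 : L fun w (p : (α × ℕ) × ℕ) => (f w p.1.1 p.2).length :=
      hf.length.comp (g := fun w (p : (α × ℕ) × ℕ) => (p.1.1, p.2)) inferInstance
    have h4 : L fun w (q : α × ℕ) =>
      bmin (n w q.1) (fun i => q.2 < ∑ j ∈ Finset.range (i + 1), (f w q.1 j).length) :=
      inferInstance
    generalize hb : (fun w (q : α × ℕ) =>
      bmin (n w q.1) (fun i => q.2 < ∑ j ∈ Finset.range (i + 1), (f w q.1 j).length)) = b at h4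
    have hb' : ∀ w (q : α × ℕ), bmin (n w q.1)
      (fun i => q.2 < ∑ j ∈ Finset.range (i + 1), (f w q.1 j).length) = b w q :=
      fun w q => congrFun (congrFun hb w) q
    have h5 : LO fun w (q : α × ℕ) => f w q.1 (b w q) :=
      hf.comp (g := fun w (q : α × ℕ) => (q.1, b w q)) inferInstance
    have : L fun w (q : α × ℕ) => if b w q < n w q.1 then
      symCode (f w q.1 (b w q))[q.2 - ∑ j ∈ Finset.range (b w q), (f w q.1 j).length]? else 0 :=
      inferInstance
    convert this using 3 with w q
    rw [getElem?_flatMap_range, hb' w q]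
    split_ifs <;> rfl

/-! ### Self-delimiting encodings -/

theorem encWord_eq (l : List Bool) :
    encWord l = ((List.range l.length).flatMap fun i => [true] ++ [decide (symCode l[i]? = 2)]) ++
      [false] := by
  rw [encWord]
  congr 1
  induction l with
  | nil => rfl
  | cons a l ih =>
    rw [List.length_cons, List.range_succ_eq_map, List.flatMap_cons, List.flatMap_cons,
      List.flatMap_map, ih]
    cases a <;> simp [symCode]

instance LO.encWord (f : List Bool → α → List Bool) [hf : LO f] :
    LO fun w a => encWord (f w a) := by
  simp only [encWord_eq]
  have h1 : LO fun w (q : α × ℕ) => f w q.1 := hf.comp inferInstance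
  infer_instance

theorem size_eq_bmin (n : ℕ) : n.size = bmin (n + 1) fun i => n < min (2 ^ i) (n + 1) := by
  symm
  refine bmin_eq ?_ (fun j hj => ?_) (.inr ?_)
  · exact (Nat.size_le.2 n.lt_two_pow_self).trans (Nat.le_succ n)
  · have := Nat.lt_size.1 hj
    simp only [lt_min_iff, not_and_or]
    exact .inl (by omega)
  · exact lt_min n.lt_size_self (Nat.lt_succ_self n)

theorem bits_eq_map (n : ℕ) : n.bits =
    (List.range (bmin (n + 1) fun i => n < min (2 ^ i) (n + 1))).map
      fun i => decide (n / (min (2 ^ i) (n + 1)) % 2 = 1) := by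
  rw [← size_eq_bmin]
  refine List.ext_getElem (by simp [Nat.size_eq_bits_len]) fun i h1 h2 => ?_
  have h3 : 2 ^ i ≤ n := Nat.lt_size.1 (by rwa [← Nat.size_eq_bits_len])
  rw [List.getElem_map, List.getElem_range, min_eq_left (by omega),
    ← Nat.testBit_eq_decide_div_mod_eq, Nat.testBit_eq_inth, List.getI_eq_getElem _ h1]

instance LO.bits (n : List Bool → α → ℕ) [hn : L n] : LO fun w a => (n w a).bits := by
  simp only [bits_eq_map]
  have h1 : L fun w (q : α × ℕ) => n w q.1 := hn.comp inferInstance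
  classical
  convert LO.map_range (fun w a => bmin (n w a + 1) fun i => n w a < min (2 ^ i) (n w a + 1))
    (fun w a i => n w a / (min (2 ^ i) (n w a + 1)) % 2 = 1)

instance LO.encNat (n : List Bool → α → ℕ) [hn : L n] : LO fun w a => encNat (n w a) := by
  unfold AutNet.encNat
  infer_instance

end

/-! ### Substitution of the input -/

theorem Lnat.subst {f : List Bool → ℕ → ℕ} (hf : Lnat f) {G : List Bool → List Bool}
    (hG : LO fun w (_ : ℕ) => G w) : L fun w (n : ℕ) => f (G w) n := by
  induction hf with
  | zero => infer_instance
  | succ => infer_instance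
  | pred => infer_instance
  | left => exact L.iff_nat.2 .left
  | right => exact L.iff_nat.2 .right
  | bit => infer_instance
  | len => infer_instance
  | comp _ _ ihf ihg => exact ihf.comp ihg
  | pair _ _ ihf ihg => infer_instance
  | @iter f _ hb ihf =>
    obtain ⟨k, hk⟩ := hb
    have hl : L fun _ (n : ℕ) => (cunpair n).1 := L.iff_nat.2 .left
    have hr : L fun _ (n : ℕ) => (cunpair n).2 := L.iff_nat.2 .right
    have h : L fun w (p : ℕ × ℕ) => f (G w) p.2 := ihf.comp inferInstance
    exact L.iterate h (fun _ n => (cunpair n).1) (fun _ n => (cunpair n).2)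
      (fun w n => ((G w).length + n + 2) ^ k) fun w n i hi => hk (G w) n i hi

theorem L.subst {α β : Type} [Enc α] [Enc β] {f : List Bool → α → β} (hf : L f)
    {G : List Bool → List Bool} (hG : LO fun w (_ : ℕ) => G w) :
    L fun w a => f (G w) a := by
  obtain ⟨g, hg, h⟩ := hf
  obtain ⟨g', hg', h'⟩ := hg.subst hG
  exact ⟨g', hg', fun w a => (h' w _).trans (h _ _)⟩

theorem LO.logspaceComputable {F : List Bool → List Bool} (h : LO fun w (_ : ℕ) => F w) :
    LogspaceComputable F := by
  exact logspaceComputable_of_Lnat (L.iff_nat.1 inferInstance) (L.iff_nat.1 inferInstance)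

end AutNet

namespace AutNet

open Enc

/-! ### Finite functions and vectors -/

theorem L.table (t : ℕ → ℕ) (N : ℕ) : L fun _ (n : ℕ) => if n < N then t n else 0 := by
  induction N with
  | zero => simpa using L.const 0
  | succ N ih =>
    have : L fun _ (n : ℕ) => if n = N then t N else if n < N then t n else 0 := inferInstance
    convert this using 3 with _ n
    grind

theorem L.of_finite {α β : Type} [Enc α] [Enc β] [Finite α]
    (hα : Function.Injective (enc : α → ℕ)) (f : α → β) : L fun _ a => f a := by
  classical
  obtain ⟨N, hN⟩ : ∃ N, ∀ a : α, enc a < N := by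
    obtain ⟨N, hN⟩ := (Set.finite_range (enc : α → ℕ)).bddAbove
    exact ⟨N + 1, fun a => Nat.lt_succ_of_le (hN ⟨a, rfl⟩)⟩
  refine ⟨_, L.iff_nat.1 (L.table (fun n => if h : ∃ a : α, enc a = n then enc (f h.choose) else 0)
    N), fun w a => ?_⟩
  have h : ∃ b : α, enc b = enc a := ⟨a, rfl⟩
  rw [if_pos (hN a), dif_pos h, hα h.choose_spec]

theorem L.apply_finite {α β γ : Type} [Enc α] [Enc β] [Enc γ] [Finite β]
    (hβ : Function.Injective (enc : β → ℕ)) (f : β → γ) {g : List Bool → α → β} (hg : L g) :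
    L fun w a => f (g w a) := (L.of_finite hβ f).comp hg

theorem enc_prod_injective {α β : Type} [Enc α] [Enc β] (hα : Function.Injective (enc : α → ℕ))
    (hβ : Function.Injective (enc : β → ℕ)) : Function.Injective (enc : α × β → ℕ) := by
  rintro ⟨a, b⟩ ⟨a', b'⟩ h
  have := congrArg cunpair h
  simp only [enc_prod, cunpair_cpair, Prod.mk.injEq] at this
  rw [hα this.1, hβ this.2]

/-- The code of a vector. -/
def encVec {β : Type} [Enc β] : (k : ℕ) → (Fin k → β) → ℕ
  | 0, _ => 0
  | k + 1, v => cpair (enc (v 0)) (encVec k fun j => v j.succ)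

instance {β : Type} [Enc β] {k : ℕ} : Enc (Fin k → β) := ⟨encVec k⟩

theorem enc_vec_injective {β : Type} [Enc β] (hβ : Function.Injective (enc : β → ℕ)) {k : ℕ} :
    Function.Injective (enc : (Fin k → β) → ℕ) := by
  intro u v h
  change encVec k u = encVec k v at h
  induction k with
  | zero => exact Subsingleton.elim _ _
  | succ k ih =>
    have := congrArg cunpair h
    simp only [encVec, cunpair_cpair, Prod.mk.injEq] at this
    have h2 := ih this.2
    funext j
    refine Fin.cases (hβ this.1) (fun j => congrFun h2 j) j

theorem L.vec {α β : Type} [Enc α] [Enc β] {k : ℕ} {f : List Bool → α → Fin k → β}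
    (h : ∀ j, L fun w a => f w a j) : L f := by
  induction k with
  | zero => exact ⟨_, .const 0, fun w a => rfl⟩
  | succ k ih =>
    obtain ⟨g, hg, hg'⟩ := h 0
    obtain ⟨g', hg₁, hg₂⟩ := ih (f := fun w a j => f w a j.succ) fun j => h j.succ
    exact ⟨_, hg.pair hg₁, fun w a => by rw [hg', hg₂]; rfl⟩

theorem L.proj_self {β : Type} [Enc β] {k : ℕ} (j : Fin k) :
    L fun _ (v : Fin k → β) => v j := by
  induction k with
  | zero => exact j.elim0
  | succ k ih =>
    refine Fin.cases ⟨_, .left, fun w v => ?_⟩ (fun j => ?_) j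
    · change (cunpair (encVec (k + 1) v)).1 = _
      rw [encVec, cunpair_cpair]
    · obtain ⟨g, hg, hg'⟩ := ih j
      refine ⟨_, hg.comp .right, fun w v => ?_⟩
      change g w (cunpair (encVec (k + 1) v)).2 = _
      rw [encVec, cunpair_cpair]
      exact hg' w _

theorem L.proj {α β : Type} [Enc α] [Enc β] {k : ℕ} {f : List Bool → α → Fin k → β}
    (h : L f) (j : Fin k) : L fun w a => f w a j := (L.proj_self j).comp h

/-- A bound for the codes of vectors. -/
def vecBound (X : ℕ) : ℕ → ℕ
  | 0 => 0
  | k + 1 => cpair X (vecBound X k)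

theorem enc_vec_le {β : Type} [Enc β] {k X : ℕ} {v : Fin k → β} (h : ∀ j, enc (v j) ≤ X) :
    enc v ≤ vecBound X k := by
  change encVec k v ≤ _
  induction k with
  | zero => rfl
  | succ k ih => exact cpair_mono (h 0) (ih fun j => h _)

theorem L.vecBound {α : Type} [Enc α] (X : List Bool → α → ℕ) [hX : L X] (k : ℕ) :
    L fun w a => vecBound (X w a) k := by
  induction k with
  | zero => exact L.const 0
  | succ k ih => exact L.cpairOf _ _

instance : Enc (Option Bool) := ⟨symCode⟩

theorem symCode_injective : Function.Injective symCode := by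
  rintro (_ | _ | _) (_ | _ | _) h <;> simp_all [symCode]

/-! ### Machines as number functions -/

namespace Machine

variable (M : Machine)

instance : Finite M.State := M.finState

instance : Finite M.Sym := M.finSym

noncomputable instance : Enc M.State := ⟨fun s => Finite.equivFin M.State s⟩

noncomputable instance : Enc M.Sym := ⟨fun s => Finite.equivFin M.Sym s⟩

theorem enc_state_injective : Function.Injective (enc : M.State → ℕ) :=
  Fin.val_injective.comp (Finite.equivFin M.State).injective

theorem enc_sym_injective : Function.Injective (enc : M.Sym → ℕ) :=
  Fin.val_injective.comp (Finite.equivFin M.Sym).injective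

/-- The digit for a symbol; the blank has the digit `0`. -/
noncomputable def digit (s : M.Sym) : ℕ := by
  classical exact if s = M.blank then 0 else enc s + 1

/-- The base of the coding of tapes. -/
noncomputable def base : ℕ := Nat.card M.Sym + 1

theorem digit_lt (s : M.Sym) : M.digit s < M.base := by
  have : enc s < Nat.card M.Sym := (Finite.equivFin M.Sym s).isLt
  rw [digit, base]
  split_ifs <;> omega

theorem digit_injective : Function.Injective M.digit := by
  intro s t h
  rw [digit, digit] at h
  split_ifs at h with h1 h2 h2
  · rw [h1, h2]
  · exact M.enc_sym_injective (by omega)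

theorem digit_blank : M.digit M.blank = 0 := if_pos rfl

theorem base_pos : 0 < M.base := Nat.succ_pos _

/-- The symbol with a given digit. -/
noncomputable def symOf (d : ℕ) : M.Sym := by
  classical exact if h : ∃ s, M.digit s = d then h.choose else M.blank

theorem symOf_digit (s : M.Sym) : M.symOf (M.digit s) = s := by
  have h : ∃ t, M.digit t = M.digit s := ⟨s, rfl⟩
  rw [symOf, dif_pos h]
  exact M.digit_injective h.choose_spec

theorem L_symOf : L fun _ (d : ℕ) => M.symOf (d % M.base) := by
  refine ⟨_, L.iff_nat.1 ((L.table (fun d => enc (M.symOf d)) M.base).comp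
    (inferInstance : L fun _ (d : ℕ) => d % M.base)), fun w a => ?_⟩
  rw [if_pos (Nat.mod_lt _ M.base_pos)]
  rfl

/-- The state, the position on the input tape, and for each work tape its contents, read as a
number, and the value of the place at its head. -/
abbrev Snap : Type := M.State × (ℕ × (Fin M.tapes → ℕ × ℕ))

/-- What a machine sees. -/
abbrev View : Type := M.State × (Option Bool × (Fin M.tapes → M.Sym))

theorem enc_view_injective : Function.Injective (enc : M.View → ℕ) :=
  enc_prod_injective M.enc_state_injective (enc_prod_injective symCode_injective
    (enc_vec_injective M.enc_sym_injective))

theorem enc_snap_injective : Function.Injective (enc : M.Snap → ℕ) :=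
  enc_prod_injective M.enc_state_injective (enc_prod_injective (fun _ _ h => h)
    (enc_vec_injective (enc_prod_injective (fun _ _ h => h) fun _ _ h => h)))

noncomputable def view (w : List Bool) (x : M.Snap) : M.View :=
  (x.1, readInput w x.2.1, fun j => M.symOf (((x.2.2 j).1 / (x.2.2 j).2) % M.base))

def result (v : M.View) : Option (M.State × Move × (Fin M.tapes → M.Sym × Move) × Option Bool) :=
  M.trans v.1 v.2.1 v.2.2

def moveCode : Move → ℕ
  | .left => 0
  | .stay => 1
  | .right => 2

/-- The new state and, coded as numbers, whether the machine moves on, and the move on the input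
tape. -/
noncomputable def newState (v : M.View) : M.State := ((M.result v).map fun r => r.1).getD M.start

def going (v : M.View) : ℕ := ((M.result v).map fun _ => 1).getD 0

def inMove (v : M.View) : ℕ := ((M.result v).map fun r => moveCode r.2.1).getD 0

noncomputable def newDigit (j : Fin M.tapes) (v : M.View) : ℕ :=
  ((M.result v).map fun r => M.digit (r.2.2.1 j).1).getD 0

def workMove (j : Fin M.tapes) (v : M.View) : ℕ :=
  ((M.result v).map fun r => moveCode (r.2.2.1 j).2).getD 0

def emitted (v : M.View) : Option Bool := ((M.result v).map fun r => r.2.2.2).getD none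

noncomputable def snapStep (w : List Bool) (x : M.Snap) : M.Snap :=
  if M.going (M.view w x) = 0 then x else
    (M.newState (M.view w x),
      (if M.inMove (M.view w x) = 0 then x.2.1 - 1 else
        if M.inMove (M.view w x) = 1 then x.2.1 else min (x.2.1 + 1) (w.length + 1)),
      fun j => ((x.2.2 j).1 - (x.2.2 j).1 / (x.2.2 j).2 % M.base * (x.2.2 j).2 +
          M.newDigit j (M.view w x) * (x.2.2 j).2,
        if M.workMove j (M.view w x) = 0 then max 1 ((x.2.2 j).2 / M.base) else
          if M.workMove j (M.view w x) = 1 then (x.2.2 j).2 else (x.2.2 j).2 * M.base))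

theorem L_view : L fun w (x : M.Snap) => M.view w x := by
  have h1 : L fun w (x : M.Snap) => readInput w x.2.1 := by
    have h0 : L fun w (x : M.Snap) => w[x.2.1 - 1]? := by
      obtain ⟨g, hg, hg'⟩ := (inferInstance : L fun w (x : M.Snap) => symCode w[x.2.1 - 1]?)
      exact ⟨g, hg, hg'⟩
    have : L fun w (x : M.Snap) => if x.2.1 = 0 then none else w[x.2.1 - 1]? := inferInstance
    convert this using 3 with w x
    rcases x.2.1 with _ | p <;> simp [readInput]
  have h2 : L fun w (x : M.Snap) =>
      (fun j => M.symOf (((x.2.2 j).1 / (x.2.2 j).2) % M.base)) := by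
    refine L.vec fun j => M.L_symOf.comp ?_
    have : L fun w (x : M.Snap) => x.2.2 j := L.proj inferInstance j
    infer_instance
  unfold view
  infer_instance

theorem L_snapStep : L fun w (x : M.Snap) => M.snapStep w x := by
  have hv := M.L_view
  have h1 := L.apply_finite M.enc_view_injective M.going hv
  have h2 := L.apply_finite M.enc_view_injective M.newState hv
  have h3 := L.apply_finite M.enc_view_injective M.inMove hv
  have h4 : L fun w (x : M.Snap) => fun j =>
      ((x.2.2 j).1 - (x.2.2 j).1 / (x.2.2 j).2 % M.base * (x.2.2 j).2 +
          M.newDigit j (M.view w x) * (x.2.2 j).2,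
        if M.workMove j (M.view w x) = 0 then max 1 ((x.2.2 j).2 / M.base) else
          if M.workMove j (M.view w x) = 1 then (x.2.2 j).2 else (x.2.2 j).2 * M.base) := by
    refine L.vec fun j => ?_
    have h5 := L.apply_finite M.enc_view_injective (M.newDigit j) hv
    have h6 := L.apply_finite M.enc_view_injective (M.workMove j) hv
    have h7 : L fun w (x : M.Snap) => x.2.2 j := L.proj inferInstance j
    infer_instance
  unfold snapStep
  infer_instance

/-- The coded form of a configuration whose work tapes are blank from the cell `B` on. -/
noncomputable def snap (B : ℕ) (c : M.Cfg) : M.Snap :=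
  (c.state, c.inHead, fun j =>
    (∑ i ∈ Finset.range B, M.digit (c.tape j i) * M.base ^ i, M.base ^ c.head j))

theorem digit_sum_lt (B : ℕ) (t : ℕ → M.Sym) :
    ∑ i ∈ Finset.range B, M.digit (t i) * M.base ^ i < M.base ^ B := by
  induction B with
  | zero => simp
  | succ B ih =>
    rw [Finset.sum_range_succ, pow_succ]
    have := M.digit_lt (t B)
    nlinarith [Nat.pow_pos (n := B) M.base_pos]

theorem digit_sum_div (B h : ℕ) (hh : h < B) (t : ℕ → M.Sym) :
    (∑ i ∈ Finset.range B, M.digit (t i) * M.base ^ i) / M.base ^ h % M.base = M.digit (t h) := by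
  obtain ⟨l, rfl⟩ : ∃ l, B = h + 1 + l := ⟨B - h - 1, by omega⟩
  have hp : 0 < M.base ^ h := Nat.pow_pos M.base_pos
  have e : ∑ i ∈ Finset.range (h + 1 + l), M.digit (t i) * M.base ^ i =
      (∑ i ∈ Finset.range h, M.digit (t i) * M.base ^ i) + M.base ^ h * (M.digit (t h) +
        M.base * ∑ i ∈ Finset.range l, M.digit (t (h + 1 + i)) * M.base ^ i) := by
    rw [Finset.sum_range_add, Finset.sum_range_succ, mul_add, Finset.mul_sum, Finset.mul_sum,
      add_assoc]
    congr 1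
    congr 1
    · ring
    · exact Finset.sum_congr rfl fun i _ => by ring
  rw [e, Nat.add_mul_div_left _ _ hp, Nat.div_eq_of_lt (M.digit_sum_lt h t), zero_add,
    Nat.add_mul_mod_self_left, Nat.mod_eq_of_lt (M.digit_lt _)]

theorem digit_sum_update (B h : ℕ) (hh : h < B) (t : ℕ → M.Sym) (s : M.Sym) :
    ∑ i ∈ Finset.range B, M.digit (Function.update t h s i) * M.base ^ i =
      (∑ i ∈ Finset.range B, M.digit (t i) * M.base ^ i) - M.digit (t h) * M.base ^ h +
        M.digit s * M.base ^ h := by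
  have hm : h ∈ Finset.range B := Finset.mem_range.2 hh
  rw [← Finset.add_sum_erase _ _ hm, ← Finset.add_sum_erase (Finset.range B)
    (fun i => M.digit (t i) * M.base ^ i) hm, Function.update_self, Nat.add_sub_cancel_left,
    add_comm]
  congr 1
  exact Finset.sum_congr rfl fun i hi => by
    rw [Function.update_of_ne (Finset.ne_of_mem_erase hi)]

theorem view_snap {w : List Bool} {B : ℕ} {c : M.Cfg} (hB : ∀ j, c.head j < B) :
    M.view w (M.snap B c) = (c.state, readInput w c.inHead, fun j => c.tape j (c.head j)) := by
  simp only [view, snap, Prod.mk.injEq, true_and]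
  funext j
  rw [M.digit_sum_div _ _ (hB j), symOf_digit]

theorem result_eq_none_iff (v : M.View) : M.result v = none ↔ M.going v = 0 := by
  rw [going]
  cases M.result v <;> simp

theorem snap_next {w : List Bool} {B : ℕ} {c : M.Cfg} (hB : ∀ j, c.head j < B)
    (hbase : 1 < M.base) :
    M.snap B ((M.next w c).getD c) = M.snapStep w (M.snap B c) := by
  have hv := M.view_snap (w := w) hB
  rw [snapStep, hv]
  have hn : M.next w c = (M.result (c.state, readInput w c.inHead,
    fun j => c.tape j (c.head j))).map fun r =>
    { state := r.1
      inHead := moveInput w c.inHead r.2.1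
      head := fun j => moveWork (c.head j) (r.2.2.1 j).2
      tape := fun j => Function.update (c.tape j) (c.head j) (r.2.2.1 j).1
      out := c.out ++ r.2.2.2.toList } := rfl
  rcases hr : M.result (c.state, readInput w c.inHead, fun j => c.tape j (c.head j)) with _ | r
  · rw [if_pos ((M.result_eq_none_iff _).1 hr), hn, hr]
    rfl
  · rw [if_neg (mt (M.result_eq_none_iff _).2 (by simp [hr])), hn, hr]
    simp only [Option.map_some, Option.getD_some, newState, inMove, newDigit, workMove, hr]
    simp only [snap, Prod.mk.injEq, true_and]
    refine ⟨?_, funext fun j => ?_⟩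
    · cases r.2.1 <;> simp [moveCode, moveInput]
    · rw [M.digit_sum_update _ _ (hB j), M.digit_sum_div _ _ (hB j)]
      refine Prod.ext rfl ?_
      simp only
      cases (r.2.2.1 j).2
      · simp only [moveCode, moveWork, if_true]
        rcases c.head j with _ | h
        · rw [pow_zero, Nat.div_eq_of_lt hbase]; rfl
        · rw [pow_succ, Nat.mul_div_cancel _ M.base_pos, Nat.add_sub_cancel,
            max_eq_right (Nat.one_le_pow _ _ M.base_pos)]
      · simp [moveCode, moveWork]
      · simp [moveCode, moveWork, pow_succ]

theorem one_lt_base : 1 < M.base := by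
  have : 0 < Nat.card M.Sym := @Nat.card_pos _ ⟨M.blank⟩ _
  rw [base]; omega

/-- The snapshot after `t` steps. -/
noncomputable def snapAt (w : List Bool) (t : ℕ) : M.Snap :=
  (M.snapStep w)^[t] (M.start, 0, fun _ => (0, 1))

theorem run_succ (w : List Bool) (t : ℕ) :
    M.run w (t + 1) = (M.next w (M.run w t)).getD (M.run w t) := by
  rw [run, Function.iterate_succ_apply']; rfl

theorem snap_run {w : List Bool} {B : ℕ} (hB : ∀ t j, (M.run w t).head j < B) (t : ℕ) :
    M.snap B (M.run w t) = M.snapAt w t := by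
  induction t with
  | zero =>
    simp [snap, snapAt, run, initial, digit_blank]
  | succ t ih =>
    rw [run_succ, M.snap_next (hB t) M.one_lt_base, ih, snapAt, snapAt,
      Function.iterate_succ_apply']

theorem run_out {w : List Bool} {B : ℕ} (hB : ∀ t j, (M.run w t).head j < B) (t : ℕ) :
    (M.run w t).out = (List.range t).flatMap fun i =>
      (M.emitted (M.view w (M.snapAt w i))).toList := by
  induction t with
  | zero => rfl
  | succ t ih =>
    rw [List.range_succ, List.flatMap_append, ← ih, run_succ, List.flatMap_cons, List.flatMap_nil,
      List.append_nil, ← M.snap_run hB, M.view_snap (hB t), emitted]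
    have hn : M.next w (M.run w t) = (M.result ((M.run w t).state, readInput w (M.run w t).inHead,
        fun j => (M.run w t).tape j ((M.run w t).head j))).map fun r => _ := rfl
    rw [hn]
    rcases M.result ((M.run w t).state, readInput w (M.run w t).inHead,
        fun j => (M.run w t).tape j ((M.run w t).head j)) with _ | r
    · simp
    · simp

theorem going_snapAt {w : List Bool} {B : ℕ} (hB : ∀ t j, (M.run w t).head j < B) (t : ℕ) :
    M.going (M.view w (M.snapAt w t)) = 0 ↔ M.next w (M.run w t) = none := by
  rw [← M.snap_run hB, M.view_snap (hB t), ← result_eq_none_iff]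
  simp [next, result]

/-- A machine that halts does so before its snapshots repeat. -/
theorem halted_of_bound {w : List Bool} {X t : ℕ} (hX : ∀ i, enc (M.snapAt w i) ≤ X)
    (ht : M.going (M.view w (M.snapAt w t)) = 0) :
    ∃ i ≤ X + 1, M.going (M.view w (M.snapAt w i)) = 0 := by
  obtain ⟨i, hi, j, hj, hij, he⟩ := Finset.exists_ne_map_eq_of_card_lt_of_maps_to
    (s := Finset.range (X + 2)) (t := Finset.range (X + 1)) (by simp)
    (f := fun i => enc (M.snapAt w i)) (fun i _ => by simpa using Nat.lt_succ_of_le (hX i))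
  wlog h : i < j generalizing i j
  · exact this j hj i hi hij.symm he.symm (by omega)
  have he := M.enc_snap_injective he
  simp only [Finset.mem_range] at hi hj
  refine ⟨i, by omega, ?_⟩
  have hadd : ∀ a b, M.snapAt w (a + b) = (M.snapStep w)^[a] (M.snapAt w b) := fun a b =>
    Function.iterate_add_apply _ _ _ _
  have hper : ∀ m, M.snapAt w (m * (j - i) + i) = M.snapAt w i := by
    intro m
    induction m with
    | zero => rw [zero_mul, zero_add]
    | succ m ih =>
      rw [show (m + 1) * (j - i) + i = m * (j - i) + j by
        rw [add_mul, one_mul]; omega, hadd, ← he, ← hadd, ih]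
  have hstay : ∀ s, M.snapAt w (s + t) = M.snapAt w t := by
    intro s
    rw [hadd]
    refine Function.iterate_fixed ?_ s
    rw [snapStep, if_pos ht]
  have h1 := hper t
  have h2 : t ≤ t * (j - i) := Nat.le_mul_of_pos_right t (by omega)
  obtain ⟨s, hs⟩ : ∃ s, t * (j - i) + i = s + t := ⟨t * (j - i) + i - t, by omega⟩
  rw [hs, hstay] at h1
  rw [← h1]
  exact ht

end Machine

theorem two_pow_log_le (n : ℕ) : 2 ^ (Nat.log 2 n + 1) ≤ 2 * (n + 1) := by
  rcases Nat.eq_zero_or_pos n with rfl | h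
  · simp
  · have := Nat.pow_log_le_self 2 h.ne'
    rw [pow_succ]; omega

/-- Every function computed by a logarithmic-space Turing machine is one of the class `LO`. -/
theorem LogspaceComputable.isLO {f : List Bool → List Bool} (hf : LogspaceComputable f) :
    LO fun w (_ : ℕ) => f w := by
  obtain ⟨M, c, hM⟩ := hf
  set B : List Bool → ℕ := fun w => c * (Nat.log 2 w.length + 1) + 1 with hBdef
  have hB : ∀ w t j, (M.run w t).head j < B w := fun w t j => Nat.lt_succ_of_le ((hM w).1 t j)
  set Y : List Bool → ℕ := fun w => (2 * (w.length + 1)) ^ (c * M.base) * M.base with hY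
  have hpow : ∀ w, M.base ^ B w ≤ Y w := fun w => by
    simp only [hBdef, hY]
    rw [pow_succ]
    refine Nat.mul_le_mul_right _ ?_
    calc M.base ^ (c * (Nat.log 2 w.length + 1))
        ≤ (2 ^ M.base) ^ (c * (Nat.log 2 w.length + 1)) :=
          Nat.pow_le_pow_left M.base.lt_two_pow_self.le _
      _ = (2 ^ (Nat.log 2 w.length + 1)) ^ (c * M.base) := by
          rw [← pow_mul, ← pow_mul]; ring_nf
      _ ≤ _ := Nat.pow_le_pow_left (two_pow_log_le _) _
  set X : List Bool → ℕ := fun w => cpair (Nat.card M.State) (cpair (w.length + 1)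
    (vecBound (cpair (Y w) (Y w)) M.tapes)) with hX
  have hin : ∀ w t, (M.run w t).inHead ≤ w.length + 1 := by
    intro w t
    induction t with
    | zero => exact Nat.zero_le _
    | succ t ih =>
      rw [M.run_succ, Machine.next]
      rcases M.trans _ _ _ with _ | r
      · exact ih
      · simp only [Option.map_some, Option.getD_some]
        cases r.2.1 <;> simp only [Machine.moveInput] <;> omega
  have hle : ∀ w t, enc (M.snapAt w t) ≤ X w := by
    intro w t
    rw [← M.snap_run (hB w)]
    refine cpair_mono (Finite.equivFin M.State _).isLt.le (cpair_mono (hin w t)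
      (enc_vec_le fun j => cpair_mono ?_ ?_))
    · exact (M.digit_sum_lt _ _).le.trans (hpow w)
    · exact (Nat.pow_le_pow_right M.base_pos (hB w t j).le).trans (hpow w)
  have hXL : L fun w (_ : ℕ) => X w := by
    have : L fun w (_ : ℕ) => Y w := by simp only [hY]; infer_instance
    have := L.vecBound (fun w (_ : ℕ) => cpair (Y w) (Y w)) M.tapes
    simp only [hX]
    infer_instance
  have hsnap : L fun w (t : ℕ) => M.snapAt w t := by
    have h0 : L fun w (p : ℕ × M.Snap) => M.snapStep w p.2 := M.L_snapStep.comp inferInstance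
    exact L.iterate h0 (fun _ t => t) (fun _ _ => (M.start, 0, fun _ => (0, 1))) (fun w _ => X w)
      fun w t i _ => hle w i
  have hem := L.apply_finite M.enc_view_injective M.emitted (M.L_view.comp hsnap)
  have heq : ∀ w, f w = (List.range (X w + 1)).flatMap fun i =>
      (M.emitted (M.view w (M.snapAt w i))).toList := by
    intro w
    rw [← M.run_out (hB w)]
    obtain ⟨-, t, ht, hout⟩ := hM w
    obtain ⟨i, hi, hg⟩ := M.halted_of_bound (hle w) ((M.going_snapAt (hB w) t).2 ht)
    have hg := (M.going_snapAt (hB w) i).1 hg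
    have hstay : ∀ {t}, M.next w (M.run w t) = none → ∀ s, M.run w (s + t) = M.run w t := by
      intro t ht s
      rw [Machine.run, Function.iterate_add_apply]
      refine Function.iterate_fixed ?_ s
      have := ht
      rw [Machine.run] at this
      simp only [this, Option.getD_none]
    have e1 := hstay hg (X w + 1 - i)
    rw [show X w + 1 - i + i = X w + 1 by omega] at e1
    rw [e1, ← hout, ← hstay hg t, ← hstay ht i, add_comm]
  simp only [heq]
  have hbit : LO fun w (p : ℕ × ℕ) => (M.emitted (M.view w (M.snapAt w p.2))).toList := by
    have h1 : L fun w (p : ℕ × ℕ) => enc (M.emitted (M.view w (M.snapAt w p.2))) :=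
      (hem.comp (g := fun w (p : ℕ × ℕ) => p.2) inferInstance).encOf
    have : LO fun w (p : ℕ × ℕ) =>
      if enc (M.emitted (M.view w (M.snapAt w p.2))) = 0 then [] else
        [decide (enc (M.emitted (M.view w (M.snapAt w p.2))) = 2)] := inferInstance
    convert this using 3 with w p
    rcases M.emitted (M.view w (M.snapAt w p.2)) with _ | _ | _ <;> simp [enc, symCode]
  infer_instance

end AutNet

namespace AutNet

open Enc

/-! ### Reading sequences of numbers -/

theorem flatMap_finRange {β : Type} (n : ℕ) (f : Fin n → List β) :
    (List.finRange n).flatMap f =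
      (List.range n).flatMap fun v => if h : v < n then f ⟨v, h⟩ else [] := by
  rw [← List.map_coe_finRange_eq_range, List.flatMap_map]
  congr 1
  funext v
  simp

theorem flatMap_finRange_of_val {β : Type} (n : ℕ) (f : Fin n → List β) (g : ℕ → List β)
    (h : ∀ v : Fin n, f v = g v) :
    (List.finRange n).flatMap f = (List.range n).flatMap g := by
  rw [← List.map_coe_finRange_eq_range, List.flatMap_map]
  congr 1
  funext v
  exact h v

theorem getElem?_flatMap_range_add {β : Type} (r : ℕ → List β) {n v k : ℕ} (hv : v < n)
    (hk : k < (r v).length) :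
    ((List.range n).flatMap r)[(∑ u ∈ Finset.range v, (r u).length) + k]? = (r v)[k]? := by
  have hlen : ∀ m, ((List.range m).flatMap r).length = ∑ u ∈ Finset.range m, (r u).length := by
    intro m
    induction m with
    | zero => rfl
    | succ m ih => simp [List.range_succ, Finset.sum_range_succ, ih]
  obtain ⟨l, rfl⟩ : ∃ l, n = v + (l + 1) := ⟨n - v - 1, by omega⟩
  rw [List.range_add, List.flatMap_append, List.getElem?_append_right (by rw [hlen]; omega), hlen,
    Nat.add_sub_cancel_left, List.range_succ_eq_map]
  simp only [List.map_cons, List.flatMap_cons, add_zero]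
  rw [List.getElem?_append_left hk]

theorem encWord_cons (b : Bool) (l : List Bool) : encWord (b :: l) = true :: b :: encWord l := rfl

theorem encWord_length (l : List Bool) : (encWord l).length = 2 * l.length + 1 := by
  induction l with
  | nil => rfl
  | cons b l ih => rw [encWord_cons, List.length_cons, List.length_cons, ih, List.length_cons]; ring

theorem getElem?_encWord (pre l suf : List Bool) (i : ℕ) (hi : i ≤ l.length) :
    (pre ++ encWord l ++ suf)[pre.length + 2 * i]? = some (decide (i < l.length)) ∧
      (i < l.length → (pre ++ encWord l ++ suf)[pre.length + 2 * i + 1]? = l[i]?) := by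
  have e : ∀ k, (pre ++ encWord l ++ suf)[pre.length + k]? = (encWord l ++ suf)[k]? := by
    intro k
    rw [List.append_assoc, List.getElem?_append_right (by omega), Nat.add_sub_cancel_left]
  rw [add_assoc, e, e]
  clear e
  induction l generalizing i with
  | nil =>
    have : i = 0 := by simpa using hi
    subst this
    simp [encWord]
  | cons b l ih =>
    rw [encWord_cons]
    rcases i with _ | i
    · simp
    · rw [show 2 * (i + 1) = 2 * i + 1 + 1 by ring]
      have := ih i (by simpa using hi)
      simpa using this

/-- The length of the word whose self-delimiting encoding starts at position `p`. -/
noncomputable def tokLen (w : List Bool) (p : ℕ) : ℕ :=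
  bmin w.length fun i => ¬ symCode w[p + 2 * i]? = 2

/-- The position after the encoding that starts at position `p`. -/
noncomputable def skip (w : List Bool) (p : ℕ) : ℕ := min (p + 2 * tokLen w p + 1) w.length

/-- The number encoded at position `p`, with powers of two clipped at `B`. -/
noncomputable def tokVal (w : List Bool) (B p : ℕ) : ℕ :=
  ∑ i ∈ Finset.range (tokLen w p), (symCode w[p + 2 * i + 1]? - 1) * min (2 ^ i) B

/-- The `i`-th of the numbers encoded from position `p` on. -/
noncomputable def tok (w : List Bool) (B p i : ℕ) : ℕ := tokVal w B ((skip w)^[i] p)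

section

variable {α : Type} [Enc α]

instance L.tokLenOf (p : List Bool → α → ℕ) [hp : L p] : L fun w a => tokLen w (p w a) := by
  have h1 : L fun w (q : α × ℕ) => p w q.1 := hp.comp inferInstance
  unfold tokLen
  infer_instance

instance L.skipOf (p : List Bool → α → ℕ) [hp : L p] : L fun w a => skip w (p w a) := by
  unfold skip
  infer_instance

instance L.tokValOf (B p : List Bool → α → ℕ) [hB : L B] [hp : L p] :
    L fun w a => tokVal w (B w a) (p w a) := by
  have h1 : L fun w (q : α × ℕ) => p w q.1 := hp.comp inferInstance
  have h2 : L fun w (q : α × ℕ) => B w q.1 := hB.comp inferInstance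
  unfold tokVal
  infer_instance

instance L.iterate_skip (n p : List Bool → α → ℕ) [hn : L n] [hp : L p] :
    L fun w a => (skip w)^[n w a] (p w a) := by
  have h : L fun w a => (fun x => min (x + 2 * tokLen w x + 1) w.length)^[n w a] (p w a) :=
    inferInstance
  exact h

instance L.tokOf (B p i : List Bool → α → ℕ) [hB : L B] [hp : L p] [hi : L i] :
    L fun w a => tok w (B w a) (p w a) (i w a) := by
  unfold tok
  infer_instance

end

theorem tokLen_eq (pre l suf : List Bool) :
    tokLen (pre ++ encWord l ++ suf) pre.length = l.length := by
  refine bmin_eq ?_ (fun j hj => ?_) (.inr ?_)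
  · simp only [List.length_append, encWord_length]; omega
  · rw [(getElem?_encWord pre l suf j hj.le).1]
    simp [hj, symCode]
  · rw [(getElem?_encWord pre l suf _ le_rfl).1]
    simp [symCode]

theorem skip_eq (pre l suf : List Bool) :
    skip (pre ++ encWord l ++ suf) pre.length = (pre ++ encWord l).length := by
  rw [skip, tokLen_eq, min_eq_left]
  · rw [List.length_append, encWord_length]; ring
  · simp only [List.length_append, encWord_length]; omega

theorem sum_bits (n : ℕ) :
    ∑ i ∈ Finset.range n.bits.length, (symCode n.bits[i]? - 1) * 2 ^ i = n := by
  induction n using Nat.strong_induction_on with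
  | _ n ih =>
  obtain ⟨m, rfl | rfl⟩ := n.even_or_odd'
  · rcases Nat.eq_zero_or_pos m with rfl | hm
    · simp
    · rw [Nat.bit0_bits _ (by omega), List.length_cons, Finset.sum_range_succ']
      simp only [List.getElem?_cons_succ, List.getElem?_cons_zero, pow_succ, ← mul_assoc]
      rw [← Finset.sum_mul, ih m (by omega)]
      simp [mul_comm, symCode]
  · rw [Nat.bit1_bits, List.length_cons, Finset.sum_range_succ']
    simp only [List.getElem?_cons_succ, List.getElem?_cons_zero, pow_succ, ← mul_assoc]
    rw [← Finset.sum_mul, ih m (by omega)]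
    simp [mul_comm, symCode]

theorem tokVal_eq (pre suf : List Bool) {n B : ℕ} (h : n < B) :
    tokVal (pre ++ encNat n ++ suf) B pre.length = n := by
  rw [tokVal, encNat, tokLen_eq]
  conv_rhs => rw [← sum_bits n]
  refine Finset.sum_congr rfl fun i hi => ?_
  have hi' := Finset.mem_range.1 hi
  rw [(getElem?_encWord pre n.bits suf i hi'.le).2 hi', min_eq_left]
  have := Nat.lt_size.1 (by rwa [← Nat.size_eq_bits_len])
  omega

theorem append_flatMap_encNat (pre suf : List Bool) (ts : List ℕ) {i : ℕ} (hi : i < ts.length) :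
    pre ++ ts.flatMap encNat ++ suf = (pre ++ (ts.take i).flatMap encNat) ++
      encWord ts[i].bits ++ ((ts.drop (i + 1)).flatMap encNat ++ suf) := by
  have e : ts.flatMap encNat = (ts.take i).flatMap encNat ++
      (encWord ts[i].bits ++ (ts.drop (i + 1)).flatMap encNat) := by
    conv_lhs => rw [← List.take_append_drop i ts, List.drop_eq_getElem_cons hi]
    rw [List.flatMap_append, List.flatMap_cons]
    rfl
  rw [e]
  simp only [List.append_assoc]

theorem iterate_skip_eq (pre suf : List Bool) (ts : List ℕ) (i : ℕ) (hi : i ≤ ts.length) :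
    (skip (pre ++ ts.flatMap encNat ++ suf))^[i] pre.length =
      (pre ++ (ts.take i).flatMap encNat).length := by
  induction i with
  | zero => simp
  | succ i ih =>
    rw [Function.iterate_succ_apply', ih (by omega), append_flatMap_encNat pre suf ts hi, skip_eq,
      List.take_succ_eq_append_getElem hi, List.flatMap_append, List.append_assoc]
    simp only [List.flatMap_cons, List.flatMap_nil, List.append_nil]
    rfl

theorem tok_eq (pre suf : List Bool) (ts : List ℕ) {B i : ℕ} (hi : i < ts.length)
    (hB : ts[i] < B) : tok (pre ++ ts.flatMap encNat ++ suf) B pre.length i = ts[i] := by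
  rw [tok, iterate_skip_eq pre suf ts i hi.le, append_flatMap_encNat pre suf ts hi]
  exact tokVal_eq _ _ hB

theorem length_le_flatMap_encNat (ts : List ℕ) : ts.length ≤ (ts.flatMap encNat).length := by
  induction ts with
  | nil => simp
  | cons a ts ih =>
    simp only [List.flatMap_cons, List.length_append, List.length_cons, encNat, encWord_length]
    omega

/-! ### Reading local maps -/

namespace LocalMaps

variable {q n : ℕ}

/-- The record of a node: its degree, its in-neighbours, and its transition table. -/
def record (R : LocalMaps q n) (v : Fin n) : List ℕ :=
  (R.nbr v).length :: ((R.nbr v).map Fin.val ++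
    (List.finRange (q ^ (R.nbr v).length)).map fun i => (R.loc v (finFunctionFinEquiv.symm i)).val)

def recordN (R : LocalMaps q n) (v : ℕ) : List ℕ := if h : v < n then R.record ⟨v, h⟩ else []

def tokens (R : LocalMaps q n) : List ℕ := n :: (List.range n).flatMap R.recordN

theorem encode_eq (R : LocalMaps q n) : R.encode = R.tokens.flatMap encNat := by
  rw [encode, tokens, List.flatMap_cons, ← flatMap_finRange_of_val n R.record, List.flatMap_assoc]
  · congr 2
    funext v
    have h : (R.nbr v >>= fun a => pure (a : ℕ)) = (R.nbr v).map Fin.val :=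
      List.map_eq_flatMap.symm
    rw [h, record, List.flatMap_cons, List.flatMap_append, List.flatMap_map (l := List.finRange _),
      List.append_assoc]
  · intro v
    simp [recordN]

theorem length_recordN (R : LocalMaps q n) (v : Fin n) :
    (R.recordN v).length = 1 + (R.nbr v).length + q ^ (R.nbr v).length := by
  simp [recordN, record]
  ring

theorem n_lt_encode_length (R : LocalMaps q n) : n < R.encode.length := by
  rw [encode_eq]
  refine lt_of_lt_of_le ?_ (length_le_flatMap_encNat _)
  rw [tokens, List.length_cons, Nat.lt_succ_iff]
  have : ∀ m ≤ n, m ≤ ((List.range m).flatMap R.recordN).length := by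
    intro m
    induction m with
    | zero => simp
    | succ m ih =>
      intro hm
      have := R.length_recordN ⟨m, hm⟩
      have h2 := ih (by omega)
      rw [List.range_succ, List.flatMap_append, List.length_append]
      simp only [List.flatMap_cons, List.flatMap_nil, List.append_nil]
      simp only at this
      omega
  exact this n le_rfl

end LocalMaps

/-- The position, in the sequence of numbers, of the record of the node `v`, for local maps over
`q` letters with at most `Δ` in-neighbours. -/
noncomputable def recordPos (q Δ : ℕ) (w : List Bool) (v : ℕ) : ℕ :=
  (fun x => min (x + (1 + tok w (w.length + q + Δ) 0 x +
    if tok w (w.length + q + Δ) 0 x < Δ + 1 then q ^ tok w (w.length + q + Δ) 0 x else 0))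
      w.length)^[v] 1

/-- The number of nodes, read from the encoding of local maps. -/
noncomputable def readN (w : List Bool) : ℕ := tok w w.length 0 0

/-- The degree of a node. -/
noncomputable def readDeg (q Δ : ℕ) (w : List Bool) (v : ℕ) : ℕ :=
  tok w (w.length + q + Δ) 0 (recordPos q Δ w v)

/-- The in-neighbours of a node. -/
noncomputable def readNbr (q Δ : ℕ) (w : List Bool) (v i : ℕ) : ℕ :=
  tok w (w.length + q + Δ) 0 (recordPos q Δ w v + (1 + i))

/-- The transition table of a node. -/
noncomputable def readLoc (q Δ : ℕ) (w : List Bool) (v i : ℕ) : ℕ :=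
  tok w (w.length + q + Δ) 0 (recordPos q Δ w v + (1 + readDeg q Δ w v + i))

section

variable {α : Type} [Enc α] (q Δ : ℕ)

instance L.recordPosOf (v : List Bool → α → ℕ) [hv : L v] :
    L fun w a => recordPos q Δ w (v w a) := by
  have h1 : L fun w (p : α × ℕ) =>
      if tok w (w.length + q + Δ) 0 p.2 < Δ + 1 then q ^ tok w (w.length + q + Δ) 0 p.2 else 0 :=
    (L.table (fun d => q ^ d) (Δ + 1)).comp
      (g := fun w (p : α × ℕ) => tok w (w.length + q + Δ) 0 p.2) inferInstance
  unfold recordPos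
  infer_instance

instance L.readNOf : L fun w (_ : α) => readN w := by unfold readN; infer_instance

instance L.readDegOf (v : List Bool → α → ℕ) [hv : L v] :
    L fun w a => readDeg q Δ w (v w a) := by unfold readDeg; infer_instance

instance L.readNbrOf (v i : List Bool → α → ℕ) [hv : L v] [hi : L i] :
    L fun w a => readNbr q Δ w (v w a) (i w a) := by unfold readNbr; infer_instance

instance L.readLocOf (v i : List Bool → α → ℕ) [hv : L v] [hi : L i] :
    L fun w a => readLoc q Δ w (v w a) (i w a) := by unfold readLoc; infer_instance

end

namespace LocalMaps

variable {q n Δ : ℕ} (R : LocalMaps q n)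

theorem tok_encode {B i : ℕ} (hi : i < R.tokens.length) (hB : R.tokens[i] < B) :
    tok R.encode B 0 i = R.tokens[i] := by
  have := tok_eq [] [] R.tokens hi hB
  rwa [List.nil_append, List.append_nil, ← encode_eq] at this

theorem readN_encode : readN R.encode = n := by
  have := R.tok_encode (B := R.encode.length) (i := 0) (by simp [tokens])
    (by simpa [tokens] using R.n_lt_encode_length)
  simpa [readN, tokens] using this

theorem getElem?_tokens (v : Fin n) {k : ℕ} (hk : k < (R.recordN v).length) :
    R.tokens[1 + ∑ u ∈ Finset.range v, (R.recordN u).length + k]? = (R.recordN v)[k]? := by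
  rw [tokens, add_assoc, add_comm 1, List.getElem?_cons_succ]
  exact getElem?_flatMap_range_add R.recordN v.isLt hk

theorem length_tokens_le : R.tokens.length ≤ R.encode.length := by
  rw [encode_eq]
  exact length_le_flatMap_encNat _

theorem length_flatMap_recordN (m : ℕ) :
    ((List.range m).flatMap R.recordN).length = ∑ u ∈ Finset.range m, (R.recordN u).length := by
  induction m with
  | zero => rfl
  | succ m ih => simp [List.range_succ, Finset.sum_range_succ, ih]

theorem tok_record (hΔ : ∀ v, (R.nbr v).length ≤ Δ) (v : Fin n) {k x : ℕ}
    (hk : (R.recordN v)[k]? = some x) :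
    tok R.encode (R.encode.length + q + Δ) 0
      (1 + ∑ u ∈ Finset.range v, (R.recordN u).length + k) = x := by
  obtain ⟨hk', hx⟩ := List.getElem?_eq_some_iff.1 hk
  have h1 := R.getElem?_tokens v hk'
  rw [hk] at h1
  obtain ⟨hi, h2⟩ := List.getElem?_eq_some_iff.1 h1
  rw [← h2]
  refine R.tok_encode hi ?_
  rw [h2]
  have h3 : x ∈ R.recordN v := hx ▸ List.getElem_mem hk'
  have h4 := R.n_lt_encode_length
  have h5 := hΔ v
  simp only [recordN, record, v.isLt, dite_true, List.mem_cons, List.mem_append, List.mem_map]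
    at h3
  rcases h3 with h3 | ⟨u, -, h3⟩ | ⟨j, -, h3⟩
  · rw [h3]
    exact lt_of_le_of_lt h5 (by omega)
  · omega
  · rw [← h3]
    exact lt_of_lt_of_le (R.loc v (finFunctionFinEquiv.symm j)).isLt (by omega)

theorem recordPos_encode (hΔ : ∀ v, (R.nbr v).length ≤ Δ) (v : ℕ) (hv : v ≤ n) :
    recordPos q Δ R.encode v = 1 + ∑ u ∈ Finset.range v, (R.recordN u).length := by
  induction v with
  | zero =>
    rfl
  | succ v ih =>
    have h0 : recordPos q Δ R.encode v = _ := ih (by omega)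
    rw [recordPos] at h0 ⊢
    rw [Function.iterate_succ_apply', h0]
    have h1 := R.tok_record hΔ ⟨v, hv⟩ (k := 0) (x := (R.nbr ⟨v, hv⟩).length)
      (by have : v < n := hv
          simp [recordN, record, this])
    have h2 := R.length_recordN ⟨v, hv⟩
    simp only [add_zero] at h1 h2
    rw [h1, if_pos (by have := hΔ ⟨v, hv⟩; omega), Finset.sum_range_succ, h2, min_eq_left]
    · ring
    · refine le_trans ?_ R.length_tokens_le
      have h3 : ∑ u ∈ Finset.range (v + 1), (R.recordN u).length ≤
          ∑ u ∈ Finset.range n, (R.recordN u).length :=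
        Finset.sum_le_sum_of_subset (Finset.range_mono hv)
      rw [tokens, List.length_cons, length_flatMap_recordN]
      rw [Finset.sum_range_succ, h2] at h3
      omega

theorem readDeg_encode (hΔ : ∀ v, (R.nbr v).length ≤ Δ) (v : Fin n) :
    readDeg q Δ R.encode v = (R.nbr v).length := by
  rw [readDeg, R.recordPos_encode hΔ v v.isLt.le]
  exact R.tok_record hΔ v (k := 0) (by simp [recordN, record])

theorem readNbr_encode (hΔ : ∀ v, (R.nbr v).length ≤ Δ) (v : Fin n) (i : ℕ)
    (hi : i < (R.nbr v).length) : readNbr q Δ R.encode v i = (R.nbr v)[i] := by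
  rw [readNbr, R.recordPos_encode hΔ v v.isLt.le]
  refine R.tok_record hΔ v ?_
  rw [add_comm 1]
  simp [recordN, record, List.getElem?_append, hi]

theorem readLoc_encode (hΔ : ∀ v, (R.nbr v).length ≤ Δ) (v : Fin n)
    (i : Fin (q ^ (R.nbr v).length)) :
    readLoc q Δ R.encode v i = R.loc v (finFunctionFinEquiv.symm i) := by
  rw [readLoc, R.readDeg_encode hΔ, R.recordPos_encode hΔ v v.isLt.le]
  refine R.tok_record hΔ v ?_
  rw [show 1 + (R.nbr v).length + (i : ℕ) = (R.nbr v).length + i + 1 by ring]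
  simp [recordN, record]

end LocalMaps

end AutNet

namespace AutNet

open Enc

/-! ### Layered networks -/

/-- A layered network over `{0, …, q-1}` has `W` registers in each of `T` layers, which are
arranged in a cycle. The register `r` of the layer after `t` depends on the registers `r` and
`τ t r` of the layer `t`, where `τ t` is an involution. -/
structure Layered (q : ℕ) where
  T : ℕ
  W : ℕ
  τ : ℕ → ℕ → ℕ
  h : ℕ → ℕ → ℕ → ℕ → ℕ
  T_pos : 0 < T
  τ_lt : ∀ t < T, ∀ r < W, τ t r < W
  τ_τ : ∀ t < T, ∀ r < W, τ t (τ t r) = r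
  h_lt : ∀ t < T, ∀ r < W, ∀ x < q, ∀ y < q, h t r x y < q
  h_zero : ∀ t < T, ∀ r < W, h t r 0 0 = 0

def prevLayer (T t : ℕ) : ℕ := if t = 0 then T - 1 else t - 1

theorem prevLayer_lt {T t : ℕ} (h : t < T) : prevLayer T t < T := by
  unfold prevLayer; split <;> omega

theorem prevLayer_eq_iff {T t s : ℕ} (ht : t < T) (hs : s < T) :
    prevLayer T t = s ↔ t = (s + 1) % T := by
  unfold prevLayer
  rcases Nat.lt_or_ge (s + 1) T with h | h
  · rw [Nat.mod_eq_of_lt h]; split <;> omega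
  · rw [show s + 1 = T by omega, Nat.mod_self]; split <;> omega

/-- The encoding of the local maps of a layered network. -/
def layeredWord (q T W : ℕ) (τ : ℕ → ℕ → ℕ) (h : ℕ → ℕ → ℕ → ℕ → ℕ) : List Bool :=
  encNat (T * W) ++ (List.range (T * W)).flatMap fun v =>
    if τ (prevLayer T (v / W)) (v % W) = v % W then
      encNat 1 ++ encNat (prevLayer T (v / W) * W + v % W) ++
        (List.range q).flatMap fun x => encNat (h (prevLayer T (v / W)) (v % W) x x)
    else
      encNat 2 ++ encNat (prevLayer T (v / W) * W + v % W) ++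
        encNat (prevLayer T (v / W) * W + τ (prevLayer T (v / W)) (v % W)) ++
        (List.range (q * q)).flatMap fun i =>
          encNat (h (prevLayer T (v / W)) (v % W) (i % q) (i / q))

theorem ncard_pair_le {β : Type*} (a b : β) : ({a, b} : Set β).ncard ≤ 2 :=
  (Set.ncard_insert_le _ _).trans (by rw [Set.ncard_singleton])

namespace Layered

variable {q : ℕ} (D : Layered q)

theorem W_pos (v : Fin (D.T * D.W)) : 0 < D.W :=
  Nat.pos_of_ne_zero fun h => by have := v.isLt; simp [h] at this

theorem layer_lt (v : Fin (D.T * D.W)) : v / D.W < D.T :=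
  Nat.div_lt_of_lt_mul (lt_of_lt_of_eq v.isLt (mul_comm _ _))

theorem reg_lt (v : Fin (D.T * D.W)) : v % D.W < D.W := Nat.mod_lt _ (D.W_pos v)

theorem node_lt {t r : ℕ} (ht : t < D.T) (hr : r < D.W) : t * D.W + r < D.T * D.W :=
  lt_of_lt_of_le (Nat.add_lt_add_left hr _)
    (by rw [← Nat.succ_mul]; exact Nat.mul_le_mul_right _ ht)

def node (t r : ℕ) (ht : t < D.T) (hr : r < D.W) : Fin (D.T * D.W) := ⟨t * D.W + r, D.node_lt ht hr⟩

@[simp] theorem node_div {t r : ℕ} (ht : t < D.T) (hr : r < D.W) :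
    (D.node t r ht hr : ℕ) / D.W = t := by
  show (t * D.W + r) / D.W = t
  rw [Nat.add_comm, Nat.add_mul_div_right _ _ (by omega), Nat.div_eq_of_lt hr, zero_add]

@[simp] theorem node_mod {t r : ℕ} (ht : t < D.T) (hr : r < D.W) :
    (D.node t r ht hr : ℕ) % D.W = r := by
  show (t * D.W + r) % D.W = r
  rw [Nat.add_comm, Nat.add_mul_mod_self_right, Nat.mod_eq_of_lt hr]

theorem node_ext {u v : Fin (D.T * D.W)} (h1 : (u : ℕ) / D.W = v / D.W)
    (h2 : (u : ℕ) % D.W = v % D.W) : u = v := by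
  ext
  rw [← Nat.div_add_mod (u : ℕ) D.W, h1, h2, Nat.div_add_mod]

/-- The first in-neighbour. -/
def fstNbr (v : Fin (D.T * D.W)) : Fin (D.T * D.W) :=
  D.node (prevLayer D.T (v / D.W)) (v % D.W) (prevLayer_lt (D.layer_lt v)) (D.reg_lt v)

/-- The second in-neighbour. -/
def sndNbr (v : Fin (D.T * D.W)) : Fin (D.T * D.W) :=
  D.node (prevLayer D.T (v / D.W)) (D.τ (prevLayer D.T (v / D.W)) (v % D.W))
    (prevLayer_lt (D.layer_lt v)) (D.τ_lt _ (prevLayer_lt (D.layer_lt v)) _ (D.reg_lt v))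

def nbr (v : Fin (D.T * D.W)) : List (Fin (D.T * D.W)) :=
  if D.τ (prevLayer D.T (v / D.W)) (v % D.W) = v % D.W then [D.fstNbr v]
  else [D.fstNbr v, D.sndNbr v]

theorem nbr_length_pos (v : Fin (D.T * D.W)) : 0 < (D.nbr v).length := by
  unfold nbr; split <;> simp

theorem fst_get (v : Fin (D.T * D.W)) : (D.nbr v).get ⟨0, D.nbr_length_pos v⟩ = D.fstNbr v := by
  simp only [nbr, List.get_eq_getElem]
  split <;> rfl

theorem snd_get (v : Fin (D.T * D.W)) :
    (D.nbr v).get ⟨(D.nbr v).length - 1, Nat.sub_lt (D.nbr_length_pos v) Nat.one_pos⟩ =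
      D.sndNbr v := by
  simp only [nbr, List.get_eq_getElem]
  split
  · next h => simp [sndNbr, fstNbr, h]
  · rfl

/-- The local maps of a layered network. -/
def maps : LocalMaps q (D.T * D.W) where
  nbr := D.nbr
  nodup v := by
    unfold nbr
    split
    · simp
    · next h =>
      simp only [List.nodup_cons, List.mem_singleton, List.not_mem_nil, not_false_eq_true,
        List.nodup_nil, and_self, and_true]
      intro e
      have := congrArg (fun u : Fin (D.T * D.W) => (u : ℕ) % D.W) e
      simp only [fstNbr, sndNbr, node_mod] at this
      exact h this.symm
  loc v y := ⟨D.h (prevLayer D.T (v / D.W)) (v % D.W) (y ⟨0, D.nbr_length_pos v⟩)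
      (y ⟨(D.nbr v).length - 1, Nat.sub_lt (D.nbr_length_pos v) Nat.one_pos⟩),
    D.h_lt _ (prevLayer_lt (D.layer_lt v)) _ (D.reg_lt v) _ (Fin.isLt _) _ (Fin.isLt _)⟩

theorem net_apply (x : Fin (D.T * D.W) → Fin q) (v : Fin (D.T * D.W)) :
    (D.maps.net x v : ℕ) =
      D.h (prevLayer D.T (v / D.W)) (v % D.W) (x (D.fstNbr v)) (x (D.sndNbr v)) := by
  rw [← D.fst_get, ← D.snd_get]
  rfl

theorem eq_node_of_mem_nbr {u v : Fin (D.T * D.W)} (h : u ∈ D.nbr v) :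
    v = D.node ((u / D.W + 1) % D.T) (u % D.W) (Nat.mod_lt _ D.T_pos) (D.reg_lt u) ∨
    v = D.node ((u / D.W + 1) % D.T) (D.τ (u / D.W) (u % D.W)) (Nat.mod_lt _ D.T_pos)
      (D.τ_lt _ (D.layer_lt u) _ (D.reg_lt u)) := by
  have h1 : u = D.fstNbr v ∨ u = D.sndNbr v := by
    unfold nbr at h
    split at h
    · exact .inl (by simpa using h)
    · simpa using h
  have hp := prevLayer_lt (D.layer_lt v)
  have hl := (prevLayer_eq_iff (D.layer_lt v) hp).1 rfl
  rcases h1 with rfl | rfl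
  · left
    apply D.node_ext
    · rw [node_div, fstNbr, node_div, ← hl]
    · rw [node_mod, fstNbr, node_mod]
  · right
    apply D.node_ext
    · rw [node_div, sndNbr, node_div, ← hl]
    · rw [node_mod, sndNbr, node_div, node_mod, D.τ_τ _ hp _ (D.reg_lt v)]

theorem degreeAtMost : DegreeAtMost 4 D.maps.Edge := by
  intro v
  have h1 : {u | D.maps.Edge u v}.ncard ≤ 2 := by
    have : {u | D.maps.Edge u v} ⊆ {D.fstNbr v, D.sndNbr v} := by
      intro u hu
      have hu : u ∈ D.nbr v := hu
      unfold nbr at hu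
      split at hu
      · exact .inl (by simpa using hu)
      · simpa using hu
    exact (Set.ncard_le_ncard this (Set.toFinite _)).trans (ncard_pair_le _ _)
  have h2 : {u | D.maps.Edge v u}.ncard ≤ 2 := by
    have hs : {u | D.maps.Edge v u} ⊆ {_, _} := fun u hu => D.eq_node_of_mem_nbr hu
    exact (Set.ncard_le_ncard hs (Set.toFinite _)).trans (ncard_pair_le _ _)
  omega

theorem maps_encode : D.maps.encode = layeredWord q D.T D.W D.τ D.h := by
  rw [LocalMaps.encode, layeredWord]
  congr 1
  apply flatMap_finRange_of_val
  intro v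
  have hloc : ∀ y, ((D.maps.loc v y : Fin q) : ℕ) = D.h (prevLayer D.T (v / D.W)) (v % D.W)
      (y ⟨0, D.nbr_length_pos v⟩)
      (y ⟨(D.nbr v).length - 1, Nat.sub_lt (D.nbr_length_pos v) Nat.one_pos⟩) := fun _ => rfl
  have hb : (D.maps.nbr v >>= fun a => pure (a : ℕ)) = (D.nbr v).map Fin.val :=
    List.map_eq_flatMap.symm
  rw [hb]
  have key : ((List.finRange (q ^ (D.maps.nbr v).length)).flatMap fun i =>
      encNat (D.maps.loc v (finFunctionFinEquiv.symm i))) =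
      (List.range (q ^ (D.nbr v).length)).flatMap fun i =>
        encNat (D.h (prevLayer D.T (v / D.W)) (v % D.W) (i % q)
          (i / q ^ ((D.nbr v).length - 1) % q)) := by
    apply flatMap_finRange_of_val
    intro i
    rw [hloc]
    simp [finFunctionFinEquiv_symm_apply_val]
  rw [key]
  have hn : D.maps.nbr v = D.nbr v := rfl
  rw [hn]
  have hx : ∀ (c : ℕ → ℕ) (c' : ℕ → ℕ) (N : ℕ), (∀ i < N, c i = c' i) →
      (List.range N).flatMap (fun i => encNat (c i)) =
        (List.range N).flatMap fun i => encNat (c' i) := by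
    intro c c' N h
    apply List.flatMap_congr
    intro i hi
    rw [h i (List.mem_range.1 hi)]
  by_cases h : D.τ (prevLayer D.T (v / D.W)) (v % D.W) = v % D.W
  · have : D.nbr v = [D.fstNbr v] := if_pos h
    rw [if_pos h, this]
    simp only [List.length_singleton, pow_one, List.map_cons, List.map_nil, List.flatMap_cons,
      List.flatMap_nil, List.append_nil, Nat.sub_self, pow_zero, Nat.div_one]
    congr 1
    exact hx _ _ _ fun i hi => by rw [Nat.mod_eq_of_lt hi]
  · have : D.nbr v = [D.fstNbr v, D.sndNbr v] := if_neg h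
    rw [if_neg h, this]
    simp only [List.length_cons, List.length_nil, List.map_cons, List.map_nil, List.flatMap_cons,
      List.flatMap_nil, List.append_nil, zero_add, Nat.reduceAdd, Nat.add_one_sub_one, pow_one,
      pow_two]
    rw [← List.append_assoc (encNat 2)]
    congr 1
    exact hx _ _ _ fun i hi => by rw [Nat.mod_eq_of_lt (Nat.div_lt_of_lt_mul hi)]

/-- The registers after `s` layers. -/
def state (z : ℕ → ℕ) : ℕ → ℕ → ℕ
  | 0 => z
  | s + 1 => fun r => D.h s r (state z s r) (state z s (D.τ s r))

theorem net_iterate {z : ℕ → ℕ} {x : Fin (D.T * D.W) → Fin q}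
    (hx : ∀ u, (x u : ℕ) = if (u : ℕ) / D.W = 0 then z (u % D.W) else 0) {s : ℕ} (hs : s ≤ D.T)
    (u : Fin (D.T * D.W)) :
    (D.maps.net^[s] x u : ℕ) = if (u : ℕ) / D.W = s % D.T then D.state z s (u % D.W) else 0 := by
  induction s generalizing u with
  | zero => rw [Nat.zero_mod]; exact hx u
  | succ s ih =>
    have hs' : s < D.T := hs
    rw [Function.iterate_succ_apply', net_apply, ih hs'.le, ih hs'.le, fstNbr, sndNbr, node_div,
      node_mod, node_div, node_mod, Nat.mod_eq_of_lt hs']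
    have h1 := prevLayer_eq_iff (D.layer_lt u) hs'
    by_cases h : prevLayer D.T (u / D.W) = s
    · rw [if_pos h, if_pos h, if_pos (h1.1 h), h]
      rfl
    · rw [if_neg h, if_neg h, if_neg (fun e => h (h1.2 e)),
        D.h_zero _ (prevLayer_lt (D.layer_lt u)) _ (D.reg_lt u)]

end Layered

/-- A block embedding whose patterns are supported in the first layer. -/
structure Layered.Embedding {a : ℕ} (D : Layered a) (q n : ℕ) where
  blk : ℕ → ℕ
  pat : ℕ → ℕ → ℕ
  pos : 0 < a
  blk_lt : ∀ r < D.W, blk r < n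
  pat_lt : ∀ r < D.W, ∀ s < q, pat r s < a
  surj : ∀ i < n, ∃ r < D.W, blk r = i
  inj : ∀ i < n, ∀ s < q, ∀ s' < q, (∀ r < D.W, blk r = i → pat r s = pat r s') → s = s'

namespace Layered.Embedding

variable {a q n : ℕ} {D : Layered a} (E : D.Embedding q n)

def toBlock : BlockEmbedding q n a (D.T * D.W) where
  block u := ⟨E.blk (u % D.W), E.blk_lt _ (D.reg_lt u)⟩
  block_surjective i := by
    obtain ⟨r, hr, h⟩ := E.surj i i.isLt
    refine ⟨D.node 0 r D.T_pos hr, Fin.ext ?_⟩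
    simp only [D.node_mod]
    exact h
  pat u s := ⟨if (u : ℕ) / D.W = 0 then E.pat (u % D.W) s else 0, by
    split
    · exact E.pat_lt _ (D.reg_lt u) _ s.isLt
    · exact E.pos⟩
  inj i s s' h := by
    refine Fin.ext (E.inj i i.isLt s s.isLt s' s'.isLt fun r hr hb => ?_)
    have := h (D.node 0 r D.T_pos hr) (Fin.ext (by simp only [D.node_mod]; exact hb))
    simpa only [D.node_div, D.node_mod, if_true, Fin.mk.injEq] using this

theorem map_apply (x : Fin n → Fin q) (u : Fin (D.T * D.W)) :
    (E.toBlock.map x u : ℕ) = if (u : ℕ) / D.W = 0 then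
      E.pat (u % D.W) (x ⟨E.blk (u % D.W), E.blk_lt _ (D.reg_lt u)⟩) else 0 := rfl

theorem simulates {F : NetMap q n} (x : Fin n → Fin q)
    (h : ∀ z, (∀ r (hr : r < D.W), z r = E.pat r (x ⟨E.blk r, E.blk_lt r hr⟩)) →
      ∀ r (hr : r < D.W), D.state z D.T r = E.pat r (F x ⟨E.blk r, E.blk_lt r hr⟩)) :
    E.toBlock.map (F x) = D.maps.net^[D.T] (E.toBlock.map x) := by
  funext u
  apply Fin.ext
  let z : ℕ → ℕ := fun r => if hr : r < D.W then E.pat r (x ⟨E.blk r, E.blk_lt r hr⟩) else 0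
  have hz : ∀ r (hr : r < D.W), z r = E.pat r (x ⟨E.blk r, E.blk_lt r hr⟩) :=
    fun r hr => dif_pos hr
  rw [D.net_iterate (z := z) (fun u => by rw [map_apply, hz _ (D.reg_lt u)]) le_rfl, Nat.mod_self,
    map_apply, h z hz _ (D.reg_lt u)]

/-- The encoding of a block embedding whose patterns are supported in the first layer. -/
def word (n q T W : ℕ) (blk : ℕ → ℕ) (pat : ℕ → ℕ → ℕ) : List Bool :=
  encNat n ++ encNat (T * W) ++ (List.range (T * W)).flatMap fun u =>
    encNat (blk (u % W)) ++ (List.range q).flatMap fun s =>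
      encNat (if u / W = 0 then pat (u % W) s else 0)

theorem toBlock_encode : E.toBlock.encode = word n q D.T D.W E.blk E.pat := by
  rw [BlockEmbedding.encode, word]
  congr 1
  apply flatMap_finRange_of_val
  intro u
  congr 1
  exact flatMap_finRange_of_val _ _ _ fun s => rfl

end Layered.Embedding

section

variable {α : Type} [Enc α]

instance L.prevLayerOf (T t : List Bool → α → ℕ) [hT : L T] [ht : L t] :
    L fun w a => prevLayer (T w a) (t w a) := by unfold prevLayer; infer_instance

theorem LO.layeredWord (q : ℕ) {T W : List Bool → ℕ} {τ : List Bool → ℕ → ℕ → ℕ}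
    {h : List Bool → ℕ → ℕ → ℕ → ℕ → ℕ} (hT : L fun w (_ : ℕ) => T w) (hW : L fun w (_ : ℕ) => W w)
    (hτ : L fun w (p : ℕ × ℕ) => τ w p.1 p.2)
    (hh : L fun w (p : (ℕ × ℕ) × (ℕ × ℕ)) => h w p.1.1 p.1.2 p.2.1 p.2.2) :
    LO fun w (_ : ℕ) => layeredWord q (T w) (W w) (τ w) (h w) := by
  have h1 : L fun w (_ : ℕ × ℕ) => T w := hT.comp (g := fun _ p => p.1) inferInstance
  have h2 : L fun w (_ : ℕ × ℕ) => W w := hW.comp (g := fun _ p => p.1) inferInstance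
  have h1' : L fun w (_ : (ℕ × ℕ) × ℕ) => T w := hT.comp (g := fun _ p => p.2) inferInstance
  have h2' : L fun w (_ : (ℕ × ℕ) × ℕ) => W w := hW.comp (g := fun _ p => p.2) inferInstance
  have h3 : L fun w (p : ℕ × ℕ) => τ w (prevLayer (T w) (p.2 / W w)) (p.2 % W w) :=
    hτ.comp (g := fun w (p : ℕ × ℕ) => (prevLayer (T w) (p.2 / W w), p.2 % W w)) inferInstance
  have h4 : L fun w (p : (ℕ × ℕ) × ℕ) => h w (prevLayer (T w) (p.1.2 / W w)) (p.1.2 % W w) p.2 p.2 :=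
    hh.comp (g := fun w (p : (ℕ × ℕ) × ℕ) =>
      ((prevLayer (T w) (p.1.2 / W w), p.1.2 % W w), (p.2, p.2))) inferInstance
  have h5 : L fun w (p : (ℕ × ℕ) × ℕ) =>
      h w (prevLayer (T w) (p.1.2 / W w)) (p.1.2 % W w) (p.2 % q) (p.2 / q) :=
    hh.comp (g := fun w (p : (ℕ × ℕ) × ℕ) =>
      ((prevLayer (T w) (p.1.2 / W w), p.1.2 % W w), (p.2 % q, p.2 / q))) inferInstance
  unfold AutNet.layeredWord
  infer_instance

theorem LO.embeddingWord (q : ℕ) {n T W : List Bool → ℕ} {blk : List Bool → ℕ → ℕ}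
    {pat : List Bool → ℕ → ℕ → ℕ} (hn : L fun w (_ : ℕ) => n w) (hT : L fun w (_ : ℕ) => T w)
    (hW : L fun w (_ : ℕ) => W w) (hb : L fun w (r : ℕ) => blk w r)
    (hp : L fun w (p : ℕ × ℕ) => pat w p.1 p.2) :
    LO fun w (_ : ℕ) => Layered.Embedding.word (n w) q (T w) (W w) (blk w) (pat w) := by
  have h2 : L fun w (_ : ℕ × ℕ) => W w := hW.comp (g := fun _ p => p.1) inferInstance
  have h2' : L fun w (_ : (ℕ × ℕ) × ℕ) => W w := hW.comp (g := fun _ p => p.2) inferInstance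
  have h3 : L fun w (p : ℕ × ℕ) => blk w (p.2 % W w) :=
    hb.comp (g := fun w (p : ℕ × ℕ) => p.2 % W w) inferInstance
  have h4 : L fun w (p : (ℕ × ℕ) × ℕ) => pat w (p.1.2 % W w) p.2 :=
    hp.comp (g := fun w (p : (ℕ × ℕ) × ℕ) => (p.1.2 % W w, p.2)) inferInstance
  unfold Layered.Embedding.word
  infer_instance

end

end AutNet

namespace AutNet

/-! ### Recognizing networks of monotone gates -/

/-- The gate with `c` inputs and `c` outputs that all equal the maximum or the minimum. -/
noncomputable def monoGate (b : Bool) (c : ℕ) : LocalGate 2 :=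
  ⟨c, c, fun x _ => if b then Finset.univ.sup x else Finset.univ.inf x⟩

theorem monoGate_mem (b : Bool) {c : ℕ} (hc : c = 1 ∨ c = 2) : monoGate b c ∈ monotoneGates := by
  refine ⟨c, c, hc, hc, ?_⟩
  cases b
  · exact .inr rfl
  · exact .inl rfl

/-- A network is built from monotone gates if the nodes are grouped in pairs and singletons such
that the nodes of each group take the maximum, or the minimum, of the nodes of the group moved by a
permutation. -/
theorem IsGateNetwork.of_pairing {m : ℕ} {F : NetMap 2 m} (ρ : Equiv.Perm (Fin m))
    {κ : Fin m → Fin m} (hκ : ∀ v, κ (κ v) = v) {op : Fin m → Bool} (hop : ∀ v, op (κ v) = op v)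
    (h1 : ∀ v, ρ v ≠ v) (h2 : ∀ v, ρ v ≠ κ v)
    (hF : ∀ x v, F x v = if op v then max (x (ρ v)) (x (ρ (κ v)))
      else min (x (ρ v)) (x (ρ (κ v)))) :
    IsGateNetwork monotoneGates ⟨m, F⟩ := by
  classical
  let e := Finite.equivFin (Set.range fun v => min v (κ v))
  let f : Fin m → Fin (Nat.card (Set.range fun v => min v (κ v))) :=
    fun v => e ⟨min v (κ v), v, rfl⟩
  have hf : ∀ v w, f v = f w ↔ v = w ∨ v = κ w := by
    intro v w
    have h3 : f v = f w ↔ min v (κ v) = min w (κ w) :=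
      e.apply_eq_iff_eq.trans Subtype.ext_iff
    rw [h3]
    constructor
    · intro h
      rcases min_choice v (κ v) with h4 | h4 <;> rcases min_choice w (κ w) with h5 | h5 <;>
        rw [h4, h5] at h
      · exact .inl h
      · exact .inr h
      · right; rw [← h, hκ]
      · left; rw [← hκ v, h, hκ]
    · rintro (rfl | rfl)
      · rfl
      · rw [hκ, min_comm]
  have hsurj : Function.Surjective f := by
    intro j
    obtain ⟨⟨_, v, rfl⟩, rfl⟩ := e.surjective j
    exact ⟨v, rfl⟩
  let s := Function.surjInv hsurj
  have hs : ∀ j, f (s j) = j := Function.surjInv_eq hsurj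
  let ε := fun j => Finite.equivFin {v // f v = j}
  let β : Fin m ≃ Σ j, Fin (Nat.card {v // f v = j}) :=
    (Equiv.sigmaFiberEquiv f).symm.trans (Equiv.sigmaCongrRight ε)
  have hβ : ∀ v, (β v).1 = f v := fun v => rfl
  have hβs : ∀ p, f (β.symm p) = p.1 := fun p => by rw [← hβ, Equiv.apply_symm_apply]
  have hops : ∀ v, op (s (f v)) = op v := by
    intro v
    rcases (hf _ _).1 (hs (f v)) with h | h
    · rw [h]
    · rw [h, hop]
  have hcard : ∀ j, Nat.card {v // f v = j} = 1 ∨ Nat.card {v // f v = j} = 2 := by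
    intro j
    have h3 : {v | f v = j} = {s j, κ (s j)} := by
      ext v
      rw [Set.mem_ofPred_eq, ← hs j, hf, hs]
      rfl
    have h4 : Nat.card {v // f v = j} = ({s j, κ (s j)} : Set (Fin m)).ncard := by
      rw [← h3]; rfl
    rw [h4]
    by_cases h : s j = κ (s j)
    · left; rw [← h]; simp
    · right; exact Set.ncard_pair h
  refine ⟨_, fun j => monoGate (op (s j)) (Nat.card {v // f v = j}), β.symm.trans ρ, β,
    fun j => monoGate_mem _ (hcard j), ?_, ?_⟩
  · intro p h
    change f (ρ (β.symm p)) = _ at h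
    rw [← hβs p] at h
    rcases (hf _ _).1 h with h | h
    · exact h1 _ h
    · exact h2 _ h
  · intro x v
    have hmem : ∀ k, β.symm ⟨(β v).1, k⟩ = v ∨ β.symm ⟨(β v).1, k⟩ = κ v := by
      intro k
      rw [← hf, hβs]
      rfl
    have hex : ∀ w, w = v ∨ w = κ v → ∃ k, β.symm ⟨(β v).1, k⟩ = w := by
      intro w hw
      have h3 : (β v).1 = (β w).1 := ((hf w v).2 hw).symm
      obtain ⟨k, hk⟩ : ∃ k, (⟨(β v).1, k⟩ : Σ j, Fin (Nat.card {v // f v = j})) = β w := by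
        rw [h3]; exact ⟨_, rfl⟩
      exact ⟨k, by rw [hk, Equiv.symm_apply_apply]⟩
    obtain ⟨k1, hk1⟩ := hex v (.inl rfl)
    obtain ⟨k2, hk2⟩ := hex (κ v) (.inr rfl)
    refine (hF x v).trans ?_
    change _ = if op (s (f v)) then _ else _
    rw [hops]
    split
    · refine le_antisymm (max_le ?_ ?_) (Finset.sup_le fun k _ => ?_)
      · refine (congrArg (fun v => x (ρ v)) hk1).ge.trans ?_
        exact Finset.le_sup (f := fun k => x (ρ (β.symm ⟨(β v).1, k⟩))) (Finset.mem_univ k1)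
      · refine (congrArg (fun v => x (ρ v)) hk2).ge.trans ?_
        exact Finset.le_sup (f := fun k => x (ρ (β.symm ⟨(β v).1, k⟩))) (Finset.mem_univ k2)
      · change x (ρ (β.symm ⟨(β v).1, k⟩)) ≤ _
        rcases hmem k with h | h <;> rw [h]
        · exact le_max_left _ _
        · exact le_max_right _ _
    · refine le_antisymm (Finset.le_inf fun k _ => ?_) (le_min ?_ ?_)
      · change _ ≤ x (ρ (β.symm ⟨(β v).1, k⟩))
        rcases hmem k with h | h <;> rw [h]
        · exact min_le_left _ _
        · exact min_le_right _ _
      · refine LE.le.trans ?_ (congrArg (fun v => x (ρ v)) hk1).le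
        exact Finset.inf_le (f := fun k => x (ρ (β.symm ⟨(β v).1, k⟩))) (Finset.mem_univ k1)
      · refine LE.le.trans ?_ (congrArg (fun v => x (ρ v)) hk2).le
        exact Finset.inf_le (f := fun k => x (ρ (β.symm ⟨(β v).1, k⟩))) (Finset.mem_univ k2)

/-! ### Straight-line programs of monotone gates -/

/-- An instruction of a straight-line program: both registers receive the disjunction (`true`) or
the conjunction (`false`) of the two. -/
abbrev Instr (ι : Type) : Type := Bool × ι × ι

section

variable {ι : Type} [DecidableEq ι]

def Instr.exec (i : Instr ι) (σ : ι → Bool) : ι → Bool := fun r =>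
  if r = i.2.1 ∨ r = i.2.2 then
    if i.1 then σ i.2.1 || σ i.2.2 else σ i.2.1 && σ i.2.2
  else σ r

def execAll (l : List (Instr ι)) (σ : ι → Bool) : ι → Bool := l.foldl (fun σ i => i.exec σ) σ

@[simp] theorem execAll_nil (σ : ι → Bool) : execAll [] σ = σ := rfl

@[simp] theorem execAll_cons (i : Instr ι) (l : List (Instr ι)) (σ : ι → Bool) :
    execAll (i :: l) σ = execAll l (i.exec σ) := rfl

theorem execAll_append (l l' : List (Instr ι)) (σ : ι → Bool) :
    execAll (l ++ l') σ = execAll l' (execAll l σ) := List.foldl_append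

/-- A list of instructions of which the one for `x` sets the register `k x` to `val (k x)` and
leaves the other registers unchanged, as long as the registers outside `K` are. -/
theorem execAll_map {κ : Type} (instr : κ → Instr ι) (k : κ → ι) (val : ι → Bool) (K : ι → Prop)
    (l : List κ) (hk : ∀ x ∈ l, K (k x)) (σ₀ : ι → Bool)
    (h : ∀ σ, (∀ r, (¬ K r → σ r = σ₀ r)) → (∀ r, σ r = σ₀ r ∨ σ r = val r) → ∀ x ∈ l,
      (instr x).exec σ = Function.update σ (k x) (val (k x))) (r : ι) :
    execAll (l.map instr) σ₀ r = if ∃ x ∈ l, k x = r then val r else σ₀ r := by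
  classical
  have main : ∀ (l' : List κ) (σ : ι → Bool), l' ⊆ l → (∀ r, (¬ K r → σ r = σ₀ r)) →
      (∀ r, σ r = σ₀ r ∨ σ r = val r) →
      execAll (l'.map instr) σ r = if ∃ x ∈ l', k x = r then val r else σ r := by
    intro l'
    induction l' with
    | nil => simp
    | cons x l' ih =>
      intro σ hl h1 h2
      have hx : x ∈ l := hl (List.mem_cons_self)
      rw [List.map_cons, execAll_cons, h σ h1 h2 x hx, ih]
      · by_cases h3 : ∃ y ∈ l', k y = r
        · rw [if_pos h3, if_pos (by obtain ⟨y, hy, h4⟩ := h3; exact ⟨y, .tail _ hy, h4⟩)]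
        · rw [if_neg h3]
          by_cases h4 : k x = r
          · rw [if_pos ⟨x, .head _, h4⟩, h4, Function.update_self]
          · rw [Function.update_of_ne (Ne.symm h4), if_neg]
            simpa [h4] using h3
      · exact fun y hy => hl (List.mem_cons_of_mem _ hy)
      · grind [Function.update_apply]
      · grind [Function.update_apply]
  exact main l σ₀ (List.Subset.refl l) (fun _ _ => rfl) (fun _ => .inl rfl)

end

/-- The registers of the block of a node that simulates a node with `q` states and at most `Δ` in-
and out-neighbours. -/
inductive Reg (q Δ : ℕ)
  | zero
  | one
  | cur
  | acc
  | new (s : Fin q)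
  | inp (b : Fin Δ) (s : Fin q)
  | out (a : Fin Δ) (s : Fin q)
  deriving DecidableEq

namespace Reg

variable {q Δ : ℕ}

instance : Finite (Reg q Δ) := by
  let f : Reg q Δ → Option (Option (Option (Option (Fin q ⊕ (Fin Δ × Fin q) ⊕ (Fin Δ × Fin q))))) :=
    fun r => match r with
    | zero => none
    | one => some none
    | cur => some (some none)
    | acc => some (some (some none))
    | new s => some (some (some (some (.inl s))))
    | inp b s => some (some (some (some (.inr (.inl (b, s))))))
    | out a s => some (some (some (some (.inr (.inr (a, s))))))
  refine Finite.of_injective f fun r r' h => ?_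
  cases r <;> cases r' <;> simp_all [f]

/-- The contents of the registers between two simulated steps, for the state `s`. -/
def rest [NeZero q] (s : Fin q) : Reg q Δ → Bool
  | one => true
  | inp _ s' => decide (s' = 0)
  | out _ s' => decide (s' = s)
  | _ => false

/-- Sets the register `new (f y)` if the inputs are those given by `y`. -/
def matchProg (f : (Fin Δ → Fin q) → Fin q) (y : Fin Δ → Fin q) : List (Instr (Reg q Δ)) :=
  (true, acc, one) :: ((List.finRange Δ).flatMap fun i =>
    [(true, cur, inp i (y i)), (false, acc, cur), (false, cur, zero)]) ++
    [(true, new (f y), acc), (false, acc, zero)]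

/-- Computes the new state from the inputs, and restores the registers. -/
noncomputable def prog [NeZero q] (f : (Fin Δ → Fin q) → Fin q) : List (Instr (Reg q Δ)) :=
  ((Finset.univ : Finset (Fin Δ → Fin q)).toList.flatMap (matchProg f)) ++
    ((Finset.univ : Finset (Fin Δ × Fin q)).toList.map fun p => (false, out p.1 p.2, zero)) ++
    ((Finset.univ : Finset (Fin Δ × Fin q)).toList.map fun p =>
      if p.2 = 0 then (true, inp p.1 p.2, one) else (false, inp p.1 p.2, zero)) ++
    ((Finset.univ : Finset (Fin Δ × Fin q)).toList.map fun p => (true, out p.1 p.2, new p.2)) ++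
    ((Finset.univ : Finset (Fin q)).toList.map fun s => (false, new s, zero))

theorem length_prog [NeZero q] (f f' : (Fin Δ → Fin q) → Fin q) :
    (prog f).length = (prog f').length := by
  have : ∀ y, (matchProg f y).length = (matchProg f' y).length := by
    intro y
    simp [matchProg, List.length_flatMap]
  simp only [prog, List.length_append, List.length_map, List.length_flatMap, this]

theorem execAll_matchProg (f : (Fin Δ → Fin q) → Fin q) (y : Fin Δ → Fin q) (σ : Reg q Δ → Bool)
    (h0 : σ zero = false) (h1 : σ one = true) (hc : σ cur = false) (ha : σ acc = false) :
    execAll (matchProg f y) σ = Function.update σ (new (f y))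
      (σ (new (f y)) || decide (∀ i, σ (inp i (y i)) = true)) := by
  have inner : ∀ (l : List (Fin Δ)) (b : Bool),
      execAll (l.flatMap fun i => [(true, cur, inp i (y i)), (false, acc, cur), (false, cur, zero)])
        (Function.update σ acc b) =
      Function.update σ acc (b && decide (∀ i ∈ l, σ (inp i (y i)) = true)) := by
    intro l
    induction l with
    | nil => simp
    | cons i l ih =>
      intro b
      have h3 : execAll [(true, cur, inp i (y i)), (false, acc, cur), (false, cur, zero)]
          (Function.update σ acc b) = Function.update σ acc (b && σ (inp i (y i))) := by
        funext r
        simp only [execAll_cons, execAll_nil, Instr.exec]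
        grind [Function.update_apply]
      rw [List.flatMap_cons, execAll_append, h3, ih]
      congr 1
      simp [Bool.and_assoc, Bool.decide_and]
  have h4 : Instr.exec (true, acc, one) σ = Function.update σ acc true := by
    funext r
    simp only [Instr.exec]
    grind [Function.update_apply]
  rw [matchProg, execAll_append, execAll_cons (true, acc, one), h4, inner]
  simp only [List.mem_finRange, forall_true_left, Bool.true_and]
  generalize decide (∀ i, σ (inp i (y i)) = true) = b
  funext r
  simp only [execAll_cons, execAll_nil, Instr.exec]
  grind [Function.update_apply]

theorem execAll_matchAll (f : (Fin Δ → Fin q) → Fin q) (x : Fin Δ → Fin q)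
    (l : List (Fin Δ → Fin q)) (σ : Reg q Δ → Bool) (h0 : σ zero = false) (h1 : σ one = true)
    (hc : σ cur = false) (ha : σ acc = false) (hi : ∀ i s, σ (inp i s) = decide (s = x i)) :
    execAll (l.flatMap (matchProg f)) σ = fun r => σ r || decide (x ∈ l ∧ r = new (f x)) := by
  induction l generalizing σ with
  | nil => simp
  | cons y l ih =>
    rw [List.flatMap_cons, execAll_append, execAll_matchProg f y σ h0 h1 hc ha]
    have hxy : (∀ i, σ (inp i (y i)) = true) ↔ x = y := by
      simp only [hi, decide_eq_true_eq]
      exact ⟨fun h => (funext h).symm, fun h i => by rw [h]⟩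
    rw [ih _ (by simpa [Function.update_apply] using h0) (by simpa [Function.update_apply] using h1)
      (by simpa [Function.update_apply] using hc) (by simpa [Function.update_apply] using ha)
      (by simpa [Function.update_apply] using hi)]
    funext r
    simp only [hxy, List.mem_cons, Function.update_apply]
    grind

theorem execAll_prog [NeZero q] (f : (Fin Δ → Fin q) → Fin q) (x : Fin Δ → Fin q)
    (σ : Reg q Δ → Bool) (h0 : σ zero = false) (h1 : σ one = true)
    (hc : σ cur = false) (ha : σ acc = false) (hn : ∀ s, σ (new s) = false)
    (hi : ∀ i s, σ (inp i s) = decide (s = x i)) :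
    execAll (prog f) σ = rest (f x) := by
  simp only [prog, execAll_append]
  rw [execAll_matchAll f x _ σ h0 h1 hc ha hi]
  simp only [Finset.mem_toList, Finset.mem_univ, true_and]
  set σ₁ : Reg q Δ → Bool := fun r => σ r || decide (r = new (f x)) with e1
  set σ₂ := execAll ((Finset.univ : Finset (Fin Δ × Fin q)).toList.map
    fun p => (false, out p.1 p.2, zero)) σ₁ with e2
  have f2 : ∀ r, σ₂ r = if ∃ p : Fin Δ × Fin q, out p.1 p.2 = r then false else σ₁ r := by
    intro r
    rw [e2, execAll_map _ (fun p : Fin Δ × Fin q => out p.1 p.2) (fun _ => false) (· ≠ zero)]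
    · simp
    · simp
    · intro σ h3 _ p _
      have := h3 zero (by simp)
      funext r
      simp only [Instr.exec]
      grind [Function.update_apply]
  set σ₃ := execAll ((Finset.univ : Finset (Fin Δ × Fin q)).toList.map fun p =>
    if p.2 = 0 then (true, inp p.1 p.2, one) else (false, inp p.1 p.2, zero)) σ₂ with e3
  have f3 : ∀ r, σ₃ r =
      if ∃ p : Fin Δ × Fin q, inp p.1 p.2 = r then rest (f x) r else σ₂ r := by
    intro r
    rw [e3, execAll_map _ (fun p : Fin Δ × Fin q => inp p.1 p.2) (rest (f x))
      (fun r => r ≠ zero ∧ r ≠ one)]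
    · simp
    · simp
    · intro σ h3 _ p _
      have h4 := h3 zero (by simp)
      have h5 := h3 one (by simp)
      rw [f2] at h4 h5
      funext r
      simp only [Instr.exec, rest]
      split <;> grind [Function.update_apply]
  set σ₄ := execAll ((Finset.univ : Finset (Fin Δ × Fin q)).toList.map
    fun p => (true, out p.1 p.2, new p.2)) σ₃ with e4
  have f4 : ∀ r, σ₄ r =
      if ∃ p : Fin Δ × Fin q, out p.1 p.2 = r then rest (f x) r else σ₃ r := by
    intro r
    rw [e4, execAll_map _ (fun p : Fin Δ × Fin q => out p.1 p.2) (rest (f x))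
      (fun r => ∃ p : Fin Δ × Fin q, out p.1 p.2 = r)]
    · simp
    · simp
    · intro σ h3 h6 p _
      have h4 := h3 (new p.2) (by simp)
      have h5 := h6 (out p.1 p.2)
      rw [f3, f2] at h4 h5
      have h4' : σ (new p.2) = decide (p.2 = f x) := by rw [h4]; simp [e1, hn]
      have h5' : σ (out p.1 p.2) = false ∨ σ (out p.1 p.2) = decide (p.2 = f x) := by
        rcases h5 with h5 | h5
        · left; rw [h5]; simp
        · right; rw [h5]; rfl
      funext r
      simp only [Instr.exec, rest]
      grind [Function.update_apply]
  funext r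
  rw [execAll_map _ (fun s : Fin q => new s) (fun _ => false) (· ≠ zero)]
  · simp only [Finset.mem_toList, Finset.mem_univ, true_and]
    rw [f4, f3, f2, e1]
    cases r <;> simp_all [rest]
  · simp
  · intro σ h3 _ p _
    have := h3 zero (by simp)
    rw [f4, f3, f2] at this
    funext r
    simp only [Instr.exec]
    grind [Function.update_apply]

end Reg

end AutNet

namespace AutNet

open Enc

/-! ### Layered networks of monotone gates -/

namespace Layered

/-- If the first layer applies an involution to the registers, and in the other layers paired
registers both receive their maximum or minimum, then the network is built from monotone gates. -/
theorem isGateNetwork (D : Layered 2) (hT : 2 ≤ D.T) (op : ℕ → ℕ → Bool)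
    (hop : ∀ t < D.T, ∀ r < D.W, op t (D.τ t r) = op t r) (h0 : ∀ r x y, D.h 0 r x y = y)
    (h1 : ∀ t r x y, t ≠ 0 → D.h t r x y = if op t r then max x y else min x y) :
    IsGateNetwork monotoneGates ⟨_, D.maps.net⟩ := by
  have hp : ∀ v : Fin (D.T * D.W), prevLayer D.T (v / D.W) < D.T := fun v =>
    prevLayer_lt (D.layer_lt v)
  let ρ : Fin (D.T * D.W) → Fin (D.T * D.W) := fun v =>
    if prevLayer D.T (v / D.W) = 0 then D.sndNbr v else D.fstNbr v
  let κ : Fin (D.T * D.W) → Fin (D.T * D.W) := fun v =>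
    if prevLayer D.T (v / D.W) = 0 then v else
      D.node (v / D.W) (D.τ (prevLayer D.T (v / D.W)) (v % D.W)) (D.layer_lt v)
        (D.τ_lt _ (hp v) _ (D.reg_lt v))
  have hρd : ∀ v, (ρ v : ℕ) / D.W = prevLayer D.T (v / D.W) := by
    intro v
    simp only [ρ]
    split
    · rw [sndNbr, node_div]
    · rw [fstNbr, node_div]
  have hκd : ∀ v, (κ v : ℕ) / D.W = v / D.W := by
    intro v
    simp only [κ]
    split
    · rfl
    · rw [node_div]
  have hρκ : ∀ v, ρ (κ v) = if prevLayer D.T (v / D.W) = 0 then ρ v else D.sndNbr v := by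
    intro v
    by_cases h : prevLayer D.T (v / D.W) = 0
    · simp only [κ, if_pos h]
    · simp only [κ, if_neg h, ρ, node_div]
      simp [fstNbr, sndNbr]
  have hprev : ∀ v : Fin (D.T * D.W), prevLayer D.T (v / D.W) ≠ v / D.W := by
    intro v h
    have := D.layer_lt v
    unfold prevLayer at h
    split at h <;> omega
  have hinj : Function.Injective ρ := by
    intro v w h
    have h3 : (v : ℕ) / D.W = w / D.W := by
      have h4 := congrArg (fun u : Fin (D.T * D.W) => (u : ℕ) / D.W) h
      simp only [hρd] at h4
      rw [(prevLayer_eq_iff (D.layer_lt v) (hp v)).1 rfl, h4]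
      exact ((prevLayer_eq_iff (D.layer_lt w) (hp w)).1 rfl).symm
    refine D.node_ext h3 ?_
    have h4 := congrArg (fun u : Fin (D.T * D.W) => (u : ℕ) % D.W) h
    have h5 := hp w
    simp only [ρ, h3] at h4
    split at h4
    · rw [sndNbr, sndNbr, node_mod, node_mod, h3] at h4
      rw [← D.τ_τ _ h5 _ (D.reg_lt v), h4, D.τ_τ _ h5 _ (D.reg_lt w)]
    · rwa [fstNbr, fstNbr, node_mod, node_mod] at h4
  refine IsGateNetwork.of_pairing
    (Equiv.ofBijective ρ (Finite.injective_iff_bijective.1 hinj)) (κ := κ)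
    (op := fun v => if prevLayer D.T (v / D.W) = 0 then true else
      op (prevLayer D.T (v / D.W)) (v % D.W)) ?_ ?_ ?_ ?_ ?_
  · intro v
    refine D.node_ext (by rw [hκd, hκd]) ?_
    by_cases h : prevLayer D.T (v / D.W) = 0
    · simp only [κ, if_pos h]
    · simp only [κ, if_neg h, node_div, node_mod]
      exact D.τ_τ _ (hp v) _ (D.reg_lt v)
  · intro v
    simp only [hκd]
    by_cases h : prevLayer D.T (v / D.W) = 0
    · simp only [if_pos h]
    · simp only [if_neg h, κ, node_mod]
      exact hop _ (hp v) _ (D.reg_lt v)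
  · intro v h
    have := congrArg (fun u : Fin (D.T * D.W) => (u : ℕ) / D.W) h
    simp only [Equiv.ofBijective_apply, hρd] at this
    exact hprev v this
  · intro v h
    have := congrArg (fun u : Fin (D.T * D.W) => (u : ℕ) / D.W) h
    simp only [Equiv.ofBijective_apply, hρd, hκd] at this
    exact hprev v this
  · intro x v
    simp only [Equiv.ofBijective_apply, hρκ]
    apply Fin.ext
    rw [net_apply]
    by_cases h : prevLayer D.T (v / D.W) = 0
    · simp only [if_pos h, if_true, max_self, ρ]
      rw [h, h0]
    · simp only [if_neg h, ρ]
      rw [h1 _ _ _ _ h]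
      split
      · exact (Fin.coe_max _ _).symm
      · exact (Fin.coe_min _ _).symm

end Layered

/-! ### Finite codes -/

instance {k : ℕ} : Enc (Fin k) := ⟨Fin.val⟩

theorem enc_fin_injective {k : ℕ} : Function.Injective (enc : Fin k → ℕ) := Fin.val_injective

section

variable {α : Type} [Enc α]

instance L.finOfNat (k : ℕ) [NeZero k] (f : List Bool → α → ℕ) [hf : L f] :
    L fun w a => Fin.ofNat k (f w a) := by
  obtain ⟨g, hg, h⟩ : L fun w a => f w a % k := inferInstance
  exact ⟨g, hg, fun w a => h w a⟩

instance L.finVal (k : ℕ) (f : List Bool → α → Fin k) [hf : L f] :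
    L fun w a => (f w a).val := by
  obtain ⟨g, hg, h⟩ := hf
  exact ⟨g, hg, fun w a => h w a⟩

end

/-! ### The block of a node -/

namespace Reg

variable {q Δ : ℕ}

/-- The number of registers of a block. -/
noncomputable def count (q Δ : ℕ) : ℕ := Nat.card (Reg q Δ)

noncomputable def numbering : Reg q Δ ≃ Fin (count q Δ) := Finite.equivFin _

noncomputable instance : Enc (Reg q Δ) := ⟨fun ρ => (numbering ρ).val⟩

theorem enc_lt (ρ : Reg q Δ) : enc ρ < count q Δ := (numbering ρ).isLt

theorem count_pos : 0 < count q Δ := (Nat.zero_le _).trans_lt (enc_lt zero)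

instance : NeZero (count q Δ) := ⟨count_pos.ne'⟩

theorem enc_injective : Function.Injective (enc : Reg q Δ → ℕ) :=
  Fin.val_injective.comp numbering.injective

/-- The register with a given number. -/
noncomputable def ofNat (k : ℕ) : Reg q Δ :=
  numbering.symm (Fin.ofNat (count q Δ) k)

@[simp] theorem ofNat_enc (ρ : Reg q Δ) : ofNat (enc ρ) = ρ := by
  rw [ofNat, Equiv.symm_apply_eq]
  exact Fin.ext (Nat.mod_eq_of_lt (enc_lt ρ))

theorem enc_ofNat {k : ℕ} (h : k < count q Δ) : enc (ofNat k : Reg q Δ) = k := by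
  change (numbering (ofNat k : Reg q Δ)).val = k
  rw [ofNat, Equiv.apply_symm_apply]
  exact Nat.mod_eq_of_lt h

@[simp] theorem div_count (v : ℕ) (ρ : Reg q Δ) : (v * count q Δ + enc ρ) / count q Δ = v := by
  rw [Nat.add_comm, Nat.add_mul_div_right _ _ count_pos, Nat.div_eq_of_lt (enc_lt ρ), zero_add]

@[simp] theorem ofNat_mod_count (v : ℕ) (ρ : Reg q Δ) :
    ofNat ((v * count q Δ + enc ρ) % count q Δ) = ρ := by
  rw [Nat.add_comm, Nat.add_mul_mod_self_right, Nat.mod_eq_of_lt (enc_lt ρ), ofNat_enc]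

theorem exists_eq {n r : ℕ} (hr : r < n * count q Δ) :
    ∃ v < n, ∃ ρ : Reg q Δ, r = v * count q Δ + enc ρ := by
  refine ⟨r / count q Δ, Nat.div_lt_of_lt_mul (by rwa [mul_comm]), ofNat (r % count q Δ), ?_⟩
  rw [enc_ofNat (Nat.mod_lt _ count_pos), mul_comm, Nat.div_add_mod]

theorem add_enc_lt {n v : ℕ} (hv : v < n) (ρ : Reg q Δ) :
    v * count q Δ + enc ρ < n * count q Δ :=
  lt_of_lt_of_le (Nat.add_lt_add_left (enc_lt ρ) _)
    (by rw [← Nat.succ_mul]; exact Nat.mul_le_mul_right _ hv)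

instance L.ofNatOf {α : Type} [Enc α] (f : List Bool → α → ℕ) [hf : L f] :
    L fun w a => (ofNat (f w a) : Reg q Δ) :=
  L.apply_finite enc_fin_injective
    (fun k : Fin (count q Δ) => numbering.symm k) (L.finOfNat _ f)

variable [NeZero q]

def letter : Reg q Δ → Fin q
  | inp _ s => s
  | out _ s => s
  | _ => 0

def port : Reg q Δ → ℕ
  | inp b _ => b
  | out a _ => a
  | _ => 0

def kind : Reg q Δ → ℕ
  | inp _ _ => 1
  | out _ _ => 2
  | _ => 0

/-- The local function with a given table. -/
def ofTable (F : Fin (q ^ Δ) → Fin q) (y : Fin Δ → Fin q) : Fin q := F (finFunctionFinEquiv y)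

/-- The number of instructions of the program of a block. -/
noncomputable def steps (q Δ : ℕ) [NeZero q] : ℕ :=
  (prog (ofTable fun _ => 0) : List (Instr (Reg q Δ))).length

theorem length_prog_eq (f : (Fin Δ → Fin q) → Fin q) : (prog f).length = steps q Δ :=
  length_prog _ _

/-- The register paired with `ρ` by the instruction with number `t`. -/
noncomputable def partner (t : ℕ) (F : Fin (q ^ Δ) → Fin q) (ρ : Reg q Δ) : Reg q Δ :=
  match (prog (ofTable F))[t]? with
  | none => ρ
  | some i => Equiv.swap i.2.1 i.2.2 ρ

noncomputable def isOr (t : ℕ) (F : Fin (q ^ Δ) → Fin q) : Bool :=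
  match (prog (ofTable F))[t]? with
  | none => false
  | some i => i.1

theorem partner_partner (t : ℕ) (F : Fin (q ^ Δ) → Fin q) (ρ : Reg q Δ) :
    partner t F (partner t F ρ) = ρ := by
  unfold partner
  split <;> simp

theorem execAll_take_succ {t : ℕ} {F : Fin (q ^ Δ) → Fin q} (ht : t < steps q Δ)
    (σ : Reg q Δ → Bool) (ρ : Reg q Δ) :
    (execAll ((prog (ofTable F)).take (t + 1)) σ ρ).toNat =
      if isOr t F then
        max (execAll ((prog (ofTable F)).take t) σ ρ).toNat
          (execAll ((prog (ofTable F)).take t) σ (partner t F ρ)).toNat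
      else
        min (execAll ((prog (ofTable F)).take t) σ ρ).toNat
          (execAll ((prog (ofTable F)).take t) σ (partner t F ρ)).toNat := by
  have hor : ∀ x y : Bool, (x || y).toNat = max x.toNat y.toNat := by decide
  have hand : ∀ x y : Bool, (x && y).toNat = min x.toNat y.toNat := by decide
  have ht' : t < (prog (ofTable F)).length := by rwa [length_prog_eq]
  rw [List.take_succ_eq_append_getElem ht', execAll_append]
  generalize execAll ((prog (ofTable F)).take t) σ = σ'
  simp only [partner, isOr, List.getElem?_eq_getElem ht']
  obtain ⟨b, g, a⟩ := (prog (ofTable F))[t]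
  simp only [execAll_cons, execAll_nil, Instr.exec, Equiv.swap_apply_def]
  by_cases h1 : ρ = g
  · subst h1
    simp only [true_or, if_true]
    cases b <;> simp only [if_true, Bool.false_eq_true, if_false, hor, hand]
  · by_cases h2 : ρ = a
    · subst h2
      simp only [h1, if_false, false_or, if_true]
      cases b <;> simp only [if_true, Bool.false_eq_true, if_false, hor, hand, max_comm, min_comm]
    · simp [h1, h2]

end Reg

end AutNet

namespace AutNet

open Enc

/-! ### Ports -/

section

variable (n : ℕ) (deg : ℕ → ℕ) (nbr : ℕ → ℕ → ℕ)

/-- The number of out-neighbours of `u` smaller than `v`. -/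
noncomputable def outPort (u v : ℕ) : ℕ :=
  ∑ v' ∈ Finset.range v, if ∃ i, i < deg v' ∧ nbr v' i = u then 1 else 0

/-- The out-neighbour of `u` with a given number. -/
noncomputable def outNode (u a : ℕ) : ℕ :=
  bmin n fun v => (∃ i, i < deg v ∧ nbr v i = u) ∧ outPort deg nbr u v = a

/-- The number of the in-neighbour `u` of `v`. -/
noncomputable def inPort (u v : ℕ) : ℕ := bmin (deg v) fun i => nbr v i = u

variable (q Δ : ℕ) [NeZero q] [NeZero Δ]

/-- The number of the register that exchanges its content with the register `ρ` of the node `v`. -/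
noncomputable def exchange (v : ℕ) (ρ : Reg q Δ) : ℕ :=
  if ρ.kind = 1 ∧ ρ.port < deg v then
    nbr v ρ.port * Reg.count q Δ +
      enc (Reg.out (Fin.ofNat Δ (outPort deg nbr (nbr v ρ.port) v)) ρ.letter)
  else if ρ.kind = 2 ∧ outNode n deg nbr v ρ.port < n then
    outNode n deg nbr v ρ.port * Reg.count q Δ +
      enc (Reg.inp (Fin.ofNat Δ (inPort deg nbr v (outNode n deg nbr v ρ.port))) ρ.letter)
  else v * Reg.count q Δ + enc ρ

variable (tab : ℕ → Fin (q ^ Δ) → Fin q)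

/-- The involutions of the network that simulates a network of bounded degree. -/
noncomputable def boundedInvolution (t r : ℕ) : ℕ :=
  if t = 0 then exchange n deg nbr q Δ (r / Reg.count q Δ) (Reg.ofNat (r % Reg.count q Δ))
  else r / Reg.count q Δ * Reg.count q Δ +
    enc (Reg.partner (t - 1) (tab (r / Reg.count q Δ)) (Reg.ofNat (r % Reg.count q Δ)))

/-- The local maps of the network that simulates a network of bounded degree. -/
noncomputable def boundedLocal (t r x y : ℕ) : ℕ :=
  if t = 0 then y
  else if Reg.isOr (t - 1) (tab (r / Reg.count q Δ)) then max x y else min x y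

/-- The patterns of the embedding of a network of bounded degree. -/
noncomputable def boundedPat (r s : ℕ) : ℕ :=
  (Reg.rest (Fin.ofNat q s) (Reg.ofNat (r % Reg.count q Δ) : Reg q Δ)).toNat

end

/-- The transition table of a node, for functions that ignore additional arguments. -/
noncomputable def readTable (q Δ : ℕ) [NeZero q] (w : List Bool) (v : ℕ) (j : Fin (q ^ Δ)) : Fin q :=
  Fin.ofNat q (readLoc q Δ w v
    (if readDeg q Δ w v < Δ + 1 then j % q ^ readDeg q Δ w v else 0))

theorem exists_of_bmin_lt {n : ℕ} {p : ℕ → Prop} (h : bmin n p < n) : ∃ i < n, p i := by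
  by_contra! h'
  exact absurd (bmin_eq_self h') h.ne

/-- The graph given by `n`, `deg` and `nbr` has degree at most `Δ`. -/
structure BoundedGraph (Δ n : ℕ) (deg : ℕ → ℕ) (nbr : ℕ → ℕ → ℕ) : Prop where
  nbr_lt : ∀ v < n, ∀ i < deg v, nbr v i < n
  nbr_inj : ∀ v < n, ∀ i < deg v, ∀ j < deg v, nbr v i = nbr v j → i = j
  deg_le : ∀ v < n, deg v ≤ Δ
  out_le : ∀ u < n, outPort deg nbr u n ≤ Δ

section

variable {n : ℕ} {deg : ℕ → ℕ} {nbr : ℕ → ℕ → ℕ}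

theorem outPort_lt_of_lt {u v v' : ℕ} (h : ∃ i, i < deg v ∧ nbr v i = u) (hv : v < v') :
    outPort deg nbr u v < outPort deg nbr u v' := by
  have h1 : outPort deg nbr u (v + 1) ≤ outPort deg nbr u v' :=
    Finset.sum_le_sum_of_subset (Finset.range_mono hv)
  refine lt_of_lt_of_le ?_ h1
  rw [outPort, outPort, Finset.sum_range_succ, if_pos h]
  omega

theorem outNode_outPort {u v : ℕ} (h : ∃ i, i < deg v ∧ nbr v i = u) (hv : v < n) :
    outNode n deg nbr u (outPort deg nbr u v) = v := by
  refine bmin_eq hv.le (fun v' hv' h' => ?_) (.inr ⟨h, rfl⟩)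
  exact (outPort_lt_of_lt h'.1 hv').ne h'.2

theorem BoundedGraph.outPort_lt {Δ : ℕ} (G : BoundedGraph Δ n deg nbr) {v b : ℕ} (hv : v < n) (hb : b < deg v) :
    outPort deg nbr (nbr v b) v < Δ :=
  (outPort_lt_of_lt ⟨b, hb, rfl⟩ hv).trans_le (G.out_le _ (G.nbr_lt v hv b hb))

theorem BoundedGraph.inPort_nbr {Δ : ℕ} (G : BoundedGraph Δ n deg nbr) {v b : ℕ} (hv : v < n) (hb : b < deg v) :
    inPort deg nbr (nbr v b) v = b :=
  bmin_eq hb.le (fun j hj h => hj.ne (G.nbr_inj v hv j (hj.trans hb) b hb h)) (.inr rfl)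

variable {q Δ : ℕ} [NeZero q] [NeZero Δ]

namespace BoundedGraph

theorem outNode_spec {u a : ℕ} (h : outNode n deg nbr u a < n) :
    inPort deg nbr u (outNode n deg nbr u a) < deg (outNode n deg nbr u a) ∧
      nbr (outNode n deg nbr u a) (inPort deg nbr u (outNode n deg nbr u a)) = u ∧
      outPort deg nbr u (outNode n deg nbr u a) = a := by
  obtain ⟨-, h1, -⟩ := bmin_spec (exists_of_bmin_lt h)
  have h2 := bmin_spec h1.1
  exact ⟨h2.1, h2.2.1, h1.2⟩

theorem exchange_inp {v : ℕ} {b : Fin Δ} {s : Fin q} (hb : b < deg v) :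
    exchange n deg nbr q Δ v (.inp b s) = nbr v b * Reg.count q Δ +
      enc (Reg.out (Fin.ofNat Δ (outPort deg nbr (nbr v b) v)) s) :=
  if_pos ⟨rfl, hb⟩

theorem exchange_out {u : ℕ} {a : Fin Δ} {s : Fin q} (h : outNode n deg nbr u a < n) :
    exchange n deg nbr q Δ u (.out a s) = outNode n deg nbr u a * Reg.count q Δ +
      enc (Reg.inp (Fin.ofNat Δ (inPort deg nbr u (outNode n deg nbr u a))) s) := by
  rw [exchange, if_neg (by rintro ⟨h, -⟩; cases h), if_pos ⟨rfl, h⟩]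
  rfl

theorem exchange_self {v : ℕ} {ρ : Reg q Δ} (h1 : ¬ (ρ.kind = 1 ∧ ρ.port < deg v))
    (h2 : ¬ (ρ.kind = 2 ∧ outNode n deg nbr v ρ.port < n)) :
    exchange n deg nbr q Δ v ρ = v * Reg.count q Δ + enc ρ := by
  rw [exchange, if_neg h1, if_neg h2]

theorem exchange_exchange (G : BoundedGraph Δ n deg nbr) (v : ℕ) (hv : v < n) (ρ : Reg q Δ) :
    ∃ u < n, ∃ ρ' : Reg q Δ, exchange n deg nbr q Δ v ρ = u * Reg.count q Δ + enc ρ' ∧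
      exchange n deg nbr q Δ u ρ' = v * Reg.count q Δ + enc ρ := by
  by_cases h1 : ρ.kind = 1 ∧ ρ.port < deg v
  · obtain ⟨hk, hb⟩ := h1
    rcases ρ with _ | _ | _ | _ | s | ⟨b, s⟩ | ⟨a, s⟩ <;> try cases hk
    refine ⟨_, G.nbr_lt v hv b hb, _, exchange_inp hb, ?_⟩
    have h3 := G.outPort_lt hv hb
    have h4 : ((Fin.ofNat Δ (outPort deg nbr (nbr v b) v) : Fin Δ) : ℕ) =
        outPort deg nbr (nbr v b) v := Nat.mod_eq_of_lt h3
    have h5 : outNode n deg nbr (nbr v b) (outPort deg nbr (nbr v b) v) = v :=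
      outNode_outPort ⟨b, hb, rfl⟩ hv
    rw [exchange_out (by rw [h4]; exact h5.trans_lt hv), h4, h5]
    have h6 : inPort deg nbr (nbr v b) v = b := G.inPort_nbr hv hb
    rw [h6, Fin.ofNat_val_eq_self]
  · by_cases h2 : ρ.kind = 2 ∧ outNode n deg nbr v ρ.port < n
    · obtain ⟨hk, ha⟩ := h2
      rcases ρ with _ | _ | _ | _ | s | ⟨b, s⟩ | ⟨a, s⟩ <;> try cases hk
      change outNode n deg nbr v a < n at ha
      obtain ⟨h3, h4, h5⟩ := outNode_spec ha
      refine ⟨_, ha, _, exchange_out ha, ?_⟩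
      have h6 : ((Fin.ofNat Δ (inPort deg nbr v (outNode n deg nbr v a)) : Fin Δ) : ℕ) =
          inPort deg nbr v (outNode n deg nbr v a) :=
        Nat.mod_eq_of_lt (h3.trans_le (G.deg_le _ ha))
      have h4' : nbr (outNode n deg nbr v a) (inPort deg nbr v (outNode n deg nbr v a)) = v := h4
      have h5' : outPort deg nbr v (outNode n deg nbr v a) = a := h5
      rw [exchange_inp (by rw [h6]; exact h3), h6, h4', h5', Fin.ofNat_val_eq_self]
    · exact ⟨v, hv, ρ, exchange_self h1 h2, exchange_self h1 h2⟩

variable (tab : ℕ → Fin (q ^ Δ) → Fin q)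

theorem boundedInvolution_zero (v : ℕ) (ρ : Reg q Δ) :
    boundedInvolution n deg nbr q Δ tab 0 (v * Reg.count q Δ + enc ρ) =
      exchange n deg nbr q Δ v ρ := by
  rw [boundedInvolution, if_pos rfl, Reg.div_count, Reg.ofNat_mod_count]

theorem boundedInvolution_succ (t v : ℕ) (ρ : Reg q Δ) :
    boundedInvolution n deg nbr q Δ tab (t + 1) (v * Reg.count q Δ + enc ρ) =
      v * Reg.count q Δ + enc (Reg.partner t (tab v) ρ) := by
  rw [boundedInvolution, if_neg t.succ_ne_zero, Reg.div_count, Reg.ofNat_mod_count,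
    Nat.add_sub_cancel]

/-- The network that simulates a network of bounded degree. -/
noncomputable def layered (G : BoundedGraph Δ n deg nbr) : Layered 2 where
  T := Reg.steps q Δ + 1
  W := n * Reg.count q Δ
  τ := boundedInvolution n deg nbr q Δ tab
  h := boundedLocal q Δ tab
  T_pos := Nat.succ_pos _
  τ_lt t _ r hr := by
    obtain ⟨v, hv, ρ, rfl⟩ := Reg.exists_eq hr
    cases t with
    | zero =>
      obtain ⟨u, hu, ρ', h, -⟩ := G.exchange_exchange v hv ρ
      rw [boundedInvolution_zero, h]
      exact Reg.add_enc_lt hu _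
    | succ t => rw [boundedInvolution_succ]; exact Reg.add_enc_lt hv _
  τ_τ t _ r hr := by
    obtain ⟨v, hv, ρ, rfl⟩ := Reg.exists_eq hr
    cases t with
    | zero =>
      obtain ⟨u, hu, ρ', h, h'⟩ := G.exchange_exchange v hv ρ
      rw [boundedInvolution_zero, h, boundedInvolution_zero, h']
    | succ t => rw [boundedInvolution_succ, boundedInvolution_succ, Reg.partner_partner]
  h_lt t _ r _ x hx y hy := by unfold boundedLocal; split_ifs <;> omega
  h_zero t _ r _ := by unfold boundedLocal; split_ifs <;> rfl

theorem isGateNetwork (G : BoundedGraph Δ n deg nbr) : IsGateNetwork monotoneGates ⟨_, (G.layered tab).maps.net⟩ := by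
  refine Layered.isGateNetwork _ ?_
    (fun t r => decide (t = 0) || Reg.isOr (t - 1) (tab (r / Reg.count q Δ))) ?_ ?_ ?_
  · have : 0 < Reg.steps q Δ := by
      rw [← Reg.length_prog_eq (fun _ => 0), Reg.prog]
      simp only [List.length_append, List.length_map, Finset.length_toList, Finset.card_univ,
        Fintype.card_fin]
      have := NeZero.pos q
      omega
    exact Nat.succ_le_succ this
  · intro t _ r hr
    obtain ⟨v, hv, ρ, rfl⟩ := Reg.exists_eq hr
    cases t with
    | zero => rfl
    | succ t =>
      change (_ || Reg.isOr _ (tab (boundedInvolution n deg nbr q Δ tab (t + 1) _ / _))) = _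
      rw [boundedInvolution_succ, Reg.div_count, Reg.div_count]
  · intro r x y
    change boundedLocal q Δ tab 0 r x y = y
    exact if_pos rfl
  · intro t r x y ht
    change boundedLocal q Δ tab t r x y = _
    simp [boundedLocal, ht]

/-- The inputs that the block of `v` receives. -/
def inputs (deg : ℕ → ℕ) (nbr : ℕ → ℕ → ℕ) (x : ℕ → Fin q) (v : ℕ) (b : Fin Δ) : Fin q :=
  if b < deg v then x (nbr v b) else 0

theorem state_eq (G : BoundedGraph Δ n deg nbr) {x : ℕ → Fin q} {z : ℕ → ℕ}
    (hz : ∀ v < n, ∀ ρ : Reg q Δ, z (v * Reg.count q Δ + enc ρ) = (Reg.rest (x v) ρ).toNat)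
    {v : ℕ} (hv : v < n) (ρ : Reg q Δ) :
    (G.layered tab).state z (Reg.steps q Δ + 1) (v * Reg.count q Δ + enc ρ) =
      (Reg.rest (Reg.ofTable (tab v) (inputs deg nbr x v)) ρ).toNat := by
  have h0 : ∀ ρ : Reg q Δ, (G.layered tab).state z 1 (v * Reg.count q Δ + enc ρ) =
      z (exchange n deg nbr q Δ v ρ) := by
    intro ρ
    have : (G.layered tab).state z 1 (v * Reg.count q Δ + enc ρ) =
      z (boundedInvolution n deg nbr q Δ tab 0 (v * Reg.count q Δ + enc ρ)) := rfl
    rw [this, boundedInvolution_zero]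
  let σ : Reg q Δ → Bool := fun ρ => decide (z (exchange n deg nbr q Δ v ρ) = 1)
  have hσ : ∀ ρ, (G.layered tab).state z 1 (v * Reg.count q Δ + enc ρ) = (σ ρ).toNat := by
    intro ρ
    obtain ⟨u, hu, ρ', h, -⟩ := G.exchange_exchange v hv ρ
    simp only [h0, σ, h, hz u hu]
    cases (Reg.rest (x u) ρ') <;> rfl
  have hstep : ∀ t ≤ Reg.steps q Δ, ∀ ρ,
      (G.layered tab).state z (t + 1) (v * Reg.count q Δ + enc ρ) =
        (execAll ((Reg.prog (Reg.ofTable (tab v))).take t) σ ρ).toNat := by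
    intro t
    induction t with
    | zero => exact fun _ ρ => hσ ρ
    | succ t ih =>
      intro ht ρ
      have h1 : (G.layered tab).state z (t + 1 + 1) (v * Reg.count q Δ + enc ρ) =
        boundedLocal q Δ tab (t + 1) (v * Reg.count q Δ + enc ρ)
          ((G.layered tab).state z (t + 1) (v * Reg.count q Δ + enc ρ))
          ((G.layered tab).state z (t + 1)
            (boundedInvolution n deg nbr q Δ tab (t + 1) (v * Reg.count q Δ + enc ρ))) := rfl
      rw [h1, boundedInvolution_succ, ih (by omega), ih (by omega), Reg.execAll_take_succ ht,
        boundedLocal, if_neg t.succ_ne_zero, Reg.div_count, Nat.add_sub_cancel]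
  have hself : ∀ ρ : Reg q Δ, ρ.kind = 0 → σ ρ = Reg.rest (x v) ρ := by
    intro ρ hk
    simp only [σ]
    rw [exchange_self (by omega) (by omega), hz v hv]
    cases (Reg.rest (x v) ρ) <;> rfl
  have hin : ∀ i s, σ (.inp i s) = decide (s = inputs deg nbr x v i) := by
    intro i s
    simp only [σ, inputs]
    split
    · next h =>
      rw [exchange_inp h, hz _ (G.nbr_lt v hv i h)]
      simp [Reg.rest]
    · next h =>
      rw [exchange_self (fun h' => h h'.2) (by rintro ⟨h, -⟩; cases h), hz v hv]
      simp [Reg.rest]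
  rw [hstep _ le_rfl, List.take_of_length_le (Reg.length_prog_eq _).le,
    Reg.execAll_prog _ (inputs deg nbr x v) σ (hself _ rfl) (hself _ rfl) (hself _ rfl)
      (hself _ rfl) (fun s => hself _ rfl) hin]

/-- The embedding into the network that simulates a network of bounded degree. -/
noncomputable def embedding (G : BoundedGraph Δ n deg nbr) : (G.layered tab).Embedding q n where
  blk r := r / Reg.count q Δ
  pat := boundedPat q Δ
  pos := two_pos
  blk_lt r hr := Nat.div_lt_of_lt_mul (lt_of_lt_of_eq hr (mul_comm _ _))
  pat_lt r _ s _ := Bool.toNat_lt _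
  surj i hi := ⟨_, Reg.add_enc_lt hi .zero, Reg.div_count _ _⟩
  inj i hi s hs s' hs' h := by
    have h1 := h _ (Reg.add_enc_lt hi (.out 0 (Fin.ofNat q s))) (Reg.div_count _ _)
    simp only [boundedPat, Reg.ofNat_mod_count, Reg.rest, decide_true, Bool.toNat_true] at h1
    have h2 : Fin.ofNat q s = Fin.ofNat q s' := by
      by_contra h3
      rw [decide_eq_false h3] at h1
      cases h1
    have h3 := congrArg Fin.val h2
    simp only [Fin.val_ofNat, Nat.mod_eq_of_lt hs, Nat.mod_eq_of_lt hs'] at h3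
    exact h3

theorem simulates (G : BoundedGraph Δ n deg nbr) {F : NetMap q n}
    (hF : ∀ (x : Fin n → Fin q) (y : ℕ → Fin q), (∀ v : Fin n, y v = x v) → ∀ v : Fin n,
      Reg.ofTable (tab v) (inputs deg nbr y v) = F x v) (x : Fin n → Fin q) :
    (G.embedding tab).toBlock.map (F x) =
      (G.layered tab).maps.net^[Reg.steps q Δ + 1] ((G.embedding tab).toBlock.map x) := by
  refine (G.embedding tab).simulates x fun z hz r hr => ?_
  let y : ℕ → Fin q := fun v => if h : v < n then x ⟨v, h⟩ else 0
  have hy : ∀ v : Fin n, y v = x v := fun v => by simp [y]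
  have hpat : ∀ (X : Fin n → Fin q) v (ρ : Reg q Δ) (hv : v < n) (h : _ < n),
      (G.embedding tab).pat (v * Reg.count q Δ + enc ρ)
        (X ⟨(G.embedding tab).blk (v * Reg.count q Δ + enc ρ), h⟩) =
      (Reg.rest (X ⟨v, hv⟩) ρ).toNat := by
    intro X v ρ hv h
    have : (⟨(G.embedding tab).blk (v * Reg.count q Δ + enc ρ), h⟩ : Fin n) = ⟨v, hv⟩ :=
      Fin.ext (Reg.div_count _ _)
    rw [this]
    change boundedPat q Δ _ _ = _
    rw [boundedPat, Reg.ofNat_mod_count, Fin.ofNat_val_eq_self]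
  obtain ⟨v, hv, ρ, rfl⟩ := Reg.exists_eq hr
  rw [hpat _ v ρ hv]
  have hz' : ∀ v < n, ∀ ρ : Reg q Δ,
      z (v * Reg.count q Δ + enc ρ) = (Reg.rest (y v) ρ).toNat := by
    intro v hv ρ
    rw [hz _ (Reg.add_enc_lt hv ρ), hpat _ v ρ hv, ← hy ⟨v, hv⟩]
  exact (G.state_eq tab hz' hv ρ).trans (by rw [hF x y hy ⟨v, hv⟩])

end BoundedGraph

end

end AutNet

namespace AutNet

open Enc

/-! ### Strong universality of the monotone gates -/

section

variable {α : Type} [Enc α] (q Δ : ℕ)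

instance L.regFun {β : Type} [Enc β] (f : Reg q Δ → β) (ρ : List Bool → α → Reg q Δ) [hρ : L ρ] :
    L fun w a => f (ρ w a) := L.apply_finite Reg.enc_injective f hρ

/-- A function of an instruction number and finite data that is constant in the number from some
point on. -/
theorem L.regStep {β : Type} [Enc β] (N : ℕ) (f : ℕ → (Fin (q ^ Δ) → Fin q) → Reg q Δ → β)
    (hf : ∀ t F ρ, f t F ρ = f (min t N) F ρ) (t : List Bool → α → ℕ)
    (F : List Bool → α → Fin (q ^ Δ) → Fin q) (ρ : List Bool → α → Reg q Δ) [ht : L t] [hF : L F]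
    [hρ : L ρ] : L fun w a => f (t w a) (F w a) (ρ w a) := by
  have h := L.apply_finite
    (enc_prod_injective enc_fin_injective
      (enc_prod_injective (enc_vec_injective enc_fin_injective) Reg.enc_injective))
    (fun p : Fin (N + 1) × (Fin (q ^ Δ) → Fin q) × Reg q Δ => f p.1 p.2.1 p.2.2)
    (g := fun w a => (Fin.ofNat (N + 1) (min (t w a) N), (F w a, ρ w a))) inferInstance
  convert h using 3 with w a
  rw [hf, Fin.val_ofNat, Nat.mod_eq_of_lt (Nat.lt_succ_of_le (min_le_right _ _))]

variable [NeZero q]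

theorem L.boundedPat : L fun _ (p : ℕ × ℕ) => boundedPat q Δ p.1 p.2 :=
  L.apply_finite (enc_prod_injective enc_fin_injective Reg.enc_injective)
    (fun p : Fin q × Reg q Δ => (Reg.rest p.1 p.2).toNat)
    (g := fun _ (p : ℕ × ℕ) => (Fin.ofNat q p.2, Reg.ofNat (p.1 % Reg.count q Δ))) inferInstance

instance L.readTableOf (v : List Bool → α → ℕ) [hv : L v] :
    L fun w a => readTable q Δ w (v w a) := by
  refine L.vec fun j => ?_
  have h1 : L fun w a =>
      if readDeg q Δ w (v w a) < Δ + 1 then (j : ℕ) % q ^ readDeg q Δ w (v w a) else 0 :=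
    (L.table (fun d => (j : ℕ) % q ^ d) (Δ + 1)).comp (g := fun w a => readDeg q Δ w (v w a))
      inferInstance
  unfold readTable
  infer_instance

instance L.outPortOf (u v : List Bool → α → ℕ) [hu : L u] [hv : L v] :
    L fun w a => outPort (readDeg q Δ w) (readNbr q Δ w) (u w a) (v w a) := by
  have h1 : L fun w (p : α × ℕ) => u w p.1 := hu.comp inferInstance
  have h2 : L fun w (p : (α × ℕ) × ℕ) => u w p.1.1 := hu.comp inferInstance
  unfold outPort
  infer_instance

instance L.outNodeOf (u a : List Bool → α → ℕ) [hu : L u] [ha : L a] :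
    L fun w x => outNode (readN w) (readDeg q Δ w) (readNbr q Δ w) (u w x) (a w x) := by
  have h1 : L fun w (p : α × ℕ) => u w p.1 := hu.comp inferInstance
  have h2 : L fun w (p : α × ℕ) => a w p.1 := ha.comp inferInstance
  have h3 : L fun w (p : (α × ℕ) × ℕ) => u w p.1.1 := hu.comp inferInstance
  unfold outNode
  infer_instance

instance L.inPortOf (u v : List Bool → α → ℕ) [hu : L u] [hv : L v] :
    L fun w a => inPort (readDeg q Δ w) (readNbr q Δ w) (u w a) (v w a) := by
  have h1 : L fun w (p : α × ℕ) => u w p.1 := hu.comp inferInstance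
  have h2 : L fun w (p : α × ℕ) => v w p.1 := hv.comp inferInstance
  unfold inPort
  infer_instance

theorem L.boundedLocal : L fun w (p : (ℕ × ℕ) × (ℕ × ℕ)) =>
    boundedLocal q Δ (readTable q Δ w) p.1.1 p.1.2 p.2.1 p.2.2 := by
  have h1 := L.regStep q Δ (Reg.steps q Δ) (fun t F _ => (Reg.isOr t F : Bool).toNat)
    (fun t F ρ => by
      rcases le_total t (Reg.steps q Δ) with h | h
      · rw [min_eq_left h]
      · simp only [Reg.isOr, List.getElem?_eq_none ((Reg.length_prog_eq _).trans_le h),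
          min_eq_right h, List.getElem?_eq_none (Reg.length_prog_eq (Reg.ofTable F)).le])
    (fun w (p : (ℕ × ℕ) × (ℕ × ℕ)) => p.1.1 - 1)
    (fun w p => readTable q Δ w (p.1.2 / Reg.count q Δ)) (fun w p => Reg.zero)
  have h2 : L fun w (p : (ℕ × ℕ) × (ℕ × ℕ)) => if p.1.1 = 0 then p.2.2 else
      if (Reg.isOr (p.1.1 - 1) (readTable q Δ w (p.1.2 / Reg.count q Δ))).toNat = 1 then
        max p.2.1 p.2.2 else min p.2.1 p.2.2 := inferInstance
  simpa only [AutNet.boundedLocal, Bool.toNat_eq_one] using h2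

variable [NeZero Δ]

theorem L.regPort {β : Type} [Enc β] (f : Fin Δ → Fin q → β) (a : List Bool → α → ℕ)
    (ρ : List Bool → α → Reg q Δ) [ha : L a] [hρ : L ρ] :
    L fun w x => f (Fin.ofNat Δ (a w x)) (ρ w x).letter :=
  L.apply_finite (enc_prod_injective enc_fin_injective Reg.enc_injective)
    (fun p : Fin Δ × Reg q Δ => f p.1 p.2.letter)
    (g := fun w x => (Fin.ofNat Δ (a w x), ρ w x)) inferInstance

instance L.exchangeOf (v : List Bool → α → ℕ) (ρ : List Bool → α → Reg q Δ) [hv : L v] [hρ : L ρ] :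
    L fun w a => exchange (readN w) (readDeg q Δ w) (readNbr q Δ w) q Δ (v w a) (ρ w a) := by
  have h1 := L.regPort q Δ (fun a s => enc (Reg.out a s : Reg q Δ))
    (fun w a => outPort (readDeg q Δ w) (readNbr q Δ w)
      (readNbr q Δ w (v w a) (ρ w a).port) (v w a)) ρ
  have h2 := L.regPort q Δ (fun a s => enc (Reg.inp a s : Reg q Δ))
    (fun w a => inPort (readDeg q Δ w) (readNbr q Δ w) (v w a)
      (outNode (readN w) (readDeg q Δ w) (readNbr q Δ w) (v w a) (ρ w a).port)) ρ
  unfold exchange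
  infer_instance

theorem L.boundedInvolution : L fun w (p : ℕ × ℕ) =>
    boundedInvolution (readN w) (readDeg q Δ w) (readNbr q Δ w) q Δ (readTable q Δ w) p.1 p.2 := by
  have h1 := L.regStep q Δ (Reg.steps q Δ) (fun t F ρ => enc (Reg.partner t F ρ))
    (fun t F ρ => by
      rcases le_total t (Reg.steps q Δ) with h | h
      · rw [min_eq_left h]
      · simp only [Reg.partner, List.getElem?_eq_none ((Reg.length_prog_eq _).trans_le h),
          min_eq_right h, List.getElem?_eq_none (Reg.length_prog_eq (Reg.ofTable F)).le])
    (fun w (p : ℕ × ℕ) => p.1 - 1) (fun w p => readTable q Δ w (p.2 / Reg.count q Δ))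
    (fun w p => Reg.ofNat (p.2 % Reg.count q Δ))
  unfold AutNet.boundedInvolution
  infer_instance

end

namespace LocalMaps

variable {q Δ n : ℕ} (R : LocalMaps q n)

theorem length_nbr_le (hR : DegreeAtMost Δ R.Edge) (v : Fin n) : (R.nbr v).length ≤ Δ := by
  classical
  have h1 : {u | R.Edge u v} = ((R.nbr v).toFinset : Set (Fin n)) := by
    ext u; simp [Edge]
  have h2 := hR v
  rw [h1, Set.ncard_coe_finset, List.toFinset_card_of_nodup (R.nodup v)] at h2
  omega

theorem boundedGraph (hR : DegreeAtMost Δ R.Edge) :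
    BoundedGraph Δ n (readDeg q Δ R.encode) (readNbr q Δ R.encode) where
  nbr_lt v hv i hi := by
    have h := R.readDeg_encode (R.length_nbr_le hR) ⟨v, hv⟩
    simp only at h
    rw [h] at hi
    exact lt_of_eq_of_lt (R.readNbr_encode (R.length_nbr_le hR) ⟨v, hv⟩ i hi) (Fin.isLt _)
  nbr_inj v hv i hi j hj h := by
    have h1 := R.readDeg_encode (R.length_nbr_le hR) ⟨v, hv⟩
    simp only at h1
    rw [h1] at hi hj
    have h2 := R.readNbr_encode (R.length_nbr_le hR) ⟨v, hv⟩ i hi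
    have h3 := R.readNbr_encode (R.length_nbr_le hR) ⟨v, hv⟩ j hj
    simp only at h2 h3
    rw [h2, h3] at h
    exact (R.nodup ⟨v, hv⟩).getElem_inj_iff.1 (Fin.ext h)
  deg_le v hv := (R.readDeg_encode (R.length_nbr_le hR) ⟨v, hv⟩).trans_le (R.length_nbr_le hR _)
  out_le u hu := by
    classical
    rw [outPort, Finset.sum_range, Finset.sum_boole, Nat.cast_id]
    refine le_trans ?_ (le_trans (Nat.le_add_left _ _) (hR ⟨u, hu⟩))
    rw [← Set.ncard_coe_finset]
    refine Set.ncard_le_ncard ?_ (Set.toFinite _)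
    intro v hv
    simp only [Finset.coe_filter, Finset.mem_univ, true_and, Set.mem_ofPred_eq] at hv
    obtain ⟨i, hi, h⟩ := hv
    rw [R.readDeg_encode (R.length_nbr_le hR)] at hi
    rw [R.readNbr_encode (R.length_nbr_le hR) v i hi] at h
    have : (R.nbr v)[i] = ⟨u, hu⟩ := Fin.ext h
    change _ ∈ R.nbr v
    rw [← this]
    exact List.getElem_mem hi

theorem ofTable_encode [NeZero q] (hR : DegreeAtMost Δ R.Edge) (x : Fin n → Fin q) (y : ℕ → Fin q)
    (hy : ∀ v : Fin n, y v = x v) (v : Fin n) :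
    Reg.ofTable (readTable q Δ R.encode v) (BoundedGraph.inputs (readDeg q Δ R.encode)
      (readNbr q Δ R.encode) y v) = R.net x v := by
  have hd := R.readDeg_encode (R.length_nbr_le hR) v
  have hle := R.length_nbr_le hR v
  rw [Reg.ofTable, readTable, hd, if_pos (by omega)]
  set Y := finFunctionFinEquiv (BoundedGraph.inputs (Δ := Δ) (readDeg q Δ R.encode)
      (readNbr q Δ R.encode) y v) with hY
  let Z : Fin (q ^ (R.nbr v).length) := ⟨Y % q ^ (R.nbr v).length,
    Nat.mod_lt _ (Nat.pow_pos (NeZero.pos q))⟩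
  have h1 := R.readLoc_encode (R.length_nbr_le hR) v Z
  simp only [Z] at h1
  rw [h1, Fin.ofNat_val_eq_self, net]
  congr 1
  funext i
  apply Fin.ext
  rw [finFunctionFinEquiv_symm_apply_val]
  have h2 : q ^ (R.nbr v).length = q ^ (i : ℕ) * q ^ ((R.nbr v).length - i) := by
    rw [← pow_add]; congr 1; omega
  have h3 : q ∣ q ^ ((R.nbr v).length - i) := dvd_pow_self _ (by omega)
  change (Y : ℕ) % q ^ (R.nbr v).length / q ^ (i : ℕ) % q = _
  rw [h2, Nat.mod_mul_right_div_self, Nat.mod_mod_of_dvd _ h3]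
  have h4 : (Y : ℕ) / q ^ (i : ℕ) % q = (finFunctionFinEquiv.symm Y ⟨i, by omega⟩ : Fin q) :=
    (finFunctionFinEquiv_symm_apply_val Y ⟨i, by omega⟩).symm
  rw [h4, hY, Equiv.symm_apply_apply, BoundedGraph.inputs, hd, if_pos i.isLt,
    R.readNbr_encode (R.length_nbr_le hR) v i i.isLt, hy]
  rfl

end LocalMaps

theorem stronglyUniversal_monotoneFamily : StronglyUniversal monotoneFamily := by
  intro q hq Δ hΔ
  have : NeZero q := ⟨by omega⟩
  have : NeZero Δ := ⟨by omega⟩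
  refine ⟨Reg.steps q Δ + 1, (Reg.steps q Δ + 1) * Reg.count q Δ, fun w =>
    encWord (layeredWord 2 (Reg.steps q Δ + 1) (readN w * Reg.count q Δ)
      (boundedInvolution (readN w) (readDeg q Δ w) (readNbr q Δ w) q Δ (readTable q Δ w))
      (boundedLocal q Δ (readTable q Δ w))) ++ encNat (Reg.steps q Δ + 1) ++
    Layered.Embedding.word (readN w) q (Reg.steps q Δ + 1) (readN w * Reg.count q Δ)
      (fun r => r / Reg.count q Δ) (boundedPat q Δ), ?_, ?_⟩
  · have h0 : L fun w (_ : ℕ) => readN w * Reg.count q Δ := inferInstance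
    have h1 := LO.layeredWord 2 (L.const (Reg.steps q Δ + 1)) h0 (L.boundedInvolution q Δ) (L.boundedLocal q Δ)
    have h2 := LO.embeddingWord q (L.readNOf (α := ℕ)) (L.const (Reg.steps q Δ + 1)) h0
      (blk := fun _ r => r / Reg.count q Δ) inferInstance (L.boundedPat q Δ)
    apply LO.logspaceComputable
    infer_instance
  · rintro w ⟨n, F⟩ ⟨(R : LocalMaps q n), rfl, hF, hR⟩ -
    change R.net = F at hF
    subst hF
    let G := R.boundedGraph hR
    let D := G.layered (readTable q Δ R.encode)
    have hn := R.readN_encode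
    refine ⟨D.maps.encode, ⟨_, D.maps.net⟩, (G.embedding _).toBlock, ?_,
      ⟨G.isGateNetwork _, D.maps, rfl, rfl, D.degreeAtMost⟩, ?_, ?_⟩
    · rw [Layered.maps_encode, Layered.Embedding.toBlock_encode]
      beta_reduce
      rw [hn]
      rfl
    · change (Reg.steps q Δ + 1) * (n * Reg.count q Δ) = _
      ring
    · exact G.simulates _ fun x y hy v => R.ofTable_encode hR x y hy v

end AutNet

namespace AutNet

open Enc

/-! ### Values of the vertices of a circuit -/

namespace Circuit

variable (C : Circuit) (x : List Bool)

theorem foldl_values (l : List Gate) (x : List Bool) :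
    (l.foldl (fun vals g => vals ++ [g.eval vals]) x).length = x.length + l.length ∧
      ∀ v < x.length, (l.foldl (fun vals g => vals ++ [g.eval vals]) x)[v]? = x[v]? := by
  induction l generalizing x with
  | nil => simp
  | cons g l ih =>
    obtain ⟨h1, h2⟩ := ih (x ++ [g.eval x])
    rw [List.length_append, List.length_singleton] at h1 h2
    refine ⟨by rw [List.foldl_cons, h1, List.length_cons]; ring, fun v hv => ?_⟩
    rw [List.foldl_cons, h2 v (by omega), List.getElem?_append_left hv]

/-- The value of a vertex. -/
def val (v : ℕ) : Bool := (C.values x).getD v false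

theorem val_input {v : ℕ} (hx : x.length = C.inputs) (hv : v < C.inputs) :
    C.val x v = x.getD v false := by
  rw [val, values, List.getD_eq_getElem?_getD, (foldl_values _ _).2 v (by omega),
    List.getD_eq_getElem?_getD]

theorem eval_congr {g : Gate} {m : ℕ} (hg : g.Below m) {l l' : List Bool}
    (h : ∀ v < m, l[v]? = l'[v]?) : g.eval l = g.eval l' := by
  cases g <;> simp only [Gate.Below] at hg <;>
    simp only [Gate.eval, List.getD_eq_getElem?_getD]
  · rw [h _ hg]
  · rw [h _ hg.1, h _ hg.2]
  · rw [h _ hg.1, h _ hg.2]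

theorem val_gate {t : ℕ} (hx : x.length = C.inputs) (ht : t < C.gates.length) :
    C.val x (C.inputs + t) = C.gates[t].eval (C.values x) := by
  have e : C.values x = (C.gates.drop (t + 1)).foldl (fun vals g => vals ++ [g.eval vals])
      ((C.gates.take t).foldl (fun vals g => vals ++ [g.eval vals]) x ++
        [C.gates[t].eval ((C.gates.take t).foldl (fun vals g => vals ++ [g.eval vals]) x)]) := by
    rw [values]
    conv_lhs => rw [← List.take_append_drop t C.gates, List.drop_eq_getElem_cons ht]
    rw [List.foldl_append, List.foldl_cons]
  set y := (C.gates.take t).foldl (fun vals g => vals ++ [g.eval vals]) x with hy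
  have hl : y.length = C.inputs + t := by
    rw [hy, (foldl_values _ _).1, List.length_take, hx, min_eq_left ht.le]
  have h1 : ∀ v < C.inputs + t, (C.values x)[v]? = y[v]? := by
    intro v hv
    rw [e, (foldl_values _ _).2 v (by rw [List.length_append, hl]; omega),
      List.getElem?_append_left (by omega)]
  rw [eval_congr (C.gates_below t ht) h1, val, e, List.getD_eq_getElem?_getD,
    (foldl_values _ _).2 _ (by rw [List.length_append, hl, List.length_singleton]; omega), ← hl]
  simp

theorem eval_eq : C.eval x = C.outputs.map (C.val x) := rfl

end Circuit

/-! ### Reading circuits -/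

theorem getElem?_append_add {β : Type} (l l' : List β) (i : ℕ) :
    (l ++ l')[l.length + i]? = l'[i]? := by
  rw [List.getElem?_append_right (by omega), Nat.add_sub_cancel_left]

/-- The position after a gate. -/
noncomputable def gateStep (w : List Bool) (p : ℕ) : ℕ :=
  if symCode w[p]? = 1 then
    if symCode w[p + 1]? = 1 then p + 3 else skip w (p + 2)
  else skip w (skip w (p + 2))

/-- The position of the gate with a given number. -/
noncomputable def gatePos (w : List Bool) (t : ℕ) : ℕ :=
  (fun p => min (gateStep w p) w.length)^[t] (skip w (skip w 0))

/-- The number of inputs, read from the encoding of a circuit. -/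
noncomputable def readInputs (w : List Bool) : ℕ := tokVal w (w.length + 1) 0

/-- The number of gates, read from the encoding of a circuit. -/
noncomputable def readGates (w : List Bool) : ℕ := tokVal w (w.length + 1) (skip w 0)

/-- An operation that is applied to a register and to the value of the first operand of a gate. -/
noncomputable def readOp1 (w : List Bool) (t : ℕ) : ℕ :=
  if symCode w[gatePos w t]? = 1 then
    if symCode w[gatePos w t + 1]? = 1 then symCode w[gatePos w t + 2]? + 2 else 2
  else 1

/-- An operation that is applied to a register and to the value of the second operand of a gate. -/
noncomputable def readOp2 (w : List Bool) (t : ℕ) : ℕ :=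
  if symCode w[gatePos w t]? = 1 then 0 else symCode w[gatePos w t + 1]? + 4

noncomputable def readArg1 (w : List Bool) (t : ℕ) : ℕ :=
  if 2 < readOp1 w t then readInputs w + t else tokVal w (2 * w.length) (gatePos w t + 2)

noncomputable def readArg2 (w : List Bool) (t : ℕ) : ℕ :=
  if readOp2 w t = 0 then readInputs w + t
  else tokVal w (2 * w.length) (skip w (gatePos w t + 2))

noncomputable def readOut (w : List Bool) (r : ℕ) : ℕ :=
  tok w (2 * w.length) (skip w (gatePos w (readGates w))) r

section

variable {α : Type} [Enc α]

instance L.gateStepOf (p : List Bool → α → ℕ) [hp : L p] : L fun w a => gateStep w (p w a) := by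
  unfold gateStep
  infer_instance

instance L.gatePosOf (t : List Bool → α → ℕ) [ht : L t] : L fun w a => gatePos w (t w a) := by
  unfold gatePos
  infer_instance

instance L.readInputsOf : L fun w (_ : α) => readInputs w := by unfold readInputs; infer_instance

instance L.readGatesOf : L fun w (_ : α) => readGates w := by unfold readGates; infer_instance

instance L.readOp1Of (t : List Bool → α → ℕ) [ht : L t] : L fun w a => readOp1 w (t w a) := by
  unfold readOp1; infer_instance

instance L.readOp2Of (t : List Bool → α → ℕ) [ht : L t] : L fun w a => readOp2 w (t w a) := by
  unfold readOp2; infer_instance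

instance L.readArg1Of (t : List Bool → α → ℕ) [ht : L t] : L fun w a => readArg1 w (t w a) := by
  unfold readArg1; infer_instance

instance L.readArg2Of (t : List Bool → α → ℕ) [ht : L t] : L fun w a => readArg2 w (t w a) := by
  unfold readArg2; infer_instance

instance L.readOutOf (r : List Bool → α → ℕ) [hr : L r] : L fun w a => readOut w (r w a) := by
  unfold readOut; infer_instance

end

namespace Gate

def op1 : Gate → ℕ
  | const b => if b then 4 else 3
  | not _ => 2
  | and _ _ => 1
  | or _ _ => 1

def op2 : Gate → ℕ
  | const _ => 0
  | not _ => 0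
  | and _ _ => 5
  | or _ _ => 6

def arg1 (self : ℕ) : Gate → ℕ
  | const _ => self
  | not i => i
  | and i _ => i
  | or i _ => i

def arg2 (self : ℕ) : Gate → ℕ
  | const _ => self
  | not _ => self
  | and _ j => j
  | or _ j => j

theorem encode_length_pos (g : Gate) : 0 < g.encode.length := by
  cases g <;> simp [encode]

theorem gateStep_eq (pre suf : List Bool) (g : Gate) :
    gateStep (pre ++ g.encode ++ suf) pre.length = (pre ++ g.encode).length := by
  have h0 := getElem?_append_add pre (g.encode ++ suf) 0
  have h1 := getElem?_append_add pre (g.encode ++ suf) 1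
  rw [add_zero] at h0
  rw [gateStep, List.append_assoc, h0, h1]
  cases g with
  | const b => simp [encode, symCode]
  | not i =>
    have := skip_eq (pre ++ [false, true]) i.bits suf
    simp only [List.length_append, List.length_cons, List.length_nil, zero_add, Nat.reduceAdd,
      List.append_assoc, List.cons_append, List.nil_append] at this
    simp [encode, symCode, encNat, this, add_assoc]
  | and i j =>
    have h2 := skip_eq (pre ++ [true, false]) i.bits (encWord j.bits ++ suf)
    have h3 := skip_eq (pre ++ [true, false] ++ encWord i.bits) j.bits suf
    simp only [List.length_append, List.length_cons, List.length_nil, zero_add, Nat.reduceAdd,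
      List.append_assoc, List.cons_append, List.nil_append] at h2 h3
    simp [encode, symCode, encNat, h2, h3, add_assoc]
  | or i j =>
    have h2 := skip_eq (pre ++ [true, true]) i.bits (encWord j.bits ++ suf)
    have h3 := skip_eq (pre ++ [true, true] ++ encWord i.bits) j.bits suf
    simp only [List.length_append, List.length_cons, List.length_nil, zero_add, Nat.reduceAdd,
      List.append_assoc, List.cons_append, List.nil_append] at h2 h3
    simp [encode, symCode, encNat, h2, h3, add_assoc]

end Gate

namespace Circuit

variable (C : Circuit)

/-- The part of the encoding before the gates. -/
def header : List Bool := encNat C.inputs ++ encNat C.gates.length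

theorem encode_eq : C.encode = C.header ++ C.gates.flatMap Gate.encode ++
    (encNat C.outputs.length ++ C.outputs.flatMap encNat) := by
  rw [encode, header]
  simp only [List.append_assoc]

theorem skip_skip_encode : skip C.encode 0 = (encNat C.inputs).length ∧
    skip C.encode (encNat C.inputs).length = C.header.length := by
  constructor
  · have := skip_eq [] C.inputs.bits (encNat C.gates.length ++ C.gates.flatMap Gate.encode ++
      (encNat C.outputs.length ++ C.outputs.flatMap encNat))
    rw [encode_eq, header, encNat]
    simpa [List.append_assoc] using this
  · have := skip_eq (encNat C.inputs) C.gates.length.bits (C.gates.flatMap Gate.encode ++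
      (encNat C.outputs.length ++ C.outputs.flatMap encNat))
    rw [encode_eq, header, List.append_assoc (encNat C.inputs ++ _)]
    exact this

theorem split_gate {t : ℕ} (ht : t < C.gates.length) :
    ∃ suf, C.encode = (C.header ++ (C.gates.take t).flatMap Gate.encode) ++ C.gates[t].encode ++ suf := by
  refine ⟨(C.gates.drop (t + 1)).flatMap Gate.encode ++
    (encNat C.outputs.length ++ C.outputs.flatMap encNat), ?_⟩
  have e : C.gates.flatMap Gate.encode = (C.gates.take t).flatMap Gate.encode ++
      (C.gates[t].encode ++ (C.gates.drop (t + 1)).flatMap Gate.encode) := by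
    conv_lhs => rw [← List.take_append_drop t C.gates, List.drop_eq_getElem_cons ht]
    rw [List.flatMap_append, List.flatMap_cons]
  rw [encode_eq, e]
  simp only [List.append_assoc]

theorem gatePos_encode (t : ℕ) (ht : t ≤ C.gates.length) :
    gatePos C.encode t = (C.header ++ (C.gates.take t).flatMap Gate.encode).length := by
  induction t with
  | zero => simp [gatePos, C.skip_skip_encode.1, C.skip_skip_encode.2]
  | succ t ih =>
    have ih := ih (by omega)
    rw [gatePos] at ih ⊢
    obtain ⟨suf, e⟩ := C.split_gate ht
    have h := Gate.gateStep_eq (C.header ++ (C.gates.take t).flatMap Gate.encode) suf C.gates[t]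
    rw [← e] at h
    rw [Function.iterate_succ_apply', ih, h, List.take_succ_eq_append_getElem ht,
      List.flatMap_append, ← List.append_assoc]
    simp only [List.flatMap_cons, List.flatMap_nil, List.append_nil]
    rw [min_eq_left]
    rw [e, List.length_append (bs := suf)]
    omega

theorem gates_le_length (l : List Gate) : l.length ≤ (l.flatMap Gate.encode).length := by
  induction l with
  | nil => simp
  | cons g l ih =>
    have := g.encode_length_pos
    simp only [List.flatMap_cons, List.length_append, List.length_cons]
    omega

theorem gates_outputs_lt : C.gates.length + C.outputs.length < C.encode.length := by
  have h1 := gates_le_length C.gates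
  have h2 := length_le_flatMap_encNat C.outputs
  rw [encode_eq]
  simp only [List.length_append, encNat, encWord_length]
  omega

theorem readGates_encode : readGates C.encode = C.gates.length := by
  have h := C.gates_outputs_lt
  have e : C.encode = encNat C.inputs ++ encNat C.gates.length ++ (C.gates.flatMap Gate.encode ++
      (encNat C.outputs.length ++ C.outputs.flatMap encNat)) := by
    rw [encode_eq, header]
    simp only [List.append_assoc]
  have hB : C.gates.length < C.encode.length + 1 := by omega
  rw [readGates, C.skip_skip_encode.1]
  generalize C.encode.length + 1 = B at hB ⊢
  rw [e]
  exact tokVal_eq _ _ hB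

theorem readInputs_encode (hC : C.inputs = C.outputs.length) : readInputs C.encode = C.inputs := by
  have h := C.gates_outputs_lt
  have e : C.encode = [] ++ encNat C.inputs ++ (encNat C.gates.length ++
      (C.gates.flatMap Gate.encode ++ (encNat C.outputs.length ++ C.outputs.flatMap encNat))) := by
    rw [encode_eq, header]
    simp only [List.append_assoc, List.nil_append]
  have hB : C.inputs < C.encode.length + 1 := by omega
  rw [readInputs]
  generalize C.encode.length + 1 = B at hB ⊢
  rw [e]
  exact tokVal_eq [] _ hB

theorem readOut_encode (hC : C.inputs = C.outputs.length) (r : ℕ) (hr : r < C.outputs.length) :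
    readOut C.encode r = C.outputs[r] := by
  have h := C.gates_outputs_lt
  have h1 := skip_eq (C.header ++ C.gates.flatMap Gate.encode) C.outputs.length.bits
    (C.outputs.flatMap encNat)
  have h2 := tok_eq (C.header ++ C.gates.flatMap Gate.encode ++ encNat C.outputs.length) []
    C.outputs (B := 2 * C.encode.length) hr
    (by have := C.outputs_below _ (List.getElem_mem hr); omega)
  have e : C.encode = C.header ++ C.gates.flatMap Gate.encode ++ encNat C.outputs.length ++
      C.outputs.flatMap encNat := by
    rw [encode_eq]
    simp only [List.append_assoc]
  rw [List.append_nil, ← e] at h2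
  change skip (C.header ++ C.gates.flatMap Gate.encode ++ encNat C.outputs.length ++
      C.outputs.flatMap encNat) _ = _ at h1
  rw [← e] at h1
  rw [readOut, C.readGates_encode, C.gatePos_encode _ le_rfl, List.take_length, h1]
  exact h2

theorem read_gate (hC : C.inputs = C.outputs.length) {t : ℕ} (ht : t < C.gates.length) :
    readOp1 C.encode t = C.gates[t].op1 ∧ readOp2 C.encode t = C.gates[t].op2 ∧
    readArg1 C.encode t = C.gates[t].arg1 (C.inputs + t) ∧
    readArg2 C.encode t = C.gates[t].arg2 (C.inputs + t) := by
  have hlen := C.gates_outputs_lt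
  have hbelow := C.gates_below t ht
  have hp := C.gatePos_encode t ht.le
  obtain ⟨suf, e⟩ := C.split_gate ht
  set pre := C.header ++ (C.gates.take t).flatMap Gate.encode
  have g0 : C.encode[pre.length]? = (C.gates[t].encode ++ suf)[0]? := by
    rw [e, List.append_assoc]; exact getElem?_append_add pre _ 0
  have g1 : C.encode[pre.length + 1]? = (C.gates[t].encode ++ suf)[1]? := by
    rw [e, List.append_assoc]; exact getElem?_append_add pre _ 1
  have g2 : C.encode[pre.length + 2]? = (C.gates[t].encode ++ suf)[2]? := by
    rw [e, List.append_assoc]; exact getElem?_append_add pre _ 2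
  rw [readArg1, readArg2, readOp1, readOp2, hp, C.readInputs_encode hC, g0, g1, g2]
  generalize C.gates[t] = g at *
  cases g with
  | const b =>
    cases b <;> simp [Gate.encode, symCode, Gate.op1, Gate.op2, Gate.arg1, Gate.arg2]
  | not i =>
    have h2 := tokVal_eq (pre ++ [false, true]) suf (n := i) (B := 2 * C.encode.length)
      (by simp only [Gate.Below] at hbelow; omega)
    have e' : C.encode = pre ++ [false, true] ++ encNat i ++ suf := by
      rw [e, Gate.encode]; simp only [List.append_assoc]
    rw [← e'] at h2
    have h3 : (pre ++ [false, true]).length = pre.length + 2 := by simp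
    rw [h3] at h2
    simp [Gate.encode, symCode, Gate.op1, Gate.op2, Gate.arg1, Gate.arg2, h2]
  | and i j =>
    simp only [Gate.Below] at hbelow
    have h2 := tokVal_eq (pre ++ [true, false]) (encNat j ++ suf) (n := i)
      (B := 2 * C.encode.length) (by omega)
    have h2' := skip_eq (pre ++ [true, false]) i.bits (encNat j ++ suf)
    change skip (pre ++ [true, false] ++ encNat i ++ (encNat j ++ suf)) _ =
      (pre ++ [true, false] ++ encNat i).length at h2'
    have h2'' := tokVal_eq (pre ++ [true, false] ++ encNat i) suf (n := j)
      (B := 2 * C.encode.length) (by omega)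
    have e' : C.encode = pre ++ [true, false] ++ encNat i ++ (encNat j ++ suf) := by
      rw [e, Gate.encode]; simp only [List.append_assoc]
    have e'' : C.encode = pre ++ [true, false] ++ encNat i ++ encNat j ++ suf := by
      rw [e, Gate.encode]; simp only [List.append_assoc]
    rw [← e'] at h2 h2'
    rw [← e'', ← h2'] at h2''
    have h3 : (pre ++ [true, false]).length = pre.length + 2 := by simp
    rw [h3] at h2 h2''
    simp [Gate.encode, symCode, Gate.op1, Gate.op2, Gate.arg1, Gate.arg2, h2, h2'']
  | or i j =>
    simp only [Gate.Below] at hbelow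
    have h2 := tokVal_eq (pre ++ [true, true]) (encNat j ++ suf) (n := i)
      (B := 2 * C.encode.length) (by omega)
    have h2' := skip_eq (pre ++ [true, true]) i.bits (encNat j ++ suf)
    change skip (pre ++ [true, true] ++ encNat i ++ (encNat j ++ suf)) _ =
      (pre ++ [true, true] ++ encNat i).length at h2'
    have h2'' := tokVal_eq (pre ++ [true, true] ++ encNat i) suf (n := j)
      (B := 2 * C.encode.length) (by omega)
    have e' : C.encode = pre ++ [true, true] ++ encNat i ++ (encNat j ++ suf) := by
      rw [e, Gate.encode]; simp only [List.append_assoc]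
    have e'' : C.encode = pre ++ [true, true] ++ encNat i ++ encNat j ++ suf := by
      rw [e, Gate.encode]; simp only [List.append_assoc]
    rw [← e'] at h2 h2'
    rw [← e'', ← h2'] at h2''
    have h3 : (pre ++ [true, true]).length = pre.length + 2 := by simp
    rw [h3] at h2 h2''
    simp [Gate.encode, symCode, Gate.op1, Gate.op2, Gate.arg1, Gate.arg2, h2, h2'']

end Circuit

attribute [irreducible] readInputs readGates readOp1 readOp2 readArg1 readArg2 readOut

end AutNet

namespace AutNet

open Enc

/-! ### Straight-line programs that evaluate circuits -/

/-- The operations on `{0, 1, 2}`, where `1` and `2` stand for the truth values. -/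
def applyOp (o x y : ℕ) : ℕ :=
  if o = 1 then y
  else if o = 2 then if y = 0 then 0 else 3 - y
  else if o = 3 then min x 1
  else if o = 4 then if x = 0 then 0 else 2
  else if o = 5 then min x y
  else if o = 6 then max x y
  else x

theorem applyOp_lt {o x y : ℕ} (hx : x < 3) (hy : y < 3) : applyOp o x y < 3 := by
  unfold applyOp
  split_ifs <;> omega

theorem applyOp_zero (o : ℕ) : applyOp o 0 0 = 0 := by
  simp [applyOp]

/-- The letter that stands for a truth value. -/
def truth (b : Bool) : ℕ := b.toNat + 1

/-- A straight-line program for a circuit with `K` inputs, `G` gates and `K` outputs. The vertices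
are held by the registers below `P`, and the outputs by the following `K` registers. -/
structure CircuitProgram where
  K : ℕ
  P : ℕ
  G : ℕ
  op1 : ℕ → ℕ
  op2 : ℕ → ℕ
  arg1 : ℕ → ℕ
  arg2 : ℕ → ℕ
  out : ℕ → ℕ

namespace CircuitProgram

variable (A : CircuitProgram)

def op (l : ℕ) : ℕ :=
  if l < 2 * A.P then
    if l / 2 < A.G then if l % 2 = 0 then A.op1 (l / 2) else A.op2 (l / 2) else 0
  else if l < 2 * A.P + 2 * A.K then 1
  else if l < 2 * A.P + 3 * A.K then 0 else 3

def tgt (l : ℕ) : ℕ :=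
  if l < 2 * A.P then if l / 2 < A.G then A.K + l / 2 else 0
  else if l < 2 * A.P + A.K then l - A.P
  else if l < 2 * A.P + 2 * A.K then l - 2 * A.P - A.K else l - 2 * A.P - 2 * A.K

def src (l : ℕ) : ℕ :=
  if l < 2 * A.P then
    if l / 2 < A.G then if l % 2 = 0 then A.arg1 (l / 2) else A.arg2 (l / 2) else 0
  else if l < 2 * A.P + A.K then A.out (l - 2 * A.P)
  else if l < 2 * A.P + 2 * A.K then l - A.P - A.K else l - 2 * A.P - 2 * A.K

def involution (l r : ℕ) : ℕ := if r = A.tgt l then A.src l else if r = A.src l then A.tgt l else r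

def localMap (l r x y : ℕ) : ℕ := if r = A.tgt l then applyOp (A.op l) x y else x

/-- The operands exist. -/
structure Valid : Prop where
  K_pos : 0 < A.K
  le : A.K + A.G ≤ A.P
  arg1_le : ∀ t < A.G, A.arg1 t ≤ A.K + t
  arg2_le : ∀ t < A.G, A.arg2 t ≤ A.K + t
  out_lt : ∀ r < A.K, A.out r < A.K + A.G

variable {A}

theorem Valid.tgt_src_lt (hA : A.Valid) {l : ℕ} (hl : l < 3 * A.P + 3 * A.K) :
    A.tgt l < A.P + A.K ∧ A.src l < A.P + A.K := by
  have h1 := hA.K_pos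
  have h2 := hA.le
  have h3 := hA.arg1_le (l / 2)
  have h4 := hA.arg2_le (l / 2)
  have h5 := hA.out_lt (l - 2 * A.P)
  unfold tgt src
  constructor <;> split_ifs <;> omega

/-- The layered network of a program. -/
def Valid.layered (hA : A.Valid) : Layered 3 where
  T := 3 * A.P + 3 * A.K
  W := A.P + A.K
  τ := A.involution
  h := A.localMap
  T_pos := by have := hA.K_pos; omega
  τ_lt l hl r hr := by
    have := hA.tgt_src_lt hl
    unfold involution
    split_ifs <;> omega
  τ_τ l _ r _ := by unfold involution; grind
  h_lt l _ r _ x hx y hy := by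
    unfold localMap
    split_ifs
    · exact applyOp_lt hx hy
    · exact hx
  h_zero l _ r _ := by
    unfold localMap
    split_ifs
    · exact applyOp_zero _
    · rfl

/-- The program computes the values `val` of the vertices. -/
def Computes (A : CircuitProgram) (val : ℕ → Bool) : Prop :=
  ∀ t < A.G, ∀ y1 y2 : ℕ, (A.arg1 t < A.K + t → y1 = truth (val (A.arg1 t))) →
    (A.arg2 t < A.K + t → y2 = truth (val (A.arg2 t))) →
    applyOp (A.op2 t) (applyOp (A.op1 t) 1 y1) y2 = truth (val (A.K + t))

variable (hA : A.Valid) {val : ℕ → Bool} {z : ℕ → ℕ}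

theorem Valid.state_succ (l : ℕ) : hA.layered.state z (l + 1) =
    Function.update (hA.layered.state z l) (A.tgt l)
      (applyOp (A.op l) (hA.layered.state z l (A.tgt l)) (hA.layered.state z l (A.src l))) := by
  funext r
  change A.localMap l r (hA.layered.state z l r) (hA.layered.state z l (A.involution l r)) = _
  unfold localMap involution
  by_cases h : r = A.tgt l
  · rw [if_pos h, if_pos h, h, Function.update_self]
  · rw [if_neg h, Function.update_of_ne h]

theorem Valid.state_gates (hval : A.Computes val)
    (hz : ∀ r < A.P + A.K, z r = truth (decide (r < A.K) && val r)) {t : ℕ} (ht : t ≤ A.P)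
    {r : ℕ} (hr : r < A.P + A.K) :
    hA.layered.state z (2 * t) r = truth (decide (r < A.K + min t A.G) && val r) := by
  have h2 := hA.le
  induction t generalizing r with
  | zero =>
    rw [Nat.zero_min, add_zero]
    exact hz r hr
  | succ t ih =>
    have ih := fun {r} => ih (by omega) (r := r)
    rw [show 2 * (t + 1) = 2 * t + 1 + 1 by ring, hA.state_succ, hA.state_succ]
    have e1 : (2 * t + 1) / 2 = t := by omega
    have e2 : 2 * t / 2 = t := by omega
    have e3 : (2 * t + 1) % 2 = 1 := by omega
    have e4 : 2 * t % 2 = 0 := by omega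
    by_cases hG : t < A.G
    · have t1 : A.tgt (2 * t) = A.K + t := by
        rw [tgt, if_pos (by omega), e2, if_pos hG]
      have t2 : A.tgt (2 * t + 1) = A.K + t := by
        rw [tgt, if_pos (by omega), e1, if_pos hG]
      have s1 : A.src (2 * t) = A.arg1 t := by
        rw [src, if_pos (by omega), e2, if_pos hG, if_pos e4]
      have s2 : A.src (2 * t + 1) = A.arg2 t := by
        rw [src, if_pos (by omega), e1, if_pos hG, if_neg (by omega)]
      have o1 : A.op (2 * t) = A.op1 t := by
        rw [op, if_pos (by omega), e2, if_pos hG, if_pos e4]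
      have o2 : A.op (2 * t + 1) = A.op2 t := by
        rw [op, if_pos (by omega), e1, if_pos hG, if_neg (by omega)]
      rw [t1, t2, s1, s2, o1, o2, Function.update_idem, Function.update_self]
      have hself : hA.layered.state z (2 * t) (A.K + t) = 1 := by
        rw [ih (by omega), decide_eq_false (by omega)]; rfl
      rw [hself]
      have hv := hval t hG (hA.layered.state z (2 * t) (A.arg1 t))
        (Function.update (hA.layered.state z (2 * t)) (A.K + t)
          (applyOp (A.op1 t) 1 (hA.layered.state z (2 * t) (A.arg1 t))) (A.arg2 t))
        (fun h => by rw [ih (by omega), decide_eq_true (by omega)]; rfl)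
        (fun h => by
          rw [Function.update_of_ne h.ne, ih (by omega), decide_eq_true (by omega)]; rfl)
      rw [hv]
      by_cases hr' : r = A.K + t
      · rw [hr', Function.update_self, decide_eq_true (by omega)]; rfl
      · rw [Function.update_of_ne hr', ih hr]
        congr 3
        simp only [eq_iff_iff]
        omega
    · have t1 : A.tgt (2 * t) = 0 := by
        rw [tgt, if_pos (by omega), e2, if_neg hG]
      have t2 : A.tgt (2 * t + 1) = 0 := by
        rw [tgt, if_pos (by omega), e1, if_neg hG]
      have o1 : A.op (2 * t) = 0 := by
        rw [op, if_pos (by omega), e2, if_neg hG]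
      have o2 : A.op (2 * t + 1) = 0 := by
        rw [op, if_pos (by omega), e1, if_neg hG]
      have ha : ∀ x y, applyOp 0 x y = x := fun _ _ => rfl
      rw [t1, t2, o1, o2, ha, ha, Function.update_eq_self, Function.update_eq_self, ih hr]
      congr 3
      simp only [eq_iff_iff]
      omega

theorem Valid.state_copy (hval : A.Computes val)
    (hz : ∀ r < A.P + A.K, z r = truth (decide (r < A.K) && val r)) {b : ℕ} (hb : b ≤ A.K)
    {r : ℕ} (hr : r < A.P + A.K) :
    hA.layered.state z (2 * A.P + b) r = if r < A.P then truth (decide (r < A.K + A.G) && val r)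
      else truth (decide (r - A.P < b) && val (A.out (r - A.P))) := by
  have h2 := hA.le
  induction b generalizing r with
  | zero =>
    rw [add_zero, hA.state_gates hval hz le_rfl hr, min_eq_right (by omega)]
    split
    · rfl
    · rw [decide_eq_false (by omega), decide_eq_false (by omega)]; rfl
  | succ b ih =>
    have ih := fun {r} => ih (by omega) (r := r)
    have h3 := hA.out_lt b (by omega)
    have t1 : A.tgt (2 * A.P + b) = A.P + b := by
      rw [tgt, if_neg (by omega), if_pos (by omega)]; omega
    have s1 : A.src (2 * A.P + b) = A.out b := by
      rw [src, if_neg (by omega), if_pos (by omega), Nat.add_sub_cancel_left]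
    have o1 : A.op (2 * A.P + b) = 1 := by
      rw [op, if_neg (by omega), if_pos (by omega)]
    have ha : ∀ x y, applyOp 1 x y = y := fun _ _ => rfl
    rw [← add_assoc, hA.state_succ, t1, s1, o1, ha, ih (by omega), if_pos (by omega),
      decide_eq_true h3]
    by_cases hr' : r = A.P + b
    · rw [hr', Function.update_self, if_neg (by omega), Nat.add_sub_cancel_left,
        decide_eq_true (by omega)]
    · rw [Function.update_of_ne hr', ih hr]
      split
      · rfl
      · congr 3
        simp only [eq_iff_iff]
        omega

theorem Valid.state_restore (hval : A.Computes val)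
    (hz : ∀ r < A.P + A.K, z r = truth (decide (r < A.K) && val r)) {c : ℕ} (hc : c ≤ A.K)
    {r : ℕ} (hr : r < A.P + A.K) :
    (r < c → hA.layered.state z (2 * A.P + A.K + c) r = truth (val (A.out r))) ∧
    (A.P ≤ r → hA.layered.state z (2 * A.P + A.K + c) r = truth (val (A.out (r - A.P)))) ∧
    0 < hA.layered.state z (2 * A.P + A.K + c) r := by
  have h2 := hA.le
  have ht : ∀ b, 0 < truth b := fun b => Nat.succ_pos _
  induction c generalizing r with
  | zero =>
    have h := hA.state_copy hval hz (b := A.K) le_rfl hr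
    rw [add_zero]
    refine ⟨fun h => absurd h (Nat.not_lt_zero _), fun h3 => ?_, ?_⟩
    · rw [h, if_neg (by omega), decide_eq_true (by omega)]; rfl
    · rw [h]; split <;> exact ht _
  | succ c ih =>
    have ih := fun {r} => ih (by omega) (r := r)
    have t1 : A.tgt (2 * A.P + A.K + c) = c := by
      rw [tgt, if_neg (by omega), if_neg (by omega), if_pos (by omega)]; omega
    have s1 : A.src (2 * A.P + A.K + c) = A.P + c := by
      rw [src, if_neg (by omega), if_neg (by omega), if_pos (by omega)]; omega
    have o1 : A.op (2 * A.P + A.K + c) = 1 := by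
      rw [op, if_neg (by omega), if_pos (by omega)]
    have ha : ∀ x y, applyOp 1 x y = y := fun _ _ => rfl
    rw [← add_assoc, hA.state_succ, t1, s1, o1, ha, (ih (r := A.P + c) (by omega)).2.1 (by omega),
      Nat.add_sub_cancel_left]
    by_cases hr' : r = c
    · subst hr'
      rw [Function.update_self]
      exact ⟨fun _ => rfl, fun h => by omega, ht _⟩
    · rw [Function.update_of_ne hr']
      exact ⟨fun h => (ih hr).1 (by omega), (ih hr).2⟩

theorem Valid.state_reset (hval : A.Computes val)
    (hz : ∀ r < A.P + A.K, z r = truth (decide (r < A.K) && val r)) {d : ℕ} (hd : d ≤ A.P + A.K)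
    {r : ℕ} (hr : r < A.P + A.K) :
    (r < A.K → hA.layered.state z (2 * A.P + 2 * A.K + d) r = truth (val (A.out r))) ∧
    (A.K ≤ r → r < d → hA.layered.state z (2 * A.P + 2 * A.K + d) r = 1) ∧
    0 < hA.layered.state z (2 * A.P + 2 * A.K + d) r := by
  have h2 := hA.le
  induction d generalizing r with
  | zero =>
    have h := hA.state_restore hval hz (c := A.K) le_rfl hr
    rw [add_zero, show 2 * A.P + 2 * A.K = 2 * A.P + A.K + A.K by ring]
    exact ⟨h.1, fun _ h => by omega, h.2.2⟩
  | succ d ih =>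
    have ih := fun {r} => ih (by omega) (r := r)
    have t1 : A.tgt (2 * A.P + 2 * A.K + d) = d := by
      rw [tgt, if_neg (by omega), if_neg (by omega), if_neg (by omega)]; omega
    rw [← add_assoc, hA.state_succ, t1]
    by_cases hd' : d < A.K
    · have o1 : A.op (2 * A.P + 2 * A.K + d) = 0 := by
        rw [op, if_neg (by omega), if_neg (by omega), if_pos (by omega)]
      have ha : ∀ x y, applyOp 0 x y = x := fun _ _ => rfl
      rw [o1, ha, Function.update_eq_self]
      exact ⟨(ih hr).1, fun h3 h4 => (ih hr).2.1 h3 (by omega), (ih hr).2.2⟩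
    · have o1 : A.op (2 * A.P + 2 * A.K + d) = 3 := by
        rw [op, if_neg (by omega), if_neg (by omega), if_neg (by omega)]
      have ha : ∀ x y, 0 < x → applyOp 3 x y = 1 := fun x y hx => min_eq_right hx
      rw [o1, ha _ _ (ih (by omega)).2.2]
      by_cases hr' : r = d
      · subst hr'
        rw [Function.update_self]
        exact ⟨fun h => absurd h hd', fun _ _ => rfl, one_pos⟩
      · rw [Function.update_of_ne hr']
        exact ⟨(ih hr).1, fun h3 h4 => (ih hr).2.1 h3 (by omega), (ih hr).2.2⟩

theorem Valid.state_final (hval : A.Computes val)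
    (hz : ∀ r < A.P + A.K, z r = truth (decide (r < A.K) && val r)) {r : ℕ}
    (hr : r < A.P + A.K) : hA.layered.state z (3 * A.P + 3 * A.K) r =
      truth (decide (r < A.K) && val (A.out r)) := by
  have h := hA.state_reset hval hz (d := A.P + A.K) le_rfl hr
  rw [show 3 * A.P + 3 * A.K = 2 * A.P + 2 * A.K + (A.P + A.K) by ring]
  by_cases h' : r < A.K
  · rw [h.1 h', decide_eq_true h']; rfl
  · rw [h.2.1 (by omega) hr, decide_eq_false h']; rfl

end CircuitProgram

end AutNet

namespace AutNet

open Enc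

/-! ### Networks given by circuits -/

instance L.applyOpOf {α : Type} [Enc α] (o x y : List Bool → α → ℕ) [ho : L o] [hx : L x]
    [hy : L y] : L fun w a => applyOp (o w a) (x w a) (y w a) := by
  unfold applyOp
  infer_instance

section

variable (m : AlphabetCoding)

theorem AlphabetCoding.word_eq {q n : ℕ} (x : Fin n → Fin q) : m.word x =
    (List.range n).flatMap fun v => if h : v < n then List.ofFn (m.code q (x ⟨v, h⟩)) else [] := by
  rw [AlphabetCoding.word, ← flatMap_finRange n fun v => List.ofFn (m.code q (x v)),
    List.ofFn_eq_map, List.flatMap_map]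

theorem AlphabetCoding.sum_length {q n : ℕ} (x : Fin n → Fin q) {v : ℕ} (hv : v ≤ n) :
    ∑ u ∈ Finset.range v,
      (if h : u < n then List.ofFn (m.code q (x ⟨u, h⟩)) else []).length = v * m.len q := by
  rw [Finset.sum_congr rfl (g := fun _ => m.len q), Finset.sum_const, Finset.card_range, smul_eq_mul]
  intro u hu
  have : u < n := by have := Finset.mem_range.1 hu; omega
  rw [dif_pos this, List.length_ofFn]

theorem AlphabetCoding.length_word {q n : ℕ} (x : Fin n → Fin q) :
    (m.word x).length = n * m.len q := by
  rw [m.word_eq, ← m.sum_length x le_rfl]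
  exact length_flatMap_range _ _

theorem AlphabetCoding.getD_word {q n : ℕ} [NeZero (m.len q)] (x : Fin n → Fin q) {r : ℕ}
    (hr : r / m.len q < n) :
    (m.word x).getD r false = m.code q (x ⟨r / m.len q, hr⟩) (Fin.ofNat _ r) := by
  have h1 : r % m.len q < m.len q := Nat.mod_lt _ (m.len_pos q)
  have h2 := getElem?_flatMap_range_add (fun v =>
      if h : v < n then List.ofFn (m.code q (x ⟨v, h⟩)) else []) hr (k := r % m.len q)
    (by rw [dif_pos hr, List.length_ofFn]; exact h1)
  rw [m.sum_length x hr.le, ← m.word_eq, Nat.div_add_mod'] at h2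
  rw [List.getD_eq_getElem?_getD, h2, dif_pos hr, List.getElem?_ofFn, dif_pos h1]
  rfl

variable (q : ℕ) (Q : Polynomial ℕ)

/-- The program that evaluates an encoded circuit. -/
noncomputable def circuitProgram (w : List Bool) : CircuitProgram where
  K := readInputs w
  P := Q.eval (readInputs w / m.len q)
  G := readGates w
  op1 := readOp1 w
  op2 := readOp2 w
  arg1 := readArg1 w
  arg2 := readArg2 w
  out := readOut w

theorem L.polynomial_eval {α : Type} [Enc α] (f : List Bool → α → ℕ) [hf : L f] :
    L fun w a => Q.eval (f w a) := by
  simp only [Polynomial.eval_eq_sum_range]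
  generalize Q.natDegree + 1 = N
  induction N with
  | zero => exact L.const 0
  | succ N ih =>
    simp only [Finset.sum_range_succ]
    infer_instance

section

variable {α : Type} [Enc α]

instance L.circuitProgramP : L fun w (_ : α) => (circuitProgram m q Q w).P :=
  L.polynomial_eval Q fun w (_ : α) => readInputs w / m.len q

instance L.circuitProgramK : L fun w (_ : α) => (circuitProgram m q Q w).K := L.readInputsOf

instance L.circuitProgramG : L fun w (_ : α) => (circuitProgram m q Q w).G := L.readGatesOf

instance L.circuitProgramTgt (l : List Bool → α → ℕ) [hl : L l] :
    L fun w a => (circuitProgram m q Q w).tgt (l w a) := by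
  unfold CircuitProgram.tgt
  infer_instance

instance L.circuitProgramSrc (l : List Bool → α → ℕ) [hl : L l] :
    L fun w a => (circuitProgram m q Q w).src (l w a) := by
  have h1 : L fun w a => (circuitProgram m q Q w).arg1 (l w a / 2) :=
    L.readArg1Of fun w a => l w a / 2
  have h2 : L fun w a => (circuitProgram m q Q w).arg2 (l w a / 2) :=
    L.readArg2Of fun w a => l w a / 2
  have h3 : L fun w a => (circuitProgram m q Q w).out (l w a - 2 * (circuitProgram m q Q w).P) :=
    L.readOutOf fun w a => l w a - 2 * (circuitProgram m q Q w).P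
  unfold CircuitProgram.src
  infer_instance

instance L.circuitProgramOp (l : List Bool → α → ℕ) [hl : L l] :
    L fun w a => (circuitProgram m q Q w).op (l w a) := by
  have h1 : L fun w a => (circuitProgram m q Q w).op1 (l w a / 2) :=
    L.readOp1Of fun w a => l w a / 2
  have h2 : L fun w a => (circuitProgram m q Q w).op2 (l w a / 2) :=
    L.readOp2Of fun w a => l w a / 2
  unfold CircuitProgram.op
  infer_instance

end

/-- The representation of the network that evaluates an encoded circuit. -/
noncomputable def circuitWord (w : List Bool) : List Bool :=
  layeredWord 3 (3 * (circuitProgram m q Q w).P + 3 * (circuitProgram m q Q w).K)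
    ((circuitProgram m q Q w).P + (circuitProgram m q Q w).K)
    (circuitProgram m q Q w).involution (circuitProgram m q Q w).localMap

theorem LO.circuitWord : LO fun w (_ : ℕ) => circuitWord m q Q w := by
  refine LO.layeredWord 3 inferInstance inferInstance ?_ ?_
  · unfold CircuitProgram.involution
    infer_instance
  · unfold CircuitProgram.localMap
    infer_instance

/-- The pattern of a register. -/
noncomputable def circuitPat [NeZero q] [NeZero (m.len q)] (K r s : ℕ) : ℕ :=
  if r < K then truth (m.code q (Fin.ofNat q s) (Fin.ofNat (m.len q) r)) else 1

/-- The node to whose block a register belongs. -/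
def circuitBlk (K r : ℕ) : ℕ := if r < K then r / m.len q else 0

theorem L.circuitPat [NeZero q] [NeZero (m.len q)] :
    L fun w (p : ℕ × ℕ) => circuitPat m q (readInputs w) p.1 p.2 := by
  have h1 : L fun _ (p : ℕ × ℕ) => truth (m.code q (Fin.ofNat q p.2) (Fin.ofNat (m.len q) p.1)) :=
    L.apply_finite (enc_prod_injective enc_fin_injective enc_fin_injective)
      (fun p : Fin (m.len q) × Fin q => truth (m.code q p.2 p.1))
      (g := fun _ (p : ℕ × ℕ) => (Fin.ofNat (m.len q) p.1, Fin.ofNat q p.2)) inferInstance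
  unfold AutNet.circuitPat
  infer_instance

theorem L.circuitBlk : L fun w (r : ℕ) => circuitBlk m q (readInputs w) r := by
  unfold AutNet.circuitBlk
  infer_instance

end

namespace Circuit.Codes

variable {m : AlphabetCoding} {q : ℕ} {Q : Polynomial ℕ} {C : Circuit} {F : Network q}
  (hC : C.Codes m F)

theorem inputs_eq (hC : C.Codes m F) : C.inputs = C.outputs.length := hC.1.trans hC.2.1.symm

theorem readInputs_encode (hC : C.Codes m F) : readInputs C.encode = m.len q * F.1 :=
  (C.readInputs_encode hC.inputs_eq).trans hC.1

theorem valid (hC : C.Codes m F) (hs : C.size ≤ Q.eval F.1) (hF : 0 < F.1) :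
    (circuitProgram m q Q C.encode).Valid := by
  have hK := hC.readInputs_encode
  have hk := m.len_pos q
  have hi := hC.1
  have hd : readInputs C.encode / m.len q = F.1 := by rw [hK, Nat.mul_div_cancel_left _ hk]
  have hG := C.readGates_encode
  constructor
  · change 0 < readInputs C.encode
    rw [hK]
    exact Nat.mul_pos hk hF
  · change readInputs C.encode + readGates C.encode ≤ Q.eval (readInputs C.encode / m.len q)
    rw [hd, hK, hG, ← hi]
    exact hs
  · intro t ht
    change readArg1 C.encode t ≤ readInputs C.encode + t
    have ht : t < C.gates.length := hG ▸ ht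
    rw [(C.read_gate hC.inputs_eq ht).2.2.1, hK, ← hi]
    have := C.gates_below t ht
    revert this
    cases C.gates[t] <;> simp only [Gate.Below, Gate.arg1] <;> omega
  · intro t ht
    change readArg2 C.encode t ≤ readInputs C.encode + t
    have ht : t < C.gates.length := hG ▸ ht
    rw [(C.read_gate hC.inputs_eq ht).2.2.2, hK, ← hi]
    have := C.gates_below t ht
    revert this
    cases C.gates[t] <;> simp only [Gate.Below, Gate.arg2] <;> omega
  · intro r hr
    change readOut C.encode r < readInputs C.encode + readGates C.encode
    have hr : r < C.outputs.length := by rw [hC.2.1, ← hK]; exact hr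
    rw [C.readOut_encode hC.inputs_eq r hr, hK, hG, ← hi]
    exact C.outputs_below _ (List.getElem_mem hr)

theorem computes (hC : C.Codes m F) (x : Fin F.1 → Fin q) :
    (circuitProgram m q Q C.encode).Computes (C.val (m.word x)) := by
  intro t ht y1 y2 h1 h2
  have hK : (circuitProgram m q Q C.encode).K = C.inputs := C.readInputs_encode hC.inputs_eq
  have ht : t < C.gates.length := C.readGates_encode ▸ ht
  have hlen : (m.word x).length = C.inputs := by rw [m.length_word, hC.1, mul_comm]
  obtain ⟨e1, e2, e3, e4⟩ := C.read_gate hC.inputs_eq ht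
  change (circuitProgram m q Q C.encode).op1 t = _ at e1
  change (circuitProgram m q Q C.encode).op2 t = _ at e2
  change (circuitProgram m q Q C.encode).arg1 t = _ at e3
  change (circuitProgram m q Q C.encode).arg2 t = _ at e4
  rw [hK] at h1 h2 ⊢
  rw [C.val_gate _ hlen ht, e1, e2]
  rw [e3] at h1
  rw [e4] at h2
  have hb := C.gates_below t ht
  revert h1 h2 hb
  cases C.gates[t] with
  | const b => intro _ _ _; cases b <;> rfl
  | not i =>
    intro _ h1 hb
    rw [h1 hb]
    change applyOp 0 (applyOp 2 1 (truth (C.val (m.word x) i))) y2 =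
      truth (!C.val (m.word x) i)
    cases C.val (m.word x) i <;> rfl
  | and i j =>
    intro h2 h1 hb
    rw [h1 hb.1, h2 hb.2]
    change applyOp 5 (applyOp 1 1 (truth (C.val (m.word x) i))) (truth (C.val (m.word x) j)) =
      truth (C.val (m.word x) i && C.val (m.word x) j)
    cases C.val (m.word x) i <;> cases C.val (m.word x) j <;> rfl
  | or i j =>
    intro h2 h1 hb
    rw [h1 hb.1, h2 hb.2]
    change applyOp 6 (applyOp 1 1 (truth (C.val (m.word x) i))) (truth (C.val (m.word x) j)) =
      truth (C.val (m.word x) i || C.val (m.word x) j)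
    cases C.val (m.word x) i <;> cases C.val (m.word x) j <;> rfl

end Circuit.Codes

end AutNet

namespace AutNet

open Enc

/-! ### Composing embeddings -/

/-- The composition of two block embeddings. -/
def BlockEmbedding.comp {q n a k b l : ℕ} (E' : BlockEmbedding a k b l)
    (E : BlockEmbedding q n a k) : BlockEmbedding q n b l where
  block u := E.block (E'.block u)
  block_surjective := E.block_surjective.comp E'.block_surjective
  pat u s := E'.pat u (E.pat (E'.block u) s)
  inj i s s' h := E.inj i s s' fun v hv => E'.inj v _ _ fun u hu => by
    subst hu
    exact h u hv

theorem BlockEmbedding.comp_map {q n a k b l : ℕ} (E' : BlockEmbedding a k b l)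
    (E : BlockEmbedding q n a k) (x : Fin n → Fin q) : (E'.comp E).map x = E'.map (E.map x) := rfl

/-- The numbers that follow the word in the output of a simulation. -/
def simulationTokens {q n a k : ℕ} (t : ℕ) (E : BlockEmbedding q n a k) : List ℕ :=
  t :: n :: k :: (List.range k).flatMap fun u => if h : u < k then
    (E.block ⟨u, h⟩ : ℕ) :: (List.finRange q).map fun s => (E.pat ⟨u, h⟩ s : ℕ) else []

theorem simulationTokens_encode {q n a k : ℕ} (t : ℕ) (E : BlockEmbedding q n a k) :
    encNat t ++ E.encode = (simulationTokens t E).flatMap encNat := by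
  rw [simulationTokens, List.flatMap_cons, List.flatMap_cons, List.flatMap_cons,
    ← flatMap_finRange k fun u => (E.block u : ℕ) :: (List.finRange q).map fun s => (E.pat u s : ℕ),
    List.flatMap_assoc, BlockEmbedding.encode, List.append_assoc]
  congr 4
  funext u
  rw [List.flatMap_cons, List.flatMap_map]

theorem simulationTokens_get {q n a k : ℕ} (t : ℕ) (E : BlockEmbedding q n a k) (u : Fin k)
    {j : ℕ} (hj : j < q + 1) : (simulationTokens t E)[3 + u * (q + 1) + j]? =
      ((E.block u : ℕ) :: (List.finRange q).map fun s => (E.pat u s : ℕ))[j]? := by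
  rw [simulationTokens, show 3 + (u : ℕ) * (q + 1) + j = (u * (q + 1) + j) + 1 + 1 + 1 by ring]
  simp only [List.getElem?_cons_succ]
  have h := getElem?_flatMap_range_add (fun u => if h : u < k then
    (E.block ⟨u, h⟩ : ℕ) :: (List.finRange q).map fun s => (E.pat ⟨u, h⟩ s : ℕ) else []) u.isLt
    (k := j) (by simpa using hj)
  rw [Finset.sum_congr rfl (g := fun _ => q + 1), Finset.sum_const, Finset.card_range,
    smul_eq_mul] at h
  · rw [h, dif_pos u.isLt]
  · intro v hv
    have : v < k := (Finset.mem_range.1 hv).trans u.isLt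
    simp [this]

/-- The number with index `i` after the word at the beginning. -/
noncomputable def simTok (B : ℕ) (z : List Bool) (i : ℕ) : ℕ := tok z (z.length + B) (skip z 0) i

theorem simTok_eq {q n a k : ℕ} {w' z : List Bool} (t : ℕ) (E : BlockEmbedding q n a k)
    (hz : z = encWord w' ++ encNat t ++ E.encode) {i x B : ℕ}
    (hi : (simulationTokens t E)[i]? = some x) (hx : x < z.length + B) :
    simTok B z i = x := by
  obtain ⟨hi', rfl⟩ := List.getElem?_eq_some_iff.1 hi
  have h1 := skip_eq [] w' (encNat t ++ E.encode)
  have h2 := tok_eq (encWord w') [] (simulationTokens t E) hi' hx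
  rw [← simulationTokens_encode, List.append_nil, ← List.append_assoc, ← hz] at h2
  rw [List.nil_append, ← List.append_assoc, ← hz] at h1
  rw [simTok]
  change skip z 0 = _ at h1
  rw [h1]
  exact h2

theorem nodes_le_length {q n a k : ℕ} {w' z : List Bool} (t : ℕ) (E : BlockEmbedding q n a k)
    (hz : z = encWord w' ++ encNat t ++ E.encode) : k + 3 ≤ z.length := by
  have h1 := length_le_flatMap_encNat (simulationTokens t E)
  rw [← simulationTokens_encode] at h1
  have h2 : k + 3 ≤ (simulationTokens t E).length := by
    rw [simulationTokens, List.length_cons, List.length_cons, List.length_cons]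
    have : k ≤ ((List.range k).flatMap fun u => if h : u < k then
      (E.block ⟨u, h⟩ : ℕ) :: (List.finRange q).map fun s => (E.pat ⟨u, h⟩ s : ℕ)
        else []).length := by
      rw [List.length_flatMap]
      have h3 : (List.map (fun u => (if h : u < k then
        (E.block ⟨u, h⟩ : ℕ) :: (List.finRange q).map fun s => (E.pat ⟨u, h⟩ s : ℕ)
          else []).length) (List.range k)) = (List.range k).map fun _ => q + 1 := by
        apply List.map_congr_left
        intro u hu
        simp [List.mem_range.1 hu]
      rw [h3]
      simp only [List.map_const', List.length_range, List.sum_replicate, smul_eq_mul]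
      nlinarith
    omega
  rw [hz, List.append_assoc, List.length_append]
  omega

theorem LO.subst {α : Type} [Enc α] {f : List Bool → α → List Bool} (hf : LO f)
    {G : List Bool → List Bool} (hG : LO fun w (_ : ℕ) => G w) : LO fun w a => f (G w) a :=
  ⟨L.subst hf.length hG, L.subst hf.sym hG⟩

instance L.simTokOf {α : Type} [Enc α] (B : ℕ) (i : List Bool → α → ℕ) [hi : L i] :
    L fun z a => simTok B z (i z a) := by
  unfold simTok
  infer_instance

attribute [irreducible] simTok

/-! ### From strong universality to universality -/

section

variable (m : AlphabetCoding) (q : ℕ) (Q : Polynomial ℕ) (a t : ℕ) [NeZero q] [NeZero (m.len q)]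

/-- The output of the composed simulation, where `z` is the output of the simulation of the
network that evaluates the circuit. -/
noncomputable def composedWord (w z : List Bool) : List Bool :=
  z.take (skip z 0) ++
    encNat (t * (3 * (circuitProgram m q Q w).P + 3 * (circuitProgram m q Q w).K)) ++
    (encNat (readInputs w / m.len q) ++ encNat (simTok (a + 1) z 2) ++
      (List.range (simTok (a + 1) z 2)).flatMap fun u =>
        encNat (circuitBlk m q (readInputs w) (simTok (a + 1) z (3 + u * (3 + 1) + 0) %
          ((circuitProgram m q Q w).P + (circuitProgram m q Q w).K))) ++
        (List.range q).flatMap fun s =>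
          encNat (simTok (a + 1) z (3 + u * (3 + 1) + ((if
            simTok (a + 1) z (3 + u * (3 + 1) + 0) /
              ((circuitProgram m q Q w).P + (circuitProgram m q Q w).K) = 0 then
            circuitPat m q (readInputs w) (simTok (a + 1) z (3 + u * (3 + 1) + 0) %
              ((circuitProgram m q Q w).P + (circuitProgram m q Q w).K)) s else 0) + 1))))

theorem LO.composedWord {Z : List Bool → List Bool} (hZ : LO fun w (_ : ℕ) => Z w) :
    LO fun w (_ : ℕ) => composedWord m q Q a t w (Z w) := by
  have h1 : LO fun w (_ : ℕ) => (Z w).take (skip (Z w) 0) := by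
    have : LO fun z (_ : ℕ) => z.take (skip z 0) := inferInstance
    exact this.subst hZ
  have h2 : ∀ {α : Type} [Enc α], L fun w (_ : α) => simTok (a + 1) (Z w) 2 := by
    intro α _
    have : L fun z (_ : α) => simTok (a + 1) z 2 := inferInstance
    exact this.subst hZ
  have h3 : L fun w (i : ℕ) => simTok (a + 1) (Z w) i := by
    have : L fun z (i : ℕ) => simTok (a + 1) z i := L.simTokOf (a + 1) fun _ i => i
    exact this.subst hZ
  have h4 : L fun w (p : ℕ × ℕ) => simTok (a + 1) (Z w) (3 + p.2 * (3 + 1) + 0) :=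
    h3.comp (g := fun _ (p : ℕ × ℕ) => 3 + p.2 * (3 + 1) + 0) inferInstance
  have h5 : L fun w (p : (ℕ × ℕ) × ℕ) => simTok (a + 1) (Z w) (3 + p.1.2 * (3 + 1) + 0) :=
    h3.comp (g := fun _ (p : (ℕ × ℕ) × ℕ) => 3 + p.1.2 * (3 + 1) + 0) inferInstance
  have h6 : L fun w (p : ℕ × ℕ) => circuitBlk m q (readInputs w)
      (simTok (a + 1) (Z w) (3 + p.2 * (3 + 1) + 0) %
        ((circuitProgram m q Q w).P + (circuitProgram m q Q w).K)) :=
    (L.circuitBlk m q).comp (g := fun w (p : ℕ × ℕ) =>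
      simTok (a + 1) (Z w) (3 + p.2 * (3 + 1) + 0) %
        ((circuitProgram m q Q w).P + (circuitProgram m q Q w).K)) inferInstance
  have h7 : L fun w (p : (ℕ × ℕ) × ℕ) => circuitPat m q (readInputs w)
      (simTok (a + 1) (Z w) (3 + p.1.2 * (3 + 1) + 0) %
        ((circuitProgram m q Q w).P + (circuitProgram m q Q w).K)) p.2 :=
    (L.circuitPat m q).comp (g := fun w (p : (ℕ × ℕ) × ℕ) =>
      (simTok (a + 1) (Z w) (3 + p.1.2 * (3 + 1) + 0) %
        ((circuitProgram m q Q w).P + (circuitProgram m q Q w).K), p.2)) inferInstance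
  have h8 : L fun w (p : (ℕ × ℕ) × ℕ) => simTok (a + 1) (Z w) (3 + p.1.2 * (3 + 1) + ((if
      simTok (a + 1) (Z w) (3 + p.1.2 * (3 + 1) + 0) /
        ((circuitProgram m q Q w).P + (circuitProgram m q Q w).K) = 0 then
      circuitPat m q (readInputs w) (simTok (a + 1) (Z w) (3 + p.1.2 * (3 + 1) + 0) %
        ((circuitProgram m q Q w).P + (circuitProgram m q Q w).K)) p.2 else 0) + 1)) :=
    h3.comp inferInstance
  unfold AutNet.composedWord
  infer_instance

end

namespace Circuit.Codes

variable {m : AlphabetCoding} {q : ℕ} {Q : Polynomial ℕ} {C : Circuit} {F : Network q}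
  [NeZero q] [NeZero (m.len q)]

/-- The embedding into the network that evaluates a circuit. -/
noncomputable def embedding (hC : C.Codes m F) (hs : C.size ≤ Q.eval F.1) (hF : 0 < F.1) :
    (hC.valid hs hF).layered.Embedding q F.1 where
  blk := circuitBlk m q (readInputs C.encode)
  pat := circuitPat m q (readInputs C.encode)
  pos := by norm_num
  blk_lt r _ := by
    unfold circuitBlk
    split
    · next h => exact Nat.div_lt_of_lt_mul (hC.readInputs_encode ▸ h)
    · exact hF
  pat_lt r _ s _ := by
    unfold circuitPat truth
    split
    · have := Bool.toNat_lt (m.code q (Fin.ofNat q s) (Fin.ofNat (m.len q) r)); omega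
    · norm_num
  surj i hi := by
    have hk := m.len_pos q
    have hr : i * m.len q < readInputs C.encode := by
      rw [hC.readInputs_encode, mul_comm]
      exact Nat.mul_lt_mul_of_pos_left hi hk
    refine ⟨i * m.len q, lt_of_lt_of_le hr (Nat.le_add_left _ _), ?_⟩
    rw [circuitBlk, if_pos hr, Nat.mul_div_cancel _ hk]
  inj i hi s hs s' hs' h := by
    have hk := m.len_pos q
    have key : m.code q (Fin.ofNat q s) = m.code q (Fin.ofNat q s') := by
      funext j
      have hr : i * m.len q + j < readInputs C.encode := by
        rw [hC.readInputs_encode, mul_comm (m.len q)]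
        exact lt_of_lt_of_le (Nat.add_lt_add_left j.isLt _)
          (by rw [← Nat.succ_mul]; exact Nat.mul_le_mul_right _ hi)
      have hd : (i * m.len q + j) / m.len q = i := by
        rw [mul_comm, Nat.mul_add_div hk, Nat.div_eq_of_lt j.isLt, add_zero]
      have hm : Fin.ofNat (m.len q) (i * m.len q + j) = j := by
        apply Fin.ext
        rw [Fin.val_ofNat, Nat.mul_add_mod_self_right, Nat.mod_eq_of_lt j.isLt]
      have h1 := h _ (lt_of_lt_of_le hr (Nat.le_add_left _ _)) (by rw [circuitBlk, if_pos hr, hd])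
      rw [circuitPat, circuitPat, if_pos hr, if_pos hr, hm, truth, truth] at h1
      have h2 : ∀ b b' : Bool, b.toNat + 1 = b'.toNat + 1 → b = b' := by decide
      exact h2 _ _ h1
    have h2 := congrArg Fin.val (m.code_injective q key)
    simp only [Fin.val_ofNat, Nat.mod_eq_of_lt hs, Nat.mod_eq_of_lt hs'] at h2
    exact h2

theorem simulates (hC : C.Codes m F) (hs : C.size ≤ Q.eval F.1) (hF : 0 < F.1)
    (x : Fin F.1 → Fin q) :
    (hC.embedding hs hF).toBlock.map (F.2 x) =
      (hC.valid hs hF).layered.maps.net^[(hC.valid hs hF).layered.T]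
        ((hC.embedding hs hF).toBlock.map x) := by
  refine (hC.embedding hs hF).simulates x fun z hz r hr => ?_
  have hK := hC.readInputs_encode
  have hlen : (m.word x).length = C.inputs := by rw [m.length_word, hC.1, mul_comm]
  have hpat : ∀ (y : Fin F.1 → Fin q) r h, (hC.embedding hs hF).pat r
      (y ⟨(hC.embedding hs hF).blk r, h⟩) = truth (decide (r < readInputs C.encode) &&
        (m.word y).getD r false) := by
    intro y r h
    change circuitPat m q (readInputs C.encode) r _ = _
    rw [circuitPat]
    split
    · next h1 =>
      have h2 : r / m.len q < F.1 := Nat.div_lt_of_lt_mul (hK ▸ h1)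
      have h3 : (⟨(hC.embedding hs hF).blk r, h⟩ : Fin F.1) = ⟨r / m.len q, h2⟩ :=
        Fin.ext (if_pos h1)
      rw [m.getD_word y h2, h3, Fin.ofNat_val_eq_self, decide_eq_true h1]
      rfl
    · next h1 => rw [decide_eq_false h1]; rfl
  have hfin := (hC.valid hs hF).state_final (hC.computes (Q := Q) x) (z := z) (fun r hr => by
    rw [hz r hr, hpat]
    change _ = truth (decide (r < readInputs C.encode) && _)
    by_cases h : r < readInputs C.encode
    · rw [C.val_input _ hlen (by rw [hC.1, ← hK]; exact h)]
    · rw [decide_eq_false h]; rfl) hr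
  rw [hpat]
  refine hfin.trans ?_
  change truth (decide (r < readInputs C.encode) && C.val _ (readOut C.encode r)) = _
  by_cases h : r < readInputs C.encode
  · have h1 : r < C.outputs.length := by rw [hC.2.1, ← hK]; exact h
    rw [← hC.2.2 x, C.eval_eq, C.readOut_encode hC.inputs_eq r h1, List.getD_eq_getElem?_getD,
      List.getElem?_map, List.getElem?_eq_getElem h1]
    rfl
  · rw [decide_eq_false h]; rfl

end Circuit.Codes

/-- Every strongly universal family is universal. -/
theorem StronglyUniversal.universal (m : AlphabetCoding) {a : ℕ} {A : Family a}
    (hA : StronglyUniversal A) : Universal m A := by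
  intro q hq Q
  have : NeZero q := ⟨by omega⟩
  have : NeZero (m.len q) := ⟨(m.len_pos q).ne'⟩
  obtain ⟨t, c, M, hM, hsim⟩ := hA 3 (by norm_num) 4 (by norm_num)
  let T₀ : Polynomial ℕ := 3 * Q + 3 * (Polynomial.C (m.len q) * Polynomial.X)
  let W₀ : Polynomial ℕ := Q + Polynomial.C (m.len q) * Polynomial.X
  have hT₀ : ∀ n, T₀.eval n = 3 * Q.eval n + 3 * (m.len q * n) := fun n => by simp [T₀]
  have hW₀ : ∀ n, W₀.eval n = Q.eval n + m.len q * n := fun n => by simp [W₀]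
  refine ⟨Polynomial.C t * T₀, Polynomial.C c * (T₀ * W₀),
    fun w => composedWord m q Q a t w (M (circuitWord m q Q w)), ?_, ?_⟩
  · apply LO.logspaceComputable
    apply LO.composedWord
    exact hM.isLO.subst (LO.circuitWord m q Q)
  · rintro w F ⟨C, rfl, hC, hs⟩ hF
    have hV := hC.valid hs hF
    let D := hV.layered
    let E := (hC.embedding hs hF).toBlock
    have hw : circuitWord m q Q C.encode = D.maps.encode := (Layered.maps_encode D).symm
    have hK : (circuitProgram m q Q C.encode).K = m.len q * F.1 := hC.readInputs_encode
    have hP : (circuitProgram m q Q C.encode).P = Q.eval F.1 := by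
      change Q.eval (readInputs C.encode / m.len q) = _
      rw [hC.readInputs_encode, Nat.mul_div_cancel_left _ (m.len_pos q)]
    have hDT : D.T = T₀.eval F.1 := by
      change 3 * (circuitProgram m q Q C.encode).P + 3 * (circuitProgram m q Q C.encode).K = _
      rw [hK, hP, hT₀]
    have hDW : D.W = W₀.eval F.1 := by
      change (circuitProgram m q Q C.encode).P + (circuitProgram m q Q C.encode).K = _
      rw [hK, hP, hW₀]
    have hpos : 0 < D.T * D.W := by
      refine Nat.mul_pos D.T_pos ?_
      change 0 < (circuitProgram m q Q C.encode).P + (circuitProgram m q Q C.encode).K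
      have := hV.K_pos
      omega
    obtain ⟨w', G, E', hMw, hrep, hG, hE'⟩ := hsim D.maps.encode ⟨_, D.maps.net⟩
      ⟨D.maps, rfl, rfl, D.degreeAtMost⟩ hpos
    have hE'' : Function.Semiconj E'.map D.maps.net (G.2^[t]) := hE'
    refine ⟨w', G, E'.comp E, ?_, hrep, ?_, ?_⟩
    · rw [← hw] at hMw
      set z := M (circuitWord m q Q C.encode) with hz
      have hlen := nodes_le_length t E' hMw
      have h1 : z.take (skip z 0) = encWord w' := by
        have h := skip_eq [] w' (encNat t ++ E'.encode)
        rw [List.nil_append, ← List.append_assoc, ← hMw] at h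
        change skip z 0 = _ at h
        rw [h, hMw, List.append_assoc, List.take_left]
      have h2 : simTok (a + 1) z 2 = G.1 := simTok_eq t E' hMw rfl (by omega)
      have h3 : ∀ u : Fin G.1, simTok (a + 1) z (3 + u * (3 + 1) + 0) = E'.block u := by
        intro u
        refine simTok_eq t E' hMw (simulationTokens_get t E' u (by norm_num)) ?_
        have := E'.block_surjective
        have h4 : D.T * D.W ≤ G.1 := by simpa using Fintype.card_le_of_surjective _ this
        have h5 : (E'.block u : ℕ) < D.T * D.W := (E'.block u).isLt
        omega
      have h4 : ∀ (u : Fin G.1) (s : Fin 3),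
          simTok (a + 1) z (3 + u * (3 + 1) + (s + 1)) = E'.pat u s := by
        intro u s
        refine simTok_eq t E' hMw ((simulationTokens_get t E' u (j := s + 1) (by omega)).trans ?_) ?_
        · simp
        · have := (E'.pat u s).isLt
          omega
      beta_reduce
      rw [composedWord, h1, h2, Polynomial.eval_mul, Polynomial.eval_C, ← hDT, BlockEmbedding.encode]
      have h5 : readInputs C.encode / m.len q = F.1 := by
        rw [hC.readInputs_encode, Nat.mul_div_cancel_left _ (m.len_pos q)]
      rw [h5]
      congr 2
      symm
      apply flatMap_finRange_of_val
      intro u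
      rw [h3]
      congr 1
      apply flatMap_finRange_of_val
      intro s
      exact congrArg encNat (h4 u (E.pat (E'.block u) s)).symm
    · rw [hG]
      change c * (D.T * D.W) = (Polynomial.C c * (T₀ * W₀)).eval F.1
      rw [Polynomial.eval_mul, Polynomial.eval_C, Polynomial.eval_mul, ← hDT, ← hDW]
    · intro x
      rw [BlockEmbedding.comp_map, BlockEmbedding.comp_map, hC.simulates hs hF]
      beta_reduce
      rw [Polynomial.eval_mul, Polynomial.eval_C, ← hDT, Function.iterate_mul]
      exact hE''.iterate_right _ _

end AutNet

namespace AutNet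

open Enc

/-! ### Representations of networks of monotone gates -/

theorem exists_localMaps {F : Network 2} (hF : IsGateNetwork monotoneGates F) :
    ∃ R : LocalMaps 2 F.1, R.net = F.2 ∧ DegreeAtMost 4 R.Edge := by
  obtain ⟨N, g, α, β, hg, -, hmap⟩ := hF
  have hins : ∀ j, (g j).ins ≤ 2 := by
    intro j
    obtain ⟨i, o, hi, ho, h | h⟩ := hg j <;> rw [h] <;> change i ≤ 2 <;> omega
  have houts : ∀ j, (g j).outs ≤ 2 := by
    intro j
    obtain ⟨i, o, hi, ho, h | h⟩ := hg j <;> rw [h] <;> change o ≤ 2 <;> omega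
  let R : LocalMaps 2 F.1 :=
    { nbr := fun v => List.ofFn fun k => α ⟨(β v).1, k⟩
      nodup := fun v => List.nodup_ofFn.2 fun k k' h => by simpa using α.injective h
      loc := fun v y => (g (β v).1).map (fun k => y (Fin.cast List.length_ofFn.symm k)) (β v).2 }
  have hmem : ∀ u v, R.Edge u v ↔ ∃ k, α ⟨(β v).1, k⟩ = u := fun u v => List.mem_ofFn
  refine ⟨R, ?_, fun v => ?_⟩
  · funext x v
    rw [hmap x v]
    change (g (β v).1).map _ _ = _
    congr 1
    funext k
    exact congrArg x (List.get_ofFn _ _)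
  · have h1 : {u | R.Edge u v}.ncard ≤ 2 := by
      have hs : {u | R.Edge u v} = Set.range fun k => α ⟨(β v).1, k⟩ := by
        ext u; exact hmem u v
      rw [hs, ← Nat.card_coe_set_eq]
      refine (Finite.card_range_le _).trans ?_
      rw [Nat.card_fin]
      exact hins _
    have h2 : {u | R.Edge v u}.ncard ≤ 2 := by
      have hs : {u | R.Edge v u} ⊆ Set.range fun o => β.symm ⟨(α.symm v).1, o⟩ := by
        intro u hu
        obtain ⟨k, rfl⟩ := (hmem v u).1 hu
        rw [Equiv.symm_apply_apply]
        exact ⟨(β u).2, β.symm_apply_apply u⟩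
      refine (Set.ncard_le_ncard hs (Set.toFinite _)).trans ?_
      rw [← Nat.card_coe_set_eq]
      refine (Finite.card_range_le _).trans ?_
      rw [Nat.card_fin]
      exact houts _
    omega

/-! ### Circuits for local maps with at most four arguments -/

/-- The gate of a given kind. -/
def Gate.mk (kind i j : ℕ) : Gate :=
  if kind = 0 then const false else if kind = 1 then const true else if kind = 2 then not i
  else if kind = 3 then and i j else or i j

theorem Gate.mk_below {kind i j M : ℕ} (h : 2 ≤ kind → i < M ∧ j < M) :
    (Gate.mk kind i j).Below M := by
  unfold Gate.mk
  split_ifs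
  · trivial
  · trivial
  · exact (h (by omega)).1
  · exact h (by omega)
  · exact h (by omega)

instance LO.gateMk {α : Type} [Enc α] (kind i j : List Bool → α → ℕ) [hk : L kind] [hi : L i]
    [hj : L j] : LO fun w a => (Gate.mk (kind w a) (i w a) (j w a)).encode := by
  have : LO fun w a => if kind w a = 0 then [false] ++ ([false] ++ [false])
      else if kind w a = 1 then [false] ++ ([false] ++ [true])
      else if kind w a = 2 then [false] ++ [true] ++ AutNet.encNat (i w a)
      else if kind w a = 3 then [true] ++ [false] ++ AutNet.encNat (i w a) ++ AutNet.encNat (j w a)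
      else [true] ++ [true] ++ AutNet.encNat (i w a) ++ AutNet.encNat (j w a) := inferInstance
  convert this using 3 with w a
  unfold Gate.mk
  split_ifs <;> rfl

section

variable (k js : ℕ) (c1 : Bool) (okind : ℕ → ℕ) (n : ℕ) (deg : ℕ → ℕ) (nbr loc : ℕ → ℕ → ℕ)

/-- The kind of a gate of the circuit for local maps. The first `2 * n` gates compute the state of
each node and its negation; then `96` gates for each node evaluate the transition table, six for
each row; then come the gates for the output bits. -/
def mapsKind (t : ℕ) : ℕ :=
  if t < 2 * n then if (t + c1.toNat) % 2 = 1 then 3 else 2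
  else if t < 98 * n then
    if (t - 2 * n) % 6 = 0 then
      if (t - 2 * n) / 6 % 16 < min (2 ^ deg ((t - 2 * n) / 96)) 16 ∧
        loc ((t - 2 * n) / 96) ((t - 2 * n) / 6 % 16) = 1 then 1 else 0
    else if (t - 2 * n) % 6 = 5 then 4 else 3
  else okind (t - 98 * n)

/-- The first operand of a gate. -/
def mapsFst (t : ℕ) : ℕ :=
  if t < 2 * n then t / 2 * k + js
  else if t < 98 * n then k * n + t - 1
  else k * n + 2 * n + 96 * ((t - 98 * n) / k) + 95

/-- The second operand of a gate. -/
def mapsSnd (t : ℕ) : ℕ :=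
  if t < 2 * n then t / 2 * k + js
  else if t < 98 * n then
    if (t - 2 * n) % 6 = 5 then
      if (t - 2 * n) / 6 % 16 = 0 then k * n + t - 1 else k * n + t - 6
    else if (t - 2 * n) % 6 - 1 < deg ((t - 2 * n) / 96) then
      k * n + 2 * nbr ((t - 2 * n) / 96) ((t - 2 * n) % 6 - 1) +
        (1 - (t - 2 * n) / 6 % 16 / min (2 ^ ((t - 2 * n) % 6 - 1)) 8 % 2)
    else k * n + t - 1
  else k * n + 2 * n + 96 * ((t - 98 * n) / k) + 95

def mapsGate (t : ℕ) : Gate :=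
  Gate.mk (mapsKind c1 okind n deg loc t) (mapsFst k js n t) (mapsSnd k js n deg nbr t)

/-- The encoding of the circuit for local maps. -/
def mapsWord : List Bool :=
  encNat (k * n) ++ encNat (98 * n + k * n) ++
    (List.range (98 * n + k * n)).flatMap
      (fun t => (mapsGate k js c1 okind n deg nbr loc t).encode) ++
    encNat (k * n) ++ (List.range (k * n)).flatMap fun r => encNat (k * n + 98 * n + r)

variable {k js c1 okind n deg nbr loc}

/-- The circuit for local maps. -/
def mapsCircuit (_hk : js < k) (hnbr : ∀ v < n, ∀ i < deg v, nbr v i < n) : Circuit where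
  inputs := k * n
  gates := (List.range (98 * n + k * n)).map (mapsGate k js c1 okind n deg nbr loc)
  outputs := (List.range (k * n)).map fun r => k * n + 98 * n + r
  gates_below t ht := by
    rw [List.length_map, List.length_range] at ht
    rw [List.getElem_map, List.getElem_range]
    refine Gate.mk_below fun hkind => ?_
    unfold mapsFst mapsSnd
    unfold mapsKind at hkind
    by_cases h1 : t < 2 * n
    · rw [if_pos h1, if_pos h1, and_self]
      have h2 : t / 2 * k + js < k * n := by
        have h3 : t / 2 + 1 ≤ n := by omega
        calc t / 2 * k + js < t / 2 * k + k := by omega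
          _ = (t / 2 + 1) * k := by ring
          _ ≤ n * k := Nat.mul_le_mul_right _ h3
          _ = k * n := mul_comm _ _
      omega
    · rw [if_neg h1, if_neg h1]
      rw [if_neg h1] at hkind
      by_cases h2 : t < 98 * n
      · rw [if_pos h2, if_pos h2]
        rw [if_pos h2] at hkind
        by_cases h3 : (t - 2 * n) % 6 = 0
        · rw [if_pos h3] at hkind
          split_ifs at hkind <;> omega
        · have h4 := hnbr ((t - 2 * n) / 96) (by omega) ((t - 2 * n) % 6 - 1)
          refine ⟨by omega, ?_⟩
          split_ifs with h5 h6 h7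
          · omega
          · omega
          · have := h4 h7; omega
          · omega
      · rw [if_neg h2, if_neg h2, and_self]
        have h3 : (t - 98 * n) / k < n := Nat.div_lt_of_lt_mul (by omega)
        omega
  outputs_below i hi := by
    obtain ⟨r, hr, rfl⟩ := List.mem_map.1 hi
    have := List.mem_range.1 hr
    rw [List.length_map, List.length_range]
    omega

theorem mapsCircuit_encode (hk : js < k) (hnbr : ∀ v < n, ∀ i < deg v, nbr v i < n) :
    (mapsCircuit (c1 := c1) (okind := okind) (loc := loc) hk hnbr).encode =
      mapsWord k js c1 okind n deg nbr loc := by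
  simp only [Circuit.encode, mapsCircuit, mapsWord, List.length_map, List.length_range,
    List.flatMap_map]

theorem mapsCircuit_val (hk : js < k) (hnbr : ∀ v < n, ∀ i < deg v, nbr v i < n) {X : List Bool}
    {V : ℕ → Bool}
    (hV : V = (mapsCircuit (c1 := c1) (okind := okind) (loc := loc) hk hnbr).val X)
    (hX : X.length = k * n) {t : ℕ} (ht : t < 98 * n + k * n) {kind i j : ℕ}
    (h1 : mapsKind c1 okind n deg loc t = kind) (h2 : mapsFst k js n t = i)
    (h3 : mapsSnd k js n deg nbr t = j) :
    V (k * n + t) = if kind = 0 then false else if kind = 1 then true else if kind = 2 then !V i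
      else if kind = 3 then V i && V j else V i || V j := by
  subst h1 h2 h3
  have h := (mapsCircuit (c1 := c1) (okind := okind) (loc := loc) hk hnbr).val_gate X hX
    (t := t) (by rwa [mapsCircuit, List.length_map, List.length_range])
  rw [hV]
  refine h.trans ?_
  have e : (mapsCircuit (c1 := c1) (okind := okind) (loc := loc) hk hnbr).gates[t]'(by
      rwa [mapsCircuit, List.length_map, List.length_range]) =
        mapsGate k js c1 okind n deg nbr loc t := by
    simp only [mapsCircuit, List.getElem_map, List.getElem_range]
  rw [e, mapsGate, Gate.mk]
  split_ifs <;> rfl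

/-- The row `i` of the table of `v` agrees with the states of the first `e` in-neighbours. -/
def RowMatches (deg : ℕ → ℕ) (nbr : ℕ → ℕ → ℕ) (y : ℕ → Bool) (v i e : ℕ) : Prop :=
  ∀ e' < e, e' < deg v → y (nbr v e') = decide (i / 2 ^ e' % 2 = 1)

/-- The row `i` of the table of `v` exists and has the value `1`. -/
def RowTrue (deg : ℕ → ℕ) (loc : ℕ → ℕ → ℕ) (v i : ℕ) : Prop := i < 2 ^ deg v ∧ loc v i = 1

theorem mapsCircuit_lit (hk : js < k) (hnbr : ∀ v < n, ∀ i < deg v, nbr v i < n)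
    {X : List Bool} {V : ℕ → Bool}
    (hV : V = (mapsCircuit (c1 := c1) (okind := okind) (loc := loc) hk hnbr).val X)
    (hX : X.length = k * n) {y : ℕ → Bool}
    (hy : ∀ v < n, X.getD (v * k + js) false = (y v == c1)) {v : ℕ} (hv : v < n) :
    V (k * n + 2 * v) = y v ∧ V (k * n + (2 * v + 1)) = !y v := by
  have h2 : v * k + js < k * n :=
    calc v * k + js < v * k + k := by omega
      _ = (v + 1) * k := by ring
      _ ≤ n * k := Nat.mul_le_mul_right _ hv
      _ = k * n := mul_comm _ _
  have h1 : V (v * k + js) = (y v == c1) := by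
    rw [hV, ← hy v hv]
    exact Circuit.val_input _ _ hX h2
  constructor
  · rw [mapsCircuit_val hk hnbr hV hX (t := 2 * v) (by omega) (i := v * k + js) (j := v * k + js)
      (if_pos (by omega)) (by rw [mapsFst, if_pos (by omega)]; congr 2; omega)
      (by rw [mapsSnd, if_pos (by omega)]; congr 2; omega), h1]
    cases c1 <;> cases y v <;> simp
  · rw [mapsCircuit_val hk hnbr hV hX (t := 2 * v + 1) (by omega) (i := v * k + js)
      (j := v * k + js) (if_pos (by omega)) (by rw [mapsFst, if_pos (by omega)]; congr 2; omega)
      (by rw [mapsSnd, if_pos (by omega)]; congr 2; omega), h1]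
    have e1 : (2 * v + 1 + 1) % 2 = 0 := by omega
    cases c1 <;> cases y v <;> simp [e1]

open Classical in
theorem mapsCircuit_row (hk : js < k) (hnbr : ∀ v < n, ∀ i < deg v, nbr v i < n)
    (hdeg : ∀ v < n, deg v ≤ 4) {X : List Bool} {V : ℕ → Bool}
    (hV : V = (mapsCircuit (c1 := c1) (okind := okind) (loc := loc) hk hnbr).val X)
    (hX : X.length = k * n) {y : ℕ → Bool}
    (hy : ∀ v < n, X.getD (v * k + js) false = (y v == c1)) {v i e : ℕ} (hv : v < n) (hi : i < 16)
    (he : e ≤ 4) :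
    V (k * n + (2 * n + 96 * v + 6 * i + e)) =
      decide (RowTrue deg loc v i ∧ RowMatches deg nbr y v i e) := by
  induction e with
  | zero =>
    have h1 : RowMatches deg nbr y v i 0 := fun _ h => absurd h (Nat.not_lt_zero _)
    have h3 : (2 : ℕ) ^ deg v ≤ 16 := Nat.pow_le_pow_right (by norm_num) (hdeg v hv)
    have h2 : mapsKind c1 okind n deg loc (2 * n + 96 * v + 6 * i + 0) =
        if RowTrue deg loc v i then 1 else 0 := by
      rw [mapsKind, if_neg (by omega), if_pos (by omega), if_pos (by omega),
        show (2 * n + 96 * v + 6 * i + 0 - 2 * n) / 6 % 16 = i by omega,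
        show (2 * n + 96 * v + 6 * i + 0 - 2 * n) / 96 = v by omega, min_eq_left h3]
      exact if_congr Iff.rfl rfl rfl
    rw [mapsCircuit_val hk hnbr hV hX (by omega) h2 rfl rfl]
    by_cases h : RowTrue deg loc v i <;> simp [h, h1]
  | succ e ih =>
    have ih := ih (by omega)
    have hpow : (2 : ℕ) ^ e ≤ 8 := (Nat.pow_le_pow_right (by norm_num) (show e ≤ 3 by omega))
    rw [mapsCircuit_val hk hnbr hV hX (kind := 3) (t := 2 * n + 96 * v + 6 * i + (e + 1)) (by omega)
      (by rw [mapsKind, if_neg (by omega), if_pos (by omega), if_neg (by omega),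
        if_neg (by omega)])
      (i := k * n + (2 * n + 96 * v + 6 * i + e))
      (by rw [mapsFst, if_neg (by omega), if_pos (by omega)]; omega)
      (j := if e < deg v then k * n + 2 * nbr v e + (1 - i / 2 ^ e % 2) else
        k * n + (2 * n + 96 * v + 6 * i + e))
      (by
        rw [mapsSnd, if_neg (by omega), if_pos (by omega), if_neg (by omega),
          show (2 * n + 96 * v + 6 * i + (e + 1) - 2 * n) / 6 % 16 = i by omega,
          show (2 * n + 96 * v + 6 * i + (e + 1) - 2 * n) / 96 = v by omega,
          show (2 * n + 96 * v + 6 * i + (e + 1) - 2 * n) % 6 - 1 = e by omega, min_eq_left hpow]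
        split
        · rfl
        · omega), ih]
    have hsucc : RowMatches deg nbr y v i (e + 1) ↔ RowMatches deg nbr y v i e ∧
        (e < deg v → y (nbr v e) = decide (i / 2 ^ e % 2 = 1)) := by
      constructor
      · exact fun h => ⟨fun e' he' => h e' (by omega), h e (by omega)⟩
      · rintro ⟨h, h'⟩ e' he' hd
        rcases Nat.lt_succ_iff_lt_or_eq.1 he' with h3 | rfl
        · exact h e' h3 hd
        · exact h' hd
    by_cases hd : e < deg v
    · obtain ⟨l1, l2⟩ := mapsCircuit_lit hk hnbr hV hX hy (hnbr v hv e hd)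
      have h4 : V (k * n + 2 * nbr v e + (1 - i / 2 ^ e % 2)) =
          decide (y (nbr v e) = decide (i / 2 ^ e % 2 = 1)) := by
        rcases Nat.mod_two_eq_zero_or_one (i / 2 ^ e) with h | h
        · rw [h, Nat.sub_zero, add_assoc, l2]
          cases y (nbr v e) <;> rfl
        · rw [h, Nat.sub_self, add_zero, l1]
          cases y (nbr v e) <;> rfl
      rw [if_pos hd, h4]
      simp only [hsucc, hd, forall_true_left]
      simp [Bool.and_assoc]
    · rw [if_neg hd, ih]
      simp only [hsucc, hd, false_imp_iff, and_true]
      simp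

open Classical in
theorem mapsCircuit_or (hk : js < k) (hnbr : ∀ v < n, ∀ i < deg v, nbr v i < n)
    (hdeg : ∀ v < n, deg v ≤ 4) {X : List Bool} {V : ℕ → Bool}
    (hV : V = (mapsCircuit (c1 := c1) (okind := okind) (loc := loc) hk hnbr).val X)
    (hX : X.length = k * n) {y : ℕ → Bool}
    (hy : ∀ v < n, X.getD (v * k + js) false = (y v == c1)) {v i : ℕ} (hv : v < n) (hi : i < 16) :
    V (k * n + (2 * n + 96 * v + 6 * i + 5)) =
      decide (∃ i' ≤ i, RowTrue deg loc v i' ∧ RowMatches deg nbr y v i' 4) := by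
  have hrow := mapsCircuit_row hk hnbr hdeg hV hX hy hv hi le_rfl
  have hkind : mapsKind c1 okind n deg loc (2 * n + 96 * v + 6 * i + 5) = 4 := by
    rw [mapsKind, if_neg (by omega), if_pos (by omega), if_neg (by omega), if_pos (by omega)]
  have hfst : mapsFst k js n (2 * n + 96 * v + 6 * i + 5) =
      k * n + (2 * n + 96 * v + 6 * i + 4) := by
    rw [mapsFst, if_neg (by omega), if_pos (by omega)]; omega
  induction i with
  | zero =>
    rw [mapsCircuit_val hk hnbr hV hX (by omega) hkind hfst
      (j := k * n + (2 * n + 96 * v + 6 * 0 + 4)) (by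
        rw [mapsSnd, if_neg (by omega), if_pos (by omega), if_pos (by omega), if_pos (by omega)]
        omega), hrow]
    simp
  | succ i ih =>
    have ih := ih (by omega) (mapsCircuit_row hk hnbr hdeg hV hX hy hv (by omega) le_rfl)
      (by rw [mapsKind, if_neg (by omega), if_pos (by omega), if_neg (by omega), if_pos (by omega)])
      (by rw [mapsFst, if_neg (by omega), if_pos (by omega)]; omega)
    rw [mapsCircuit_val hk hnbr hV hX (by omega) hkind hfst
      (j := k * n + (2 * n + 96 * v + 6 * i + 5)) (by
        rw [mapsSnd, if_neg (by omega), if_pos (by omega), if_pos (by omega), if_neg (by omega)]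
        omega), hrow, ih]
    simp only [Nat.reduceEqDiff, if_false]
    rw [← Bool.decide_or, decide_eq_decide]
    constructor
    · rintro (h | ⟨i', h, h'⟩)
      · exact ⟨i + 1, le_rfl, h⟩
      · exact ⟨i', by omega, h'⟩
    · rintro ⟨i', h, h'⟩
      rcases Nat.lt_or_ge i i' with h3 | h3
      · left
        rwa [show i + 1 = i' by omega]
      · exact .inr ⟨i', h3, h'⟩

end

end AutNet

namespace AutNet

open Enc

namespace LocalMaps

variable {n : ℕ} (R : LocalMaps 2 n)

theorem rowMatches_iff (hR : DegreeAtMost 4 R.Edge) {x : Fin n → Fin 2} {y : ℕ → Bool}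
    (hy : ∀ u : Fin n, y u = decide (x u = 1)) (v : Fin n) (i : Fin (2 ^ (R.nbr v).length)) :
    RowMatches (readDeg 2 4 R.encode) (readNbr 2 4 R.encode) y v i 4 ↔
      finFunctionFinEquiv.symm i = fun k => x ((R.nbr v).get k) := by
  have hle := R.length_nbr_le hR
  have h2 : ∀ (s : Fin 2) (b : ℕ), b < 2 → (decide (s = 1) = decide (b = 1) ↔ b = s.val) := by
    intro s b hb
    interval_cases b <;> fin_cases s <;> simp
  rw [funext_iff]
  have key : ∀ k : Fin (R.nbr v).length,
      y (readNbr 2 4 R.encode v k) = decide (i.val / 2 ^ k.val % 2 = 1) ↔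
        finFunctionFinEquiv.symm i k = x ((R.nbr v).get k) := by
    intro k
    rw [R.readNbr_encode hle v k k.isLt, hy, h2 _ _ (Nat.mod_lt _ two_pos), Fin.ext_iff,
      finFunctionFinEquiv_symm_apply_val]
    rfl
  constructor
  · intro h k
    exact (key k).1 (h k (k.isLt.trans_le (hle v)) (by rw [R.readDeg_encode hle]; exact k.isLt))
  · intro h e _ hd
    rw [R.readDeg_encode hle] at hd
    exact (key ⟨e, hd⟩).2 (h _)

theorem exists_row_iff (hR : DegreeAtMost 4 R.Edge) {x : Fin n → Fin 2} {y : ℕ → Bool}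
    (hy : ∀ u : Fin n, y u = decide (x u = 1)) (v : Fin n) :
    (∃ i ≤ 15, RowTrue (readDeg 2 4 R.encode) (readLoc 2 4 R.encode) v i ∧
      RowMatches (readDeg 2 4 R.encode) (readNbr 2 4 R.encode) y v i 4) ↔ R.net x v = 1 := by
  have hle := R.length_nbr_le hR
  constructor
  · rintro ⟨i, -, ⟨hi, h1⟩, h2⟩
    rw [R.readDeg_encode hle] at hi
    rw [R.readLoc_encode hle v ⟨i, hi⟩, (R.rowMatches_iff hR hy v ⟨i, hi⟩).1 h2] at h1
    exact Fin.ext h1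
  · intro h
    have h16 : 2 ^ (R.nbr v).length ≤ 2 ^ 4 := Nat.pow_le_pow_right (by norm_num) (hle v)
    let i : Fin (2 ^ (R.nbr v).length) := finFunctionFinEquiv fun k => x ((R.nbr v).get k)
    have hi : finFunctionFinEquiv.symm i = fun k => x ((R.nbr v).get k) :=
      Equiv.symm_apply_apply _ _
    refine ⟨i, by have := i.isLt; omega, ⟨?_, ?_⟩, (R.rowMatches_iff hR hy v i).2 hi⟩
    · rw [R.readDeg_encode hle]
      exact i.isLt
    · rw [R.readLoc_encode hle v i, hi]
      exact congrArg Fin.val h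

end LocalMaps

section

variable (m : AlphabetCoding)

/-- The kind of the gate that computes the bit `j` of the code of a letter, given whether this
letter is `1`. -/
def codeKind (j : Fin (m.len 2)) : ℕ :=
  if m.code 2 0 j = m.code 2 1 j then (m.code 2 0 j).toNat else if m.code 2 1 j then 3 else 2

theorem codeKind_spec (j : Fin (m.len 2)) (s : Fin 2) :
    (if codeKind m j = 0 then false else if codeKind m j = 1 then true
      else if codeKind m j = 2 then !decide (s = 1)
      else if codeKind m j = 3 then decide (s = 1) && decide (s = 1)
      else decide (s = 1) || decide (s = 1)) = m.code 2 s j := by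
  unfold codeKind
  fin_cases s <;> cases h0 : m.code 2 0 j <;> cases h1 : m.code 2 1 j <;> simp [h0, h1]

theorem exists_code_ne : ∃ j, m.code 2 0 j ≠ m.code 2 1 j := by
  by_contra! h
  exact absurd (m.code_injective 2 (funext h)) (by decide)

variable [NeZero (m.len 2)] {n : ℕ} (R : LocalMaps 2 n) {js : Fin (m.len 2)}

/-- The circuit for a network of local maps over the alphabet `{0, 1}`. -/
noncomputable def bitCircuit (hR : DegreeAtMost 4 R.Edge) (js : Fin (m.len 2)) : Circuit :=
  mapsCircuit (k := m.len 2) (c1 := m.code 2 1 js)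
    (okind := fun r => codeKind m (Fin.ofNat (m.len 2) r)) (n := n)
    (loc := readLoc 2 4 R.encode) js.isLt (R.boundedGraph hR).nbr_lt

theorem bitCircuit_codes (hR : DegreeAtMost 4 R.Edge) (hjs : m.code 2 0 js ≠ m.code 2 1 js) :
    (bitCircuit m R hR js).Codes m ⟨n, R.net⟩ := by
  classical
  refine ⟨rfl, by simp [bitCircuit, mapsCircuit], fun x => ?_⟩
  change Fin n → Fin 2 at x
  have hk := m.len_pos 2
  have hX : (m.word x).length = m.len 2 * n := by rw [m.length_word, mul_comm]
  let y : ℕ → Bool := fun u => if h : u < n then decide (x ⟨u, h⟩ = 1) else false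
  have hy : ∀ u : Fin n, y u = decide (x u = 1) := fun u => dif_pos u.isLt
  have hcode : ∀ s : Fin 2, m.code 2 s js = (decide (s = 1) == m.code 2 1 js) := by
    intro s
    fin_cases s
    · revert hjs
      cases h0 : m.code 2 0 js <;> cases h1 : m.code 2 1 js <;> simp [h0]
    · simp
  have hy' : ∀ v < n, (m.word x).getD (v * m.len 2 + js) false = (y v == m.code 2 1 js) := by
    intro v hv
    have hd : (v * m.len 2 + js) / m.len 2 = v := by
      rw [mul_comm, Nat.mul_add_div hk, Nat.div_eq_of_lt js.isLt, add_zero]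
    have hm : Fin.ofNat (m.len 2) (v * m.len 2 + js) = js := by
      apply Fin.ext
      rw [Fin.val_ofNat, Nat.mul_add_mod_self_right, Nat.mod_eq_of_lt js.isLt]
    rw [m.getD_word x (hd.symm ▸ hv), hm, hcode, ← hy]
    simp only [hd]
  have hlen : (m.word (R.net x)).length = m.len 2 * n := by rw [m.length_word, mul_comm]
  have hval : ∀ r < m.len 2 * n, (bitCircuit m R hR js).val (m.word x)
      (m.len 2 * n + 98 * n + r) = (m.word (R.net x)).getD r false := by
    intro r hr
    have hv : r / m.len 2 < n := Nat.div_lt_of_lt_mul hr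
    have hor := mapsCircuit_or (loc := readLoc 2 4 R.encode)
      (okind := fun r => codeKind m (Fin.ofNat (m.len 2) r))
      js.isLt (R.boundedGraph hR).nbr_lt (R.boundedGraph hR).deg_le
      (V := (bitCircuit m R hR js).val (m.word x)) rfl hX hy' hv
      (i := 15) (by norm_num)
    rw [decide_eq_decide.2 (R.exists_row_iff hR hy ⟨r / m.len 2, hv⟩)] at hor
    have hgate := mapsCircuit_val (V := (bitCircuit m R hR js).val (m.word x))
      (c1 := m.code 2 1 js) (loc := readLoc 2 4 R.encode)
      (okind := fun r => codeKind m (Fin.ofNat (m.len 2) r))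
      js.isLt (R.boundedGraph hR).nbr_lt rfl hX (t := 98 * n + r) (by omega)
      (kind := codeKind m (Fin.ofNat (m.len 2) r))
      (i := m.len 2 * n + (2 * n + 96 * (r / m.len 2) + 6 * 15 + 5))
      (j := m.len 2 * n + (2 * n + 96 * (r / m.len 2) + 6 * 15 + 5))
      (by rw [mapsKind, if_neg (by omega), if_neg (by omega), Nat.add_sub_cancel_left])
      (by rw [mapsFst, if_neg (by omega), if_neg (by omega), Nat.add_sub_cancel_left]; omega)
      (by rw [mapsSnd, if_neg (by omega), if_neg (by omega), Nat.add_sub_cancel_left]; omega)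
    rw [hor, codeKind_spec, ← add_assoc] at hgate
    rw [m.getD_word _ hv]
    exact hgate
  rw [Circuit.eval_eq]
  apply List.ext_getElem
  · change _ = (m.word (R.net x)).length
    rw [hlen, List.length_map]
    simp [bitCircuit, mapsCircuit]
  · intro r h1 h2
    change r < (m.word (R.net x)).length at h2
    have h3 := hval r (hlen ▸ h2)
    rw [List.getD_eq_getElem _ _ h2] at h3
    rw [List.getElem_map]
    refine Eq.trans ?_ h3
    congr 1
    simp [bitCircuit, mapsCircuit]

/-- The encoding of the circuit for the network represented by a word. -/
noncomputable def bitWord (js : Fin (m.len 2)) (w : List Bool) : List Bool :=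
  mapsWord (m.len 2) js (m.code 2 1 js) (fun r => codeKind m (Fin.ofNat (m.len 2) r)) (readN w)
    (readDeg 2 4 w) (readNbr 2 4 w) (readLoc 2 4 w)

theorem bitCircuit_encode (hR : DegreeAtMost 4 R.Edge) :
    (bitCircuit m R hR js).encode = bitWord m js R.encode := by
  rw [bitCircuit, mapsCircuit_encode, bitWord, R.readN_encode]

end

section

variable {α : Type} [Enc α] (k js : ℕ) (c1 : Bool) (okind : ℕ → ℕ)

set_option synthInstance.maxHeartbeats 400000 in
set_option synthInstance.maxSize 2000 in
instance L.mapsKind [ho : ∀ (f : List Bool → α → ℕ) [L f], L fun w a => okind (f w a)]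
    (t : List Bool → α → ℕ) [ht : L t] :
    L fun w a => mapsKind c1 okind (readN w) (readDeg 2 4 w) (readLoc 2 4 w) (t w a) := by
  unfold AutNet.mapsKind
  infer_instance

set_option synthInstance.maxHeartbeats 400000 in
set_option synthInstance.maxSize 2000 in
instance L.mapsFst (t : List Bool → α → ℕ) [ht : L t] :
    L fun w a => mapsFst k js (readN w) (t w a) := by
  unfold AutNet.mapsFst
  infer_instance

set_option synthInstance.maxHeartbeats 400000 in
set_option synthInstance.maxSize 2000 in
instance L.mapsSnd (t : List Bool → α → ℕ) [ht : L t] :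
    L fun w a => mapsSnd k js (readN w) (readDeg 2 4 w) (readNbr 2 4 w) (t w a) := by
  unfold AutNet.mapsSnd
  infer_instance

end

set_option synthInstance.maxHeartbeats 400000 in
set_option synthInstance.maxSize 2000 in
theorem LO.bitWord (m : AlphabetCoding) [NeZero (m.len 2)] (js : Fin (m.len 2)) :
    LO fun w (_ : ℕ) => bitWord m js w := by
  have ho : ∀ (f : List Bool → ℕ × ℕ → ℕ) [L f],
      L fun w a => codeKind m (Fin.ofNat (m.len 2) (f w a)) := fun f _ =>
    L.apply_finite enc_fin_injective (codeKind m) (L.finOfNat _ f)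
  have hk := L.mapsKind (m.code 2 1 js) (fun r => codeKind m (Fin.ofNat (m.len 2) r)) (ho := ho)
    (fun _ a => a.2)
  unfold AutNet.bitWord mapsWord mapsGate
  infer_instance

/-- The representation of networks of monotone gates is standard. -/
theorem isStandard_monotoneFamily (m : AlphabetCoding) : monotoneFamily.IsStandard m := by
  have : NeZero (m.len 2) := ⟨(m.len_pos 2).ne'⟩
  obtain ⟨js, hjs⟩ := exists_code_ne m
  refine ⟨⟨bitWord m js, LO.logspaceComputable (LO.bitWord m js), ?_⟩, ?_⟩
  · rintro w ⟨n, F⟩ ⟨hF, R, rfl, hnet, hR⟩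
    refine ⟨hF, bitCircuit m R hR js, (bitCircuit_encode m R hR).symm, ?_⟩
    have h := bitCircuit_codes m R hR hjs
    change R.net = F at hnet
    rwa [hnet] at h
  · intro F hF
    obtain ⟨R, h1, h2⟩ := exists_localMaps hF
    exact ⟨R.encode, hF, R, rfl, h1, h2⟩

end AutNet

theorem mainTheorem10 (m : AutNet.AlphabetCoding) :
    AutNet.monotoneFamily.IsStandard m ∧
    AutNet.StronglyUniversal AutNet.monotoneFamily ∧
    AutNet.Universal m AutNet.monotoneFamily ∧
    ∀ (a : ℕ) (A : AutNet.Family a), A.IsStandard m →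
      AutNet.StronglyUniversal A → AutNet.Universal m A :=
  ⟨AutNet.isStandard_monotoneFamily m, AutNet.stronglyUniversal_monotoneFamily,
    AutNet.stronglyUniversal_monotoneFamily.universal m, fun _ _ _ h => h.universal m⟩
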